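/- **Words and queries.** For $k\ge 1$ let $D_k$ be the language of well-balanced strings over $k$ types of parentheses $\langle_1,\rangle_1,\dots,\langle_k,\rangle_k$. For a language $L\subseteq\Sigma^*$, the dynamic problem $\mathrm{RangeMember}(L)$ over the domain $[n]=\{0,\dots,n-1\}$ is about a sequence $w_0\dots w_{n-1}$ with $w_i\in\Sigma\cup\{\epsilon\}$, initially with all $w_i=\epsilon$. Its change operations are $\mathrm{set}_\sigma(i)$ for $\sigma\in\Sigma$ (sets $w_i$ to $\sigma$ if $w_i=\epsilon$) and $\mathrm{reset}(i)$ (sets $w_i$ to $\epsilon$). Its query operation $\mathrm{range}(\ell,r)$ asks whether $w_\ell\circ\dots\circ w_r\in L$ (the word is empty if $\ell>r$). **Terms and conditions.** Over a finite schema of relation symbols and (partial) function symbols and the domain $[n]$, *terms* are built from variables, $+$, $\times$ (undefined if the result is not in $[n]$), function symbols, if-then-else, and $\mathrm{unique}\ z\le g(n): C$, where it is required that whenever this is evaluated there is exactly one witness $z\in[n]$. *Conditions* are built from atoms (with $\le$, $=$ or a relation symbol; false if a term in them is undefined), Boolean connectives, and $\exists z\le g(n): C$. Here and below each bound $g:\mathbb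 N\to\mathbb N$ is first-order definable, that is, $\{z\in[n] : z\le g(n)\}$ is defined in all $[n]$ by one first-order formula over $\le,+,\times$. **Procedures.** A procedure is built from assignments $f(\bar y)\gets t$ and $R(\bar y)\gets C$ to local function and relation symbols (initially nowhere defined, resp. empty), sequential composition, conditional branches, parallel branches "for all $z\le g(n)$ in parallel do $P$" (each branch starts from the current local values; an assignment in their scope has the variables bound by the enclosing parallel branches as first arguments, so that different branches write to different places), and return statements, one at the end of each execution path and outside of parallel branches. **Programs.** A dynamic program has a finite auxiliary schema, an initial auxiliary structure on $[n]$ defined by first-order formulas over $\le,+,\times$, a query rule for each query operation $Q(\bar p)$, which is a procedure with variables $\bar p$ that returns a condition over the auxiliary structure and local symbols, and, for each change operation $\delta(\bar p)$ and each auxiliary symbol, an update rule. An update rule consists of an initial procedure $P_1$ without return statements, with variables $\bar p$, which is executed once, bounds $x_i\le g_i(n)$ for $i=1,\dots,m$, head terms $t_1(\bar p;\bar x),\dots,t_s(\bar p;\bar x)$, where $s$ is the arity of the symbol, and a main procedure $P_2(\bar p;\bar x)$. Rules are evaluated on the old auxiliary structure. For each tuple $\bar x\in[n]^m$ within the bounds,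 the relation (or function) at $(t_1,\dots,t_s)$ is set to the truth value (or value) that $P_2$ returns; for relations, true prevails if several $\bar x$ give the same tuple, and for functions such values have to agree. All other tuples keep their value. The program *maintains* a dynamic problem if for every $n$ and after every finite sequence of changes from the initial input, with the auxiliary structure updated accordingly, every rule can be executed in accordance with these requirements and every query is answered correctly. **Work.** The work of a term, condition or procedure is $1$ for a variable or the empty procedure, and otherwise the maximum of $1$ and of the work of its immediate parts (including arguments and returned expressions), except that $\mathrm{unique}\ z\le g(n):C$, $\exists z\le g(n):C$ and parallel branching over $z\le g(n)$ have $g(n)+1$ times the work of their body. The work of an update rule is $\max\big(w(P_1),\ \prod_{i=1}^m(g_i(n)+1)\cdot\max(w(P_2),w(t_1),\dots,w(t_s))\big)$. The work of a query rule is that of its procedure. A problem *can be maintained in DynFO with work $O(f)$ per change and $O(h)$ per query operation* if it is maintained by a dynamic program in which every update rule has work $O(f(n))$ and every query rule has work $O(h(n))$, as $n\to\infty$. **Theorem.** For all real $\varepsilon>0$ and all integers $k>1$: (a) $\mathrm{RangeMember}(D_1)$ can be maintained in DynFO with work $O(n^{\varepsilon})$ per change operation and $O(n^{\varepsilon})$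 per query operation; (b) $\mathrm{RangeMember}(D_k)$ can be maintained in DynFO with work $O(n^{\varepsilon})$ per change operation and $O(n^{1+\varepsilon})$ per query operation. -/

import Mathlib

/-! ## Dyck languages -/

/-- The alphabet of `k` types of parentheses. -/
inductive Paren (k : ℕ) : Type
  | op (i : Fin k) : Paren k
  | cl (i : Fin k) : Paren k

/-- Well-balanced strings of parentheses of `k` types. -/
inductive WellBalanced {k : ℕ} : List (Paren k) → Prop
  | nil : WellBalanced []
  | wrap (i : Fin k) {w : List (Paren k)} (h : WellBalanced w) :
      WellBalanced (Paren.op i :: (w ++ [Paren.cl i]))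
  | append {u v : List (Paren k)} (hu : WellBalanced u) (hv : WellBalanced v) : WellBalanced (u ++ v)

/-- The Dyck language `D_k`. -/
def dyck (k : ℕ) : Language (Paren k) := {w | WellBalanced w}

namespace DynFO

/-! ## Dynamic problems -/

/-- A dynamic problem: over each domain `{0, …, n-1}` there is a set of input objects with an
initial (empty) one, there are change operations, which modify the input object, and (relational)
query operations.  All operations take tuples of domain elements as parameters. -/
structure DynProblem where
  State : ℕ → Type
  empty : ∀ n, State n
  Chg : Type
  chgArity : Chg → ℕ
  change : ∀ {n} (δ : Chg), (Fin (chgArity δ) → Fin n) → State n → State n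
  Qry : Type
  qryArity : Qry → ℕ
  query : ∀ {n} (q : Qry), (Fin (qryArity q) → Fin n) → State n → Prop

/-- The change operations `set_σ(i)` and `reset(i)` on words. -/
inductive WordChange (α : Type) : Type
  | set (σ : α) : WordChange α
  | reset : WordChange α

/-- The word `w_ℓ ∘ ⋯ ∘ w_r`, where `none` stands for the empty word. -/
def factor {α : Type} {n : ℕ} (w : Fin n → Option α) (l r : Fin n) : List α :=
  (List.finRange n).filterMap fun i => if l ≤ i ∧ i ≤ r then w i else none

/-- The effect of a change operation at position `i`: `set_σ(i)` sets `w_i` to `σ` if it was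
empty before, and `reset(i)` makes `w_i` empty. -/
def WordChange.apply {α : Type} {n : ℕ} (w : Fin n → Option α) (i : Fin n) :
    WordChange α → (Fin n → Option α)
  | .set σ => Function.update w i (if w i = none then some σ else w i)
  | .reset => Function.update w i none

/-- The dynamic problem `RangeMember(L)`: change operations `set_σ(i)` and `reset(i)`,
query operation `range(ℓ, r)`, asking whether `w_ℓ ∘ ⋯ ∘ w_r ∈ L`. -/
abbrev RangeMember {α : Type} (L : Language α) : DynProblem where
  State n := Fin n → Option α
  empty _ := fun _ => none
  Chg := WordChange α
  chgArity _ := 1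
  change δ p w := δ.apply w (p 0)
  Qry := Unit
  qryArity _ := 2
  query _ p w := factor w (p 0) (p 1) ∈ L

/-! ## First-order logic with linear order, addition and multiplication on `{0, …, n-1}` -/

inductive ArithRel : ℕ → Type
  | le : ArithRel 2
  | add : ArithRel 3
  | mul : ArithRel 3

/-- The relational language with `≤` and the graphs of `+` and `×`. -/
def arith : FirstOrder.Language := ⟨fun _ => Empty, ArithRel⟩

/-- The interpretation of an arithmetical symbol on `{0, …, n-1}`. -/
def ArithRel.holds {n : ℕ} : {k : ℕ} → ArithRel k → (Fin k → Fin n) → Prop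
  | _, .le, v => (v 0 : ℕ) ≤ v 1
  | _, .add, v => (v 0 : ℕ) + v 1 = v 2
  | _, .mul, v => (v 0 : ℕ) * v 1 = v 2

instance arithStructure (n : ℕ) : arith.Structure (Fin n) where
  funMap f := Empty.elim f
  RelMap r v := ArithRel.holds r v

/-- A function `g : ℕ → ℕ` for which the range `z ≤ g(n)` is definable in all domains
`{0, …, n-1}` by one first-order formula with `≤`, `+` and `×`. -/
structure Bound where
  val : ℕ → ℕ
  definable : ∃ φ : arith.Formula (Fin 1), ∀ (n : ℕ) (z : Fin n),
    φ.Realize (fun _ => z) ↔ (z : ℕ) ≤ val n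

/-! ## Schemas and structures -/

/-- A finite schema of relation symbols and function symbols. -/
structure Schema where
  Rel : Type
  Fn : Type
  relArity : Rel → ℕ
  fnArity : Fn → ℕ
  finiteRel : Finite Rel
  finiteFn : Finite Fn

/-- The disjoint union of two schemas. -/
abbrev Schema.sum (σ τ : Schema) : Schema where
  Rel := σ.Rel ⊕ τ.Rel
  Fn := σ.Fn ⊕ τ.Fn
  relArity := Sum.elim σ.relArity τ.relArity
  fnArity := Sum.elim σ.fnArity τ.fnArity
  finiteRel := by have := σ.finiteRel; have := τ.finiteRel; infer_instance
  finiteFn := by have := σ.finiteFn; have := τ.finiteFn; infer_instance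

/-- A structure with domain `{0, …, n-1}`; functions may be partial (`none` is `⊥`). -/
structure Interp (σ : Schema) (n : ℕ) where
  rel : (R : σ.Rel) → (Fin (σ.relArity R) → Fin n) → Prop
  fn : (f : σ.Fn) → (Fin (σ.fnArity f) → Fin n) → Option (Fin n)

/-- The structure with empty relations and nowhere defined functions. -/
def Interp.empty (σ : Schema) (n : ℕ) : Interp σ n := ⟨fun _ _ => False, fun _ _ => none⟩

def Interp.sum {σ τ : Schema} {n : ℕ} (A : Interp σ n) (B : Interp τ n) :
    Interp (σ.sum τ) n where
  rel
    | .inl R => A.rel R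
    | .inr R => B.rel R
  fn
    | .inl f => A.fn f
    | .inr f => B.fn f

/-! ## Terms and conditions -/

mutual

/-- Terms with `m` variables. In `unique g c` the last variable of `c` is the bound one. -/
inductive Tm (σ : Schema) : ℕ → Type
  | var {m : ℕ} (i : Fin m) : Tm σ m
  | add {m : ℕ} (s t : Tm σ m) : Tm σ m
  | mul {m : ℕ} (s t : Tm σ m) : Tm σ m
  | app {m : ℕ} (f : σ.Fn) (args : Fin (σ.fnArity f) → Tm σ m) : Tm σ m
  | ite {m : ℕ} (c : Cnd σ m) (s t : Tm σ m) : Tm σ m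
  | unique {m : ℕ} (g : Bound) (c : Cnd σ (m + 1)) : Tm σ m

/-- Conditions with `m` variables. In `ex g c` the last variable of `c` is the bound one. -/
inductive Cnd (σ : Schema) : ℕ → Type
  | le {m : ℕ} (s t : Tm σ m) : Cnd σ m
  | eq {m : ℕ} (s t : Tm σ m) : Cnd σ m
  | rel {m : ℕ} (R : σ.Rel) (args : Fin (σ.relArity R) → Tm σ m) : Cnd σ m
  | not {m : ℕ} (c : Cnd σ m) : Cnd σ m
  | and {m : ℕ} (c d : Cnd σ m) : Cnd σ m
  | or {m : ℕ} (c d : Cnd σ m) : Cnd σ m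
  | ex {m : ℕ} (g : Bound) (c : Cnd σ (m + 1)) : Cnd σ m

end

/-- The domain element with value `a`, undefined if there is none. -/
def toDomain (n a : ℕ) : Option (Fin n) := if h : a < n then some ⟨a, h⟩ else none

open Classical in
/-- The tuple of the values of all components, undefined if one of them is. -/
noncomputable def tuple {β : Type} {k : ℕ} (o : Fin k → Option β) : Option (Fin k → β) :=
  if h : ∃ u : Fin k → β, ∀ i, o i = some (u i) then some h.choose else none

mutual

/-- The value of a term (`none` is `⊥`). Undefinedness propagates through functions. -/
noncomputable def Tm.eval {σ : Schema} {n : ℕ} (A : Interp σ n) :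
    {m : ℕ} → Tm σ m → (Fin m → Fin n) → Option (Fin n)
  | _, .var i, v => some (v i)
  | _, .add s t, v => (s.eval A v).bind fun a => (t.eval A v).bind fun b => toDomain n (a + b)
  | _, .mul s t, v => (s.eval A v).bind fun a => (t.eval A v).bind fun b => toDomain n (a * b)
  | _, .app f args, v => (tuple fun i => (args i).eval A v).bind (A.fn f)
  | _, .ite c s t, v => open Classical in if c.eval A v then s.eval A v else t.eval A v
  | _, .unique g c, v => open Classical in
      if h : ∃! a : Fin n, (a : ℕ) ≤ g.val n ∧ c.eval A (Fin.snoc v a) then some h.choose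
      else none

/-- The truth value of a condition. Atoms with undefined terms are false. -/
noncomputable def Cnd.eval {σ : Schema} {n : ℕ} (A : Interp σ n) :
    {m : ℕ} → Cnd σ m → (Fin m → Fin n) → Prop
  | _, .le s t, v => ∃ a b, s.eval A v = some a ∧ t.eval A v = some b ∧ a ≤ b
  | _, .eq s t, v => ∃ a, s.eval A v = some a ∧ t.eval A v = some a
  | _, .rel R args, v => ∃ u, (∀ i, (args i).eval A v = some (u i)) ∧ A.rel R u
  | _, .not c, v => ¬ c.eval A v
  | _, .and c d, v => c.eval A v ∧ d.eval A v
  | _, .or c d, v => c.eval A v ∨ d.eval A v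
  | _, .ex g c, v => ∃ a : Fin n, (a : ℕ) ≤ g.val n ∧ c.eval A (Fin.snoc v a)

end

mutual

/-- Every `unique`-expression that is evaluated has exactly one witness. -/
def Tm.Safe {σ : Schema} {n : ℕ} (A : Interp σ n) :
    {m : ℕ} → Tm σ m → (Fin m → Fin n) → Prop
  | _, .var _, _ => True
  | _, .add s t, v => s.Safe A v ∧ t.Safe A v
  | _, .mul s t, v => s.Safe A v ∧ t.Safe A v
  | _, .app _ args, v => ∀ i, (args i).Safe A v
  | _, .ite c s t, v =>
      c.Safe A v ∧ (c.eval A v → s.Safe A v) ∧ (¬ c.eval A v → t.Safe A v)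
  | _, .unique g c, v =>
      (∀ a : Fin n, (a : ℕ) ≤ g.val n → c.Safe A (Fin.snoc v a)) ∧
        ∃! a : Fin n, (a : ℕ) ≤ g.val n ∧ c.eval A (Fin.snoc v a)

/-- Every `unique`-expression that is evaluated has exactly one witness. -/
def Cnd.Safe {σ : Schema} {n : ℕ} (A : Interp σ n) :
    {m : ℕ} → Cnd σ m → (Fin m → Fin n) → Prop
  | _, .le s t, v => s.Safe A v ∧ t.Safe A v
  | _, .eq s t, v => s.Safe A v ∧ t.Safe A v
  | _, .rel _ args, v => ∀ i, (args i).Safe A v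
  | _, .not c, v => c.Safe A v
  | _, .and c d, v => c.Safe A v ∧ d.Safe A v
  | _, .or c d, v => c.Safe A v ∧ d.Safe A v
  | _, .ex g c, v => ∀ a : Fin n, (a : ℕ) ≤ g.val n → c.Safe A (Fin.snoc v a)

end

mutual

/-- The work of evaluating a term over a domain of size `n`. There are at most `g(n) + 1`
elements `z ≤ g(n)`. -/
def Tm.work {σ : Schema} (n : ℕ) : {m : ℕ} → Tm σ m → ℕ
  | _, .var _ => 1
  | _, .add s t => max (s.work n) (t.work n)
  | _, .mul s t => max (s.work n) (t.work n)
  | _, .app _ args => max 1 (Finset.univ.sup fun i => (args i).work n)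
  | _, .ite c s t => max (c.work n) (max (s.work n) (t.work n))
  | _, .unique g c => (g.val n + 1) * c.work n

/-- The work of evaluating a condition over a domain of size `n`. -/
def Cnd.work {σ : Schema} (n : ℕ) : {m : ℕ} → Cnd σ m → ℕ
  | _, .le s t => max (s.work n) (t.work n)
  | _, .eq s t => max (s.work n) (t.work n)
  | _, .rel _ args => max 1 (Finset.univ.sup fun i => (args i).work n)
  | _, .not c => c.work n
  | _, .and c d => max (c.work n) (d.work n)
  | _, .or c d => max (c.work n) (d.work n)
  | _, .ex g c => (g.val n + 1) * c.work n

end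

/-! ## Procedures -/

/-- Return-free procedures over the auxiliary schema `τ`, assigning values to the symbols of a
local schema `loc`. There are `b` global variables, followed by `d` variables that are bound by
enclosing parallel branches. In an assignment, the latter have to be the first `d` arguments of
the assigned symbol, so that different parallel branches write to different places. -/
inductive Step (τ loc : Schema) (b : ℕ) : ℕ → Type
  | skip {d : ℕ} : Step τ loc b d
  | seq {d : ℕ} (P Q : Step τ loc b d) : Step τ loc b d
  | assignFn {d : ℕ} (f : loc.Fn) (args : Fin (loc.fnArity f) → Tm (τ.sum loc) (b + d))
      (t : Tm (τ.sum loc) (b + d))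
      (guarded : ∀ j : Fin d, ∃ hj : (j : ℕ) < loc.fnArity f,
        args ⟨j, hj⟩ = Tm.var (Fin.natAdd b j)) : Step τ loc b d
  | assignRel {d : ℕ} (R : loc.Rel) (args : Fin (loc.relArity R) → Tm (τ.sum loc) (b + d))
      (c : Cnd (τ.sum loc) (b + d))
      (guarded : ∀ j : Fin d, ∃ hj : (j : ℕ) < loc.relArity R,
        args ⟨j, hj⟩ = Tm.var (Fin.natAdd b j)) : Step τ loc b d
  | ite {d : ℕ} (c : Cnd (τ.sum loc) (b + d)) (P Q : Step τ loc b d) : Step τ loc b d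
  | par {d : ℕ} (g : Bound) (P : Step τ loc b (d + 1)) : Step τ loc b d

open Classical in
/-- The local structure after the execution of a procedure. For `par g P`, the branches are
executed independently, starting from the current local structure, and the branch for `z` is
the only one that writes to tuples with `z` at position `d`. -/
noncomputable def Step.run {τ loc : Schema} {b n : ℕ} (A : Interp τ n) :
    {d : ℕ} → Step τ loc b d → (Fin (b + d) → Fin n) → Interp loc n → Interp loc n
  | _, .skip, _, L => L
  | _, .seq P Q, v, L => Q.run A v (P.run A v L)
  | _, .assignFn f args t _, v, L =>
      { L with fn := Function.update L.fn f fun u =>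
          if ∀ i, (args i).eval (A.sum L) v = some (u i) then t.eval (A.sum L) v
          else L.fn f u }
  | _, .assignRel R args c _, v, L =>
      { L with rel := Function.update L.rel R fun u =>
          if ∀ i, (args i).eval (A.sum L) v = some (u i) then c.eval (A.sum L) v
          else L.rel R u }
  | _, .ite c P Q, v, L => if c.eval (A.sum L) v then P.run A v L else Q.run A v L
  | d, .par g P, v, L =>
      { fn := fun f u =>
          if h : ∃ hd : d < loc.fnArity f, (u ⟨d, hd⟩ : ℕ) ≤ g.val n then
            (P.run A (Fin.snoc v (u ⟨d, h.1⟩)) L).fn f u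
          else L.fn f u
        rel := fun R u =>
          if h : ∃ hd : d < loc.relArity R, (u ⟨d, hd⟩ : ℕ) ≤ g.val n then
            (P.run A (Fin.snoc v (u ⟨d, h.1⟩)) L).rel R u
          else L.rel R u }

/-- All terms and conditions that are evaluated during the execution are safe. -/
def Step.Safe {τ loc : Schema} {b n : ℕ} (A : Interp τ n) :
    {d : ℕ} → Step τ loc b d → (Fin (b + d) → Fin n) → Interp loc n → Prop
  | _, .skip, _, _ => True
  | _, .seq P Q, v, L => P.Safe A v L ∧ Q.Safe A v (P.run A v L)
  | _, .assignFn _ args t _, v, L => (∀ i, (args i).Safe (A.sum L) v) ∧ t.Safe (A.sum L) v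
  | _, .assignRel _ args c _, v, L => (∀ i, (args i).Safe (A.sum L) v) ∧ c.Safe (A.sum L) v
  | _, .ite c P Q, v, L => c.Safe (A.sum L) v ∧
      (c.eval (A.sum L) v → P.Safe A v L) ∧ (¬ c.eval (A.sum L) v → Q.Safe A v L)
  | _, .par g P, v, L => ∀ a : Fin n, (a : ℕ) ≤ g.val n → P.Safe A (Fin.snoc v a) L

def Step.work {τ loc : Schema} {b : ℕ} (n : ℕ) : {d : ℕ} → Step τ loc b d → ℕ
  | _, .skip => 1
  | _, .seq P Q => max (P.work n) (Q.work n)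
  | _, .assignFn _ args t _ => max (t.work n) (Finset.univ.sup fun i => (args i).work n)
  | _, .assignRel _ args c _ => max (c.work n) (Finset.univ.sup fun i => (args i).work n)
  | _, .ite c P Q => max (c.work n) (max (P.work n) (Q.work n))
  | _, .par g P => (g.val n + 1) * P.work n

/-- Procedures in which every execution path ends with a return statement, outside of parallel
branches. The type `E` of what can be returned is a type of terms or of conditions. -/
inductive Proc (τ loc : Schema) (b : ℕ) (E : Type) : Type
  | ret (e : E) : Proc τ loc b E
  | step (S : Step τ loc b 0) (M : Proc τ loc b E) : Proc τ loc b E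
  | ite (c : Cnd (τ.sum loc) b) (M N : Proc τ loc b E) : Proc τ loc b E

open Classical in
/-- The expression that is returned, and the local structure in which it has to be evaluated. -/
noncomputable def Proc.run {τ loc : Schema} {b n : ℕ} {E : Type} (A : Interp τ n)
    (v : Fin b → Fin n) : Proc τ loc b E → Interp loc n → E × Interp loc n
  | .ret e, L => (e, L)
  | .step S M, L => M.run A v (S.run A v L)
  | .ite c M N, L => if c.eval (A.sum L) v then M.run A v L else N.run A v L

/-- All terms and conditions that are evaluated before the return statement are safe. -/
def Proc.Safe {τ loc : Schema} {b n : ℕ} {E : Type} (A : Interp τ n)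
    (v : Fin b → Fin n) : Proc τ loc b E → Interp loc n → Prop
  | .ret _, _ => True
  | .step S M, L => S.Safe A v L ∧ M.Safe A v (S.run A v L)
  | .ite c M N, L => c.Safe (A.sum L) v ∧
      (c.eval (A.sum L) v → M.Safe A v L) ∧ (¬ c.eval (A.sum L) v → N.Safe A v L)

/-- The work of a procedure, where `workE` is the work of evaluating a returned expression. -/
def Proc.work {τ loc : Schema} {b : ℕ} {E : Type} (n : ℕ) (workE : E → ℕ) :
    Proc τ loc b E → ℕ
  | .ret e => workE e
  | .step S M => max (S.work n) (M.work n workE)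
  | .ite c M N => max (c.work n) (max (M.work n workE) (N.work n workE))

/-! ## Update rules and query rules -/

/-- An update rule for a `k`-ary symbol and a change operation with parameters
`p_1, …, p_a`: for all tuples `x_1, …, x_ell` with `x_i ≤ g_i(n)`, update the symbol at the tuple
given by the terms `head`, by what `main` returns after the initial procedure `pre`, which
does not depend on `x`, has been executed. Here `E` is `Tm` for function symbols and `Cnd` for
relation symbols. -/
structure Rule (τ : Schema) (a k : ℕ) (E : Schema → ℕ → Type) where
  loc : Schema
  ell : ℕ
  bound : Fin ell → Bound
  head : Fin k → Tm τ (a + ell)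
  pre : Step τ loc a 0
  main : Proc τ loc (a + ell) (E (τ.sum loc) (a + ell))

namespace Rule

variable {τ : Schema} {a k n : ℕ} {E : Schema → ℕ → Type}

/-- `x` satisfies the constraint of the rule. -/
def Admissible (ρ : Rule τ a k E) (x : Fin ρ.ell → Fin n) : Prop :=
  ∀ i, (x i : ℕ) ≤ (ρ.bound i).val n

/-- For the admissible tuple `x`, the rule updates the symbol at `u`. -/
def Hits (ρ : Rule τ a k E) (A : Interp τ n) (p : Fin a → Fin n) (x : Fin ρ.ell → Fin n)
    (u : Fin k → Fin n) : Prop :=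
  ρ.Admissible x ∧ ∀ i, (ρ.head i).eval A (Fin.append p x) = some (u i)

/-- The local structure after the initial procedure. -/
noncomputable def locals (ρ : Rule τ a k E) (A : Interp τ n) (p : Fin a → Fin n) :
    Interp ρ.loc n :=
  ρ.pre.run A p (Interp.empty ρ.loc n)

/-- What the main procedure returns for `x`. -/
noncomputable def outcome (ρ : Rule τ a k E) (A : Interp τ n) (p : Fin a → Fin n)
    (x : Fin ρ.ell → Fin n) : E (τ.sum ρ.loc) (a + ρ.ell) × Interp ρ.loc n :=
  ρ.main.run A (Fin.append p x) (ρ.locals A p)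

/-- All terms and conditions that are evaluated, up to the return statements, are safe. -/
def BaseSafe (ρ : Rule τ a k E) (A : Interp τ n) (p : Fin a → Fin n) : Prop :=
  ρ.pre.Safe A p (Interp.empty ρ.loc n) ∧
    ∀ x : Fin ρ.ell → Fin n, ρ.Admissible x →
      (∀ i, (ρ.head i).Safe A (Fin.append p x)) ∧
        ρ.main.Safe A (Fin.append p x) (ρ.locals A p)

/-- The initial procedure is executed once, the rest for each tuple `x`. -/
def work (ρ : Rule τ a k E) (n : ℕ) (workE : E (τ.sum ρ.loc) (a + ρ.ell) → ℕ) : ℕ :=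
  max (ρ.pre.work n) ((∏ i, ((ρ.bound i).val n + 1)) *
    max (Finset.univ.sup fun i => (ρ.head i).work n) (ρ.main.work n workE))

end Rule

section

variable {τ : Schema} {a k n : ℕ}

/-- The main procedure of an update rule for a relation returns true for `x`. -/
noncomputable def relResult (ρ : Rule τ a k Cnd) (A : Interp τ n) (p : Fin a → Fin n)
    (x : Fin ρ.ell → Fin n) : Prop :=
  (ρ.outcome A p x).1.eval (A.sum (ρ.outcome A p x).2) (Fin.append p x)

/-- The value that the main procedure of an update rule for a function returns for `x`. -/
noncomputable def fnResult (ρ : Rule τ a k Tm) (A : Interp τ n) (p : Fin a → Fin n)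
    (x : Fin ρ.ell → Fin n) : Option (Fin n) :=
  (ρ.outcome A p x).1.eval (A.sum (ρ.outcome A p x).2) (Fin.append p x)

/-- The execution of the rule for a relation is well-defined. -/
def relSafe (ρ : Rule τ a k Cnd) (A : Interp τ n) (p : Fin a → Fin n) : Prop :=
  ρ.BaseSafe A p ∧ ∀ x, ρ.Admissible x →
    (ρ.outcome A p x).1.Safe (A.sum (ρ.outcome A p x).2) (Fin.append p x)

/-- The execution of the rule for a function is well-defined; in particular, no two different
values are written to the same place. -/
def fnSafe (ρ : Rule τ a k Tm) (A : Interp τ n) (p : Fin a → Fin n) : Prop :=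
  ρ.BaseSafe A p ∧
    (∀ x, ρ.Admissible x →
      (ρ.outcome A p x).1.Safe (A.sum (ρ.outcome A p x).2) (Fin.append p x)) ∧
    ∀ x y u, ρ.Hits A p x u → ρ.Hits A p y u → fnResult ρ A p x = fnResult ρ A p y

/-- The updated relation. -/
def updateRel (ρ : Rule τ a k Cnd) (A : Interp τ n) (p : Fin a → Fin n)
    (old : (Fin k → Fin n) → Prop) (u : Fin k → Fin n) : Prop :=
  (∃ x, ρ.Hits A p x u ∧ relResult ρ A p x) ∨ (old u ∧ ¬ ∃ x, ρ.Hits A p x u)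

open Classical in
/-- The updated function. -/
noncomputable def updateFn (ρ : Rule τ a k Tm) (A : Interp τ n) (p : Fin a → Fin n)
    (old : (Fin k → Fin n) → Option (Fin n)) (u : Fin k → Fin n) : Option (Fin n) :=
  if h : ∃ x, ρ.Hits A p x u then fnResult ρ A p h.choose else old u

end

/-- A query rule for a relational query with `a` parameters. -/
structure QueryRule (τ : Schema) (a : ℕ) where
  loc : Schema
  body : Proc τ loc a (Cnd (τ.sum loc) a)

namespace QueryRule

variable {τ : Schema} {a n : ℕ}

noncomputable def outcome (ρ : QueryRule τ a) (A : Interp τ n) (p : Fin a → Fin n) :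
    Cnd (τ.sum ρ.loc) a × Interp ρ.loc n :=
  ρ.body.run A p (Interp.empty ρ.loc n)

/-- The query rule returns true. -/
noncomputable def Holds (ρ : QueryRule τ a) (A : Interp τ n) (p : Fin a → Fin n) : Prop :=
  (ρ.outcome A p).1.eval (A.sum (ρ.outcome A p).2) p

/-- The execution of the query rule is well-defined. -/
def Safe (ρ : QueryRule τ a) (A : Interp τ n) (p : Fin a → Fin n) : Prop :=
  ρ.body.Safe A p (Interp.empty ρ.loc n) ∧
    (ρ.outcome A p).1.Safe (A.sum (ρ.outcome A p).2) p

def work (ρ : QueryRule τ a) (n : ℕ) : ℕ := ρ.body.work n (Cnd.work n)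

end QueryRule

/-! ## Dynamic programs -/

/-- A dynamic program for the operations of a dynamic problem. The initial auxiliary structure
is given by first-order formulas with `≤`, `+` and `×`; those for functions define graphs.
Programs are self-contained: they do not call other dynamic programs as subroutines. -/
structure Program (Pb : DynProblem) where
  aux : Schema
  initRel : (R : aux.Rel) → arith.Formula (Fin (aux.relArity R))
  initFn : (f : aux.Fn) → arith.Formula (Fin (aux.fnArity f + 1))
  relRule : (δ : Pb.Chg) → (R : aux.Rel) → Rule aux (Pb.chgArity δ) (aux.relArity R) Cnd
  fnRule : (δ : Pb.Chg) → (f : aux.Fn) → Rule aux (Pb.chgArity δ) (aux.fnArity f) Tm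
  qryRule : (q : Pb.Qry) → QueryRule aux (Pb.qryArity q)

namespace Program

variable {Pb : DynProblem}

open Classical in
/-- The initial auxiliary structure: `f(u) = a` if `a` is the unique element for which the
formula for `f` holds for `(u, a)`. -/
noncomputable def start (P : Program Pb) (n : ℕ) : Interp P.aux n where
  rel R u := (P.initRel R).Realize u
  fn f u :=
    if h : ∃! a : Fin n, (P.initFn f).Realize (Fin.snoc u a : Fin (P.aux.fnArity f + 1) → Fin n)
    then some h.choose else none

/-- The auxiliary structure after the change operation `δ(p)`; all update rules are evaluated
on the old auxiliary structure. -/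
noncomputable def update (P : Program Pb) {n : ℕ} (δ : Pb.Chg) (p : Fin (Pb.chgArity δ) → Fin n)
    (A : Interp P.aux n) : Interp P.aux n where
  rel R := updateRel (P.relRule δ R) A p (A.rel R)
  fn f := updateFn (P.fnRule δ f) A p (A.fn f)

/-- `P.Reach I A`: some sequence of change operations leads from the empty input to `I` and from
the initial auxiliary structure to `A`. -/
inductive Reach (P : Program Pb) {n : ℕ} : Pb.State n → Interp P.aux n → Prop
  | start : Reach P (Pb.empty n) (P.start n)
  | change {I : Pb.State n} {A : Interp P.aux n} (h : Reach P I A) (δ : Pb.Chg)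
      (p : Fin (Pb.chgArity δ) → Fin n) : Reach P (Pb.change δ p I) (P.update δ p A)

/-- `P` is a dynamic program for `Pb`: after every sequence of change operations, the execution
of every rule is well-defined and all queries are answered correctly. -/
def Maintains (P : Program Pb) : Prop :=
  ∀ (n : ℕ) (I : Pb.State n) (A : Interp P.aux n), P.Reach I A →
    (∀ δ p, (∀ R, relSafe (P.relRule δ R) A p) ∧ (∀ f, fnSafe (P.fnRule δ f) A p)) ∧
    (∀ q p, (P.qryRule q).Safe A p ∧ ((P.qryRule q).Holds A p ↔ Pb.query q p I))

/-- Each update rule has work `O(w)`. -/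
def ChangeWork (P : Program Pb) (w : ℕ → ℝ) : Prop :=
  ∀ δ, (∀ R, Asymptotics.IsBigO Filter.atTop
      (fun n => ((P.relRule δ R).work n (Cnd.work n) : ℝ)) w) ∧
    (∀ f, Asymptotics.IsBigO Filter.atTop
      (fun n => ((P.fnRule δ f).work n (Tm.work n) : ℝ)) w)

/-- Each query rule has work `O(w)`. -/
def QueryWork (P : Program Pb) (w : ℕ → ℝ) : Prop :=
  ∀ q, Asymptotics.IsBigO Filter.atTop (fun n => ((P.qryRule q).work n : ℝ)) w

end Program

/-- `Pb` can be maintained in DynFO with work `O(wc)` per change operation and `O(wq)` per query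
operation. -/
def MaintainableWithWork (Pb : DynProblem) (wc wq : ℕ → ℝ) : Prop :=
  ∃ P : Program Pb, P.Maintains ∧ P.ChangeWork wc ∧ P.QueryWork wq

end DynFO

/-! ## Heights and the Dyck language -/

-- Let the height of a position be the number of opening minus closing parentheses before it. A
-- range is well-balanced up to types iff its height never drops below the initial one and returns
-- to it at the end. It is well-balanced iff moreover each closing parenthesis has the type of its
-- match, which stands at the last earlier position of smaller height (`wellBalanced_seg_iff`). So
-- the program has to compare heights, find minimal heights in intervals, and find matches.
--
-- Fix `K` and let `B` be about the `(K+1)`-st root of `n`, with `n ≤ B ^ (K+1)`. The positions are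
-- the leaves of a `B`-ary tree of depth `K + 1`: the block of `i` at level `s` is `i / B ^ s`, and
-- the children of `c` are `c * B + a` with `a < B`. Two kinds of data are stored per block: the
-- numbers of opening and of closing parentheses in its left siblings, and a position of minimal
-- height in it. Prefix counts are sums of `K + 1` stored numbers (`num_countT`), so heights are
-- compared with a constant number of lookups (`eval_heightLe`).
--
-- A change at `p` affects the sibling counts only among the children of ancestors of `p`, at most
-- `B` per level and each by at most one (`num_changedT`). Stored minima stay correct in blocks
-- without `p`, since all heights there shift by the same amount (`IsArgmin.congr`). The minima of
-- the ancestors of `p` are recomputed bottom-up, each time choosing a best child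
-- (`isArgmin_num_newArgminT`). This costs at most `B ^ 4`, and `Represents.update` shows that the
-- invariant `Represents` is preserved.
--
-- For a query, the positions strictly between `l` and `r` are covered by siblings of the ancestors
-- of `l` and of `r`, so that the height condition needs only `B` stored minima per level
-- (`eval_balancedC`). With one type nothing else is required. With several types, every position of
-- the domain looks for its match in parallel by descending from the root, always into the rightmost
-- child that contains an earlier, lower position (`num_matchT`, `num_descend`). This accounts for
-- the additional factor `n`. Choosing `4 / (K + 1) ≤ ε` gives the bounds.

/-- Whether a parenthesis is an opening one. -/
def Paren.isOp {k : ℕ} : Paren k → Bool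
  | .op _ => true
  | .cl _ => false

namespace DynFO

section Heights

variable {k : ℕ}

/-- The number of positions in `D` that carry an opening (`b = true`) or a closing (`b = false`)
parenthesis. -/
def parenCount (w : ℕ → Option (Paren k)) (b : Bool) (D : Finset ℕ) : ℕ :=
  (D.filter fun j => (w j).map Paren.isOp = some b).card

theorem parenCount_union (w : ℕ → Option (Paren k)) (b : Bool) {D E : Finset ℕ}
    (h : Disjoint D E) : parenCount w b (D ∪ E) = parenCount w b D + parenCount w b E := by
  unfold parenCount
  rw [Finset.filter_union, Finset.card_union_of_disjoint]
  exact Finset.disjoint_filter_filter h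

theorem parenCount_congr {w w' : ℕ → Option (Paren k)} {b : Bool} {D : Finset ℕ}
    (h : ∀ j ∈ D, ((w j).map Paren.isOp = some b ↔ (w' j).map Paren.isOp = some b)) :
    parenCount w b D = parenCount w' b D := by
  unfold parenCount
  rw [Finset.filter_congr h]

theorem parenCount_eq_succ {w w' : ℕ → Option (Paren k)} {b : Bool} {D : Finset ℕ} {p : ℕ}
    (hp : p ∈ D) (h : ∀ j, j ≠ p → w' j = w j) (h₀ : (w p).map Paren.isOp ≠ some b)
    (h₁ : (w' p).map Paren.isOp = some b) : parenCount w' b D = parenCount w b D + 1 := by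
  unfold parenCount
  have : D.filter (fun j => (w' j).map Paren.isOp = some b) =
      insert p (D.filter fun j => (w j).map Paren.isOp = some b) := by
    ext j
    by_cases hj : j = p
    · subst hj; simpa [hp] using h₁
    · simp [hj, h j hj]
  rw [this, Finset.card_insert_of_notMem]
  exact fun hm => h₀ (Finset.mem_filter.1 hm).2

/-- A position carries at most one parenthesis. This later keeps sums of an opening and a closing
count inside the domain. -/
theorem parenCount_true_add_false_le (w : ℕ → Option (Paren k)) (D : Finset ℕ) :
    parenCount w true D + parenCount w false D ≤ D.card := by
  unfold parenCount
  rw [← Finset.card_union_of_disjoint]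
  · exact Finset.card_le_card (by
      intro j; simp only [Finset.mem_union, Finset.mem_filter]; tauto)
  · rw [Finset.disjoint_filter]
    intro j _ h1 h2
    simp [h1] at h2

theorem parenCount_mono (w : ℕ → Option (Paren k)) (b : Bool) {D E : Finset ℕ} (h : D ⊆ E) :
    parenCount w b D ≤ parenCount w b E :=
  Finset.card_le_card (Finset.filter_subset_filter _ h)

/-- The height before position `i`. -/
def height (w : ℕ → Option (Paren k)) (i : ℕ) : ℤ :=
  parenCount w true (Finset.range i) - parenCount w false (Finset.range i)

theorem parenCount_range_succ (w : ℕ → Option (Paren k)) (b : Bool) (i : ℕ) :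
    parenCount w b (Finset.range (i + 1)) = parenCount w b (Finset.range i) +
      if (w i).map Paren.isOp = some b then 1 else 0 := by
  unfold parenCount
  rw [Finset.range_add_one, Finset.filter_insert]
  split_ifs
  · rw [Finset.card_insert_of_notMem (by simp)]
  · rfl

theorem height_succ_none {w : ℕ → Option (Paren k)} {i : ℕ} (h : w i = none) :
    height w (i + 1) = height w i := by
  simp [height, parenCount_range_succ, h]

theorem height_succ_op {w : ℕ → Option (Paren k)} {i : ℕ} {t : Fin k} (h : w i = some (.op t)) :
    height w (i + 1) = height w i + 1 := by
  simp [height, parenCount_range_succ, h, Paren.isOp]; ring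

theorem height_succ_cl {w : ℕ → Option (Paren k)} {i : ℕ} {t : Fin k} (h : w i = some (.cl t)) :
    height w (i + 1) = height w i - 1 := by
  simp [height, parenCount_range_succ, h, Paren.isOp]; ring

-- Segments of a word and decompositions of well-balanced strings

/-- The word at the positions `l ≤ i < r`. -/
def seg (w : ℕ → Option (Paren k)) (l r : ℕ) : List (Paren k) :=
  (List.range' l (r - l)).filterMap w

theorem seg_self (w : ℕ → Option (Paren k)) (l : ℕ) : seg w l l = [] := by simp [seg]

theorem seg_append (w : ℕ → Option (Paren k)) {l m r : ℕ} (h : l ≤ m) (h' : m ≤ r) :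
    seg w l m ++ seg w m r = seg w l r := by
  obtain ⟨a, rfl⟩ := Nat.exists_eq_add_of_le h
  obtain ⟨b, rfl⟩ := Nat.exists_eq_add_of_le h'
  unfold seg
  rw [← List.filterMap_append]
  congr 1
  have h1 : l + a - l = a := by omega
  have h2 : l + a + b - (l + a) = b := by omega
  have h3 : l + a + b - l = a + b := by omega
  rw [h1, h2, h3]
  exact List.range'_append_1

theorem seg_succ (w : ℕ → Option (Paren k)) {l r : ℕ} (h : l ≤ r) :
    seg w l (r + 1) = seg w l r ++ (w r).toList := by
  rw [← seg_append w h (Nat.le_succ r)]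
  congr 1
  cases h : w r <;> simp [seg, h]

/-- A segment containing a parenthesis can be split there. -/
theorem exists_of_seg_eq (w : ℕ → Option (Paren k)) (l : ℕ) {x : Paren k} :
    ∀ {r : ℕ} {u v : List (Paren k)}, l ≤ r → seg w l r = u ++ x :: v →
      ∃ m, l ≤ m ∧ m < r ∧ w m = some x ∧ seg w l m = u ∧ seg w (m + 1) r = v := by
  intro r
  induction r with
  | zero =>
    intro u v hl h
    obtain rfl : l = 0 := by omega
    simp [seg_self] at h
  | succ r ih =>
    intro u v hl h
    rcases hl.eq_or_lt with rfl | hl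
    · simp [seg_self] at h
    have hl : l ≤ r := by omega
    rw [seg_succ w hl] at h
    cases hr : w r with
    | none =>
      simp only [hr, Option.toList_none, List.append_nil] at h
      obtain ⟨m, h1, h2, h3, h4, h5⟩ := ih hl h
      exact ⟨m, h1, by omega, h3, h4, by rw [seg_succ w (by omega)]; simp [hr, h5]⟩
    | some y =>
      simp only [hr, Option.toList_some] at h
      rcases List.eq_nil_or_concat v with rfl | ⟨v', z, rfl⟩
      · have := List.append_inj_right' h rfl
        have h' := List.append_inj_left' h rfl
        simp only [List.cons.injEq, and_true] at this
        subst this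
        exact ⟨r, hl, by omega, hr, h', seg_self _ _⟩
      · have h2 : seg w l r ++ [y] = (u ++ x :: v') ++ [z] := by simpa using h
        have hz := List.append_inj_right' h2 rfl
        have h' := List.append_inj_left' h2 rfl
        simp only [List.cons.injEq, and_true] at hz
        subst hz
        obtain ⟨m, h1, h2, h3, h4, h5⟩ := ih hl h'
        exact ⟨m, h1, by omega, h3, h4, by rw [seg_succ w (by omega)]; simp [hr, h5]⟩

theorem _root_.WellBalanced.not_concat_op {u : List (Paren k)} (h : WellBalanced u) :
    ∀ {v : List (Paren k)} {t : Fin k}, u ≠ v ++ [.op t] := by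
  induction h with
  | nil => intro v t h; simp at h
  | @wrap i w hw _ =>
    intro v t h
    have : (Paren.op i :: w) ++ [Paren.cl i] = v ++ [Paren.op t] := by simpa using h
    have := List.append_inj_right' this rfl
    simp at this
  | @append u v hu hv ihu ihv =>
    intro v' t h
    rcases List.eq_nil_or_concat v with rfl | ⟨v₁, z, rfl⟩
    · exact ihu (by simpa using h)
    · have h2 : (u ++ v₁) ++ [z] = v' ++ [Paren.op t] := by simpa using h
      have := List.append_inj_right' h2 rfl
      simp only [List.cons.injEq, and_true] at this
      subst this
      exact ihv (v := v₁) (t := t) (by simp)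

/-- The last letter belongs to the last nonempty factor of a concatenation. If that factor is a
wrapped string, its inside is `u₂`, and what precedes it is collected in `u₁`. -/
theorem _root_.WellBalanced.exists_of_concat_cl {x : List (Paren k)} (h : WellBalanced x) :
    ∀ {u : List (Paren k)} {t : Fin k}, x = u ++ [.cl t] →
      ∃ u₁ u₂, u = u₁ ++ .op t :: u₂ ∧ WellBalanced u₁ ∧ WellBalanced u₂ := by
  induction h with
  | nil => intro u t h; simp at h
  | @wrap i w hw _ =>
    intro u t h
    have h : (Paren.op i :: w) ++ [Paren.cl i] = u ++ [Paren.cl t] := by simpa using h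
    have h1 := List.append_inj_right' h rfl
    have h2 := List.append_inj_left' h rfl
    simp only [List.cons.injEq, and_true, Paren.cl.injEq] at h1
    subst h1
    exact ⟨[], w, by simp [← h2], .nil, hw⟩
  | @append u v hu hv ihu ihv =>
    intro v' t h
    rcases List.eq_nil_or_concat v with rfl | ⟨v₁, z, rfl⟩
    · exact ihu (by simpa using h)
    · have h2 : (u ++ v₁) ++ [z] = v' ++ [Paren.cl t] := by simpa using h
      have h3 := List.append_inj_right' h2 rfl
      have h4 := List.append_inj_left' h2 rfl
      simp only [List.cons.injEq, and_true] at h3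
      subst h3
      obtain ⟨u₁, u₂, e, h1, h2⟩ := ihv (u := v₁) (t := t) (by simp)
      exact ⟨u ++ u₁, u₂, by rw [← h4, e]; simp, hu.append h1, h2⟩

-- Matching positions and the characterization of well-balanced segments

/-- Position `i` is where the parenthesis that is closed at position `j` is opened, if all
parentheses are considered to be of the same type. -/
def IsMatch (w : ℕ → Option (Paren k)) (i j : ℕ) : Prop :=
  i < j ∧ height w i < height w j ∧ ∀ i', i < i' → i' < j → height w j ≤ height w i'

/-- Of two different matches, the later one would lie between the earlier one and `j` with too small
a height. -/
theorem IsMatch.unique {w : ℕ → Option (Paren k)} {i i' j : ℕ} (h : IsMatch w i j)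
    (h' : IsMatch w i' j) : i = i' := by
  rcases lt_trichotomy i i' with h1 | h1 | h1
  · have := h.2.2 i' h1 h'.1; have := h'.2.1; omega
  · exact h1
  · have := h'.2.2 i h1 h.1; have := h.2.1; omega

theorem exists_isMatch (w : ℕ → Option (Paren k)) {l j : ℕ} (h : l < j)
    (hh : height w l < height w j) : ∃ i, l ≤ i ∧ IsMatch w i j := by
  classical
  let i := Nat.findGreatest (fun i => i < j ∧ height w i < height w j) j
  have hi : i < j ∧ height w i < height w j :=
    Nat.findGreatest_spec (P := fun i => i < j ∧ height w i < height w j) h.le ⟨h, hh⟩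
  refine ⟨i, Nat.le_findGreatest h.le ⟨h, hh⟩, hi.1, hi.2, fun i' h1 h2 => ?_⟩
  by_contra h3
  exact Nat.findGreatest_is_greatest h1 h2.le ⟨h2, by omega⟩

/-- Already at `i + 1` the height is at least that of `j`, and one position raises it by at most
one. -/
theorem IsMatch.exists_op {w : ℕ → Option (Paren k)} {i j : ℕ} (h : IsMatch w i j) :
    ∃ t, w i = some (.op t) ∧ height w (i + 1) = height w j ∧
      height w j = height w i + 1 := by
  obtain ⟨h1, h2, h3⟩ := h
  have h4 : height w j ≤ height w (i + 1) := by
    rcases (show i + 1 ≤ j from h1).eq_or_lt with h5 | h5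
    · rw [h5]
    · exact h3 _ (by omega) h5
  match hw : w i with
  | none => have := height_succ_none hw; omega
  | some (.cl t) => have := height_succ_cl hw; omega
  | some (.op t) => have := height_succ_op hw; exact ⟨t, rfl, by omega, by omega⟩

/-- The closing parentheses in `[l, r)` are matched with opening ones of the same type. -/
def TypesMatch (w : ℕ → Option (Paren k)) (l r : ℕ) : Prop :=
  ∀ j, l ≤ j → j < r → ∀ t, w j = some (.cl t) → ∀ i, IsMatch w i j → w i = some (.op t)

/-- The word in `[l, r)` is well-balanced if the types are ignored. -/
def HeightsBalanced (w : ℕ → Option (Paren k)) (l r : ℕ) : Prop :=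
  height w r = height w l ∧ ∀ j, l ≤ j → j ≤ r → height w l ≤ height w j

/-- Strong induction on the length, by cases on the last position. An empty position is irrelevant,
and an opening parenthesis falsifies both sides. A closing one splits the segment at its match `m`
into a balanced prefix and a wrapped balanced segment. -/
theorem wellBalanced_seg_iff (w : ℕ → Option (Paren k)) (l r : ℕ) (hlr : l ≤ r) :
    WellBalanced (seg w l r) ↔ HeightsBalanced w l r ∧ TypesMatch w l r := by
  induction hd : r - l using Nat.strong_induction_on generalizing l r with
  | _ d ih =>
  rcases hlr.eq_or_lt with rfl | hlt
  · rw [seg_self]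
    refine iff_of_true .nil ⟨⟨rfl, fun j h1 h2 => ?_⟩, fun j h1 h2 => by omega⟩
    obtain rfl : l = j := by omega
    exact le_rfl
  obtain ⟨r, rfl⟩ : ∃ r', r = r' + 1 := ⟨r - 1, by omega⟩
  have hlr' : l ≤ r := by omega
  rw [seg_succ w hlr']
  match hw : w r with
  | none =>
    have hh := height_succ_none hw
    simp only [Option.toList_none, List.append_nil]
    rw [ih (r - l) (by omega) l r hlr' rfl]
    refine and_congr ?_ ?_
    · unfold HeightsBalanced
      rw [hh]
      refine and_congr_right fun h => ⟨fun h' j h1 h2 => ?_, fun h' j h1 h2 => h' j h1 (by omega)⟩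
      rcases h2.eq_or_lt with rfl | h2
      · rw [hh, h]
      · exact h' j h1 (by omega)
    · refine ⟨fun h' j h1 h2 t ht => ?_, fun h' j h1 h2 => h' j h1 (by omega)⟩
      rcases (show j ≤ r by omega).eq_or_lt with rfl | h2
      · simp [hw] at ht
      · exact h' j h1 h2 t ht
  | some (.op t) =>
    have hh := height_succ_op hw
    refine iff_of_false (fun h => h.not_concat_op rfl) fun ⟨h, _⟩ => ?_
    have := h.1
    have := h.2 r hlr' (by omega)
    omega
  | some (.cl t) =>
    have hh := height_succ_cl hw
    simp only [Option.toList_some]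
    constructor
    · intro h
      obtain ⟨u₁, u₂, e, h1, h2⟩ := h.exists_of_concat_cl rfl
      obtain ⟨m, hm1, hm2, hm3, rfl, rfl⟩ := exists_of_seg_eq w l hlr' e
      obtain ⟨⟨a1, a2⟩, a3⟩ := (ih (m - l) (by omega) l m hm1 rfl).1 h1
      obtain ⟨⟨b1, b2⟩, b3⟩ := (ih (r - (m + 1)) (by omega) (m + 1) r hm2 rfl).1 h2
      have hm := height_succ_op hm3
      refine ⟨⟨by omega, fun j h1 h2 => ?_⟩, fun j h1 h2 t' ht' i hi => ?_⟩
      · rcases le_or_gt j m with h3 | h3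
        · exact a2 j h1 h3
        · rcases h2.eq_or_lt with rfl | h2
          · omega
          · have := b2 j h3 (by omega); omega
      · rcases lt_trichotomy j m with h3 | rfl | h3
        · exact a3 j h1 h3 t' ht' i hi
        · simp [hm3] at ht'
        · rcases (show j ≤ r by omega).eq_or_lt with rfl | h4
          -- The inner segment never drops below its start, so `m` matches the last position, and
          -- uniqueness identifies `i` with it.
          · have : IsMatch w m j :=
              ⟨hm2, by omega, fun i' h5 h6 => by have := b2 i' h5 h6.le; omega⟩
            rw [hi.unique this, hm3]
            simp_all
          · exact b3 j h3 h4 t' ht' i hi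
    · rintro ⟨⟨h1, h2⟩, h3⟩
      -- A closing parenthesis at `l` itself would push the final height below the initial one.
      have hlr'' : l < r := by
        rcases hlr'.eq_or_lt with rfl | h
        · omega
        · exact h
      obtain ⟨m, hm1, hm2⟩ := exists_isMatch w hlr'' (by omega)
      have hmr : m < r := hm2.1
      have hmt := h3 r hlr' (by omega) t hw m hm2
      obtain ⟨_, _, e1, e2⟩ := hm2.exists_op
      have a := (ih (m - l) (by omega) l m hm1 rfl).2
        ⟨⟨by omega, fun j h4 h5 => h2 j h4 (by omega)⟩, fun j h4 h5 => h3 j h4 (by omega)⟩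
      have b := (ih (r - (m + 1)) (by omega) (m + 1) r hmr rfl).2
        ⟨⟨by omega, fun j h4 h5 => ?_⟩, fun j h4 h5 => h3 j (by omega) (by omega)⟩
      · rw [← seg_append w hm1 hmr.le, ← seg_append w (Nat.le_succ m) hmr]
        have : seg w m (m + 1) = [.op t] := by rw [seg_succ w le_rfl, seg_self, hmt]; rfl
        rw [this, List.append_assoc]
        exact a.append (by simpa using WellBalanced.wrap t b)
      · rcases h5.eq_or_lt with rfl | h5
        · omega
        · have := hm2.2.2 j (by omega) h5; omega

theorem typesMatch_of_subsingleton (w : ℕ → Option (Paren 1)) (l r : ℕ) : TypesMatch w l r := by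
  intro j _ _ t _ i hi
  obtain ⟨t', h, _⟩ := hi.exists_op
  rw [h, Subsingleton.elim t' t]

-- Query ranges as segments

/-- The word `w`, continued by empty positions. -/
def extend {n : ℕ} (w : Fin n → Option (Paren k)) (i : ℕ) : Option (Paren k) :=
  if h : i < n then w ⟨i, h⟩ else none

theorem extend_val {n : ℕ} (w : Fin n → Option (Paren k)) (i : Fin n) : extend w i = w i := by
  simp [extend]

theorem factor_eq_seg {n : ℕ} (w : Fin n → Option (Paren k)) (l r : Fin n) (h : l ≤ r) :
    factor w l r = seg (extend w) l (r + 1) := by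
  have e1 : factor w l r = (List.range n).filterMap fun i =>
      if (l : ℕ) ≤ i ∧ i ≤ r then extend w i else none := by
    rw [← List.map_coe_finRange_eq_range, List.filterMap_map]
    unfold factor
    congr 1
    funext i
    simp only [Function.comp, extend_val, Fin.le_def]
  have h' : (l : ℕ) ≤ r := h
  have e2 : List.range n = List.range' 0 l ++ (List.range' l (r + 1 - l) ++
      List.range' (r + 1) (n - (r + 1))) := by
    have a : (r : ℕ) + 1 = l + (r + 1 - l) := by omega
    conv_rhs => enter [2, 2]; rw [a]
    rw [List.range_eq_range', List.range'_append_1]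
    have := List.range'_append_1 (s := 0) (m := l) (n := (r + 1 - l) + (n - (l + (r + 1 - l))))
    rw [Nat.zero_add] at this
    rw [this]
    congr 1
    have := r.2
    omega
  rw [e1, e2, List.filterMap_append, List.filterMap_append]
  have z1 : (List.range' 0 (l : ℕ)).filterMap
      (fun i => if (l : ℕ) ≤ i ∧ i ≤ r then extend w i else none) = [] := by
    rw [List.filterMap_eq_nil_iff]
    intro i hi
    rw [List.mem_range'_1] at hi
    rw [if_neg (by omega)]
  have z2 : (List.range' (r + 1 : ℕ) (n - (r + 1))).filterMap
      (fun i => if (l : ℕ) ≤ i ∧ i ≤ r then extend w i else none) = [] := by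
    rw [List.filterMap_eq_nil_iff]
    intro i hi
    rw [List.mem_range'_1] at hi
    rw [if_neg (by omega)]
  rw [z1, z2, List.nil_append, List.append_nil, seg]
  refine List.filterMap_congr fun i hi => ?_
  rw [List.mem_range'_1] at hi
  rw [if_pos (by omega)]

theorem factor_eq_nil {n : ℕ} (w : Fin n → Option (Paren k)) (l r : Fin n) (h : ¬ l ≤ r) :
    factor w l r = [] := by
  unfold factor
  rw [List.filterMap_eq_nil_iff]
  intro i _
  rw [if_neg]
  rintro ⟨h1, h2⟩
  exact h (h1.trans h2)

theorem factor_mem_dyck_iff {n : ℕ} (w : Fin n → Option (Paren k)) (l r : Fin n) :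
    factor w l r ∈ dyck k ↔ r < l ∨ HeightsBalanced (extend w) l (r + 1) ∧
      TypesMatch (extend w) l (r + 1) := by
  by_cases h : l ≤ r
  · have h' : (l : ℕ) ≤ r := h
    rw [factor_eq_seg w l r h, ← wellBalanced_seg_iff _ _ _ (by omega)]
    simp only [h.not_gt, false_or]
    rfl
  · rw [factor_eq_nil w l r h]
    exact iff_of_true WellBalanced.nil (.inl (not_le.1 h))

end Heights

end DynFO

namespace DynFO

/-! ## Uniform first-order definability -/

open FirstOrder in
/-- Properties of valuations of the variables `0, 1, …` that are defined in all domains by one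
first-order formula. -/
def UDef (R : ∀ n, (ℕ → Fin n) → Prop) : Prop :=
  ∃ φ : arith.Formula ℕ, ∀ n (v : ℕ → Fin n), φ.Realize v ↔ R n v

namespace UDef

open FirstOrder Language

variable {R S : ∀ n, (ℕ → Fin n) → Prop}

theorem congr (h : UDef R) (e : ∀ n v, R n v ↔ S n v) : UDef S :=
  let ⟨φ, hφ⟩ := h
  ⟨φ, fun n v => (hφ n v).trans (e n v)⟩

theorem rel {a : ℕ} (r : ArithRel a) (x : Fin a → ℕ) :
    UDef fun _ v => r.holds fun i => v (x i) :=
  ⟨Relations.formula (L := arith) (show arith.Relations a from r) fun i => Term.var (x i),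
    fun n v => by rw [Formula.realize_rel]; rfl⟩

theorem le (i j : ℕ) : UDef fun _ v => (v i : ℕ) ≤ v j := rel .le ![i, j]

theorem add (i j l : ℕ) : UDef fun _ v => (v i : ℕ) + v j = v l := rel .add ![i, j, l]

theorem mul (i j l : ℕ) : UDef fun _ v => (v i : ℕ) * v j = v l := rel .mul ![i, j, l]

theorem not (h : UDef R) : UDef fun n v => ¬ R n v :=
  let ⟨φ, hφ⟩ := h
  ⟨φ.not, fun n v => by rw [Formula.realize_not, hφ]⟩

theorem and (h : UDef R) (h' : UDef S) : UDef fun n v => R n v ∧ S n v :=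
  let ⟨φ, hφ⟩ := h
  let ⟨ψ, hψ⟩ := h'
  ⟨φ ⊓ ψ, fun n v => by rw [Formula.realize_inf, hφ, hψ]⟩

theorem eq (i j : ℕ) : UDef fun _ v => v i = v j :=
  ((le i j).and (le j i)).congr fun _ _ => by rw [Fin.ext_iff]; omega

/-- With variables named by natural numbers, a quantifier is an update of the valuation, and no
shifting of indices is needed. -/
theorem ex (x : ℕ) (h : UDef R) : UDef fun n v => ∃ a, R n (Function.update v x a) := by
  obtain ⟨φ, hφ⟩ := h
  refine ⟨Formula.iExs (Fin 1)
    (φ.relabel fun y => if y = x then Sum.inr (0 : Fin 1) else Sum.inl y), fun n v => ?_⟩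
  rw [Formula.realize_iExs]
  simp only [Formula.realize_relabel]
  have key : ∀ i : Fin 1 → Fin n, (Sum.elim v i ∘ fun y =>
      if y = x then Sum.inr (0 : Fin 1) else Sum.inl y) = Function.update v x (i 0) := by
    intro i
    funext y
    by_cases h : y = x
    · subst h; simp
    · simp [h]
  constructor
  · rintro ⟨i, hi⟩
    rw [key, hφ] at hi
    exact ⟨_, hi⟩
  · rintro ⟨a, ha⟩
    refine ⟨fun _ => a, ?_⟩
    rw [key, hφ]
    exact ha

theorem all (x : ℕ) (h : UDef R) : UDef fun n v => ∀ a, R n (Function.update v x a) :=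
  (h.not.ex x).not.congr fun n v => by simp

theorem exists_formula_one (h : UDef R) :
    ∃ φ : arith.Formula (Fin 1), ∀ n (v : Fin 1 → Fin n), φ.Realize v ↔ R n fun _ => v 0 := by
  obtain ⟨φ, hφ⟩ := h
  exact ⟨φ.relabel fun _ => 0, fun n v => by
    rw [Formula.realize_relabel, hφ]; rfl⟩

theorem exists_formula_two (h : UDef R) :
    ∃ φ : arith.Formula (Fin 2), ∀ n (v : Fin 2 → Fin n),
      φ.Realize v ↔ R n fun i => if i = 0 then v 0 else v 1 := by
  obtain ⟨φ, hφ⟩ := h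
  exact ⟨φ.relabel fun i => if i = 0 then 0 else 1, fun n v => by
    rw [Formula.realize_relabel, hφ]
    refine iff_of_eq (congrArg _ (funext fun i => ?_))
    by_cases h : i = 0 <;> simp [h]⟩

theorem lt (i j : ℕ) : UDef fun _ v => (v i : ℕ) < v j :=
  (le j i).not.congr fun _ _ => by omega

/-- The successor is expressed by the order alone, as a covering pair, because the number `1` need
not belong to the domain. -/
theorem isSucc : UDef fun _ v => (v 0 : ℕ) + 1 = v 1 :=
  ((lt 0 1).and (((lt 0 2).and (lt 2 1)).not.all 2)).congr fun n v => by
    simp only [Function.update_self, Function.update_of_ne (show (0 : ℕ) ≠ 2 by decide),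
      Function.update_of_ne (show (1 : ℕ) ≠ 2 by decide)]
    constructor
    · rintro ⟨h1, h2⟩
      by_contra h
      exact h2 ⟨v 0 + 1, by have := (v 1).2; omega⟩ ⟨by simp, by simp; omega⟩
    · intro h
      exact ⟨by omega, fun a => by omega⟩

theorem isPred : UDef fun _ v => (v 1 : ℕ) + 1 = v 0 :=
  ((lt 1 0).and (((lt 1 2).and (lt 2 0)).not.all 2)).congr fun n v => by
    simp only [Function.update_self, Function.update_of_ne (show (0 : ℕ) ≠ 2 by decide),
      Function.update_of_ne (show (1 : ℕ) ≠ 2 by decide)]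
    constructor
    · rintro ⟨h1, h2⟩
      by_contra h
      exact h2 ⟨v 1 + 1, by have := (v 0).2; omega⟩ ⟨by simp, by simp; omega⟩
    · intro h
      exact ⟨by omega, fun a => by omega⟩

end UDef

-- The base and its definable arithmetic

/-- The largest `z` with `z ^ K < n`. -/
def root (K n : ℕ) : ℕ := Nat.findGreatest (fun z => z ^ K < n) n

theorem le_root_iff {K n z : ℕ} (hK : K ≠ 0) (hn : 0 < n) : z ≤ root K n ↔ z ^ K < n := by
  constructor
  · intro h
    have : (root K n) ^ K < n :=
      Nat.findGreatest_spec (P := fun z => z ^ K < n) (Nat.zero_le n) (by simpa [hK] using hn)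
    exact (Nat.pow_le_pow_left h K).trans_lt this
  · intro h
    exact Nat.le_findGreatest ((Nat.le_self_pow hK z).trans h.le) h

theorem root_pow_lt {K n : ℕ} (hK : K ≠ 0) (hn : 0 < n) : root K n ^ K < n :=
  (le_root_iff hK hn).1 le_rfl

theorem root_lt {K n : ℕ} (hK : K ≠ 0) (hn : 0 < n) : root K n < n :=
  (Nat.le_self_pow hK _).trans_lt (root_pow_lt hK hn)

/-- The degree of the tree of blocks. -/
def base (K n : ℕ) : ℕ := root K n + 1

theorem base_pos (K n : ℕ) : 0 < base K n := Nat.succ_pos _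

/-- By maximality of the root, its successor has a `K`-th power of at least `n`. Hence every
position has `K` digits in this base. -/
theorem le_base_pow {K n : ℕ} (hK : K ≠ 0) : n ≤ base K n ^ K := by
  rcases Nat.eq_zero_or_pos n with rfl | hn
  · exact Nat.zero_le _
  · by_contra h
    have := (le_root_iff hK hn (z := root K n + 1)).2 (by unfold base at h; omega)
    omega

/-- Repeated multiplication. With positive exponents the intermediate powers are bounded by the
final one, so they are domain elements. -/
theorem UDef.isPow (s : ℕ) : UDef fun _ v => (v 0 : ℕ) ^ (s + 1) = v 1 := by
  induction s with
  | zero => exact (UDef.eq 0 1).congr fun n v => by simp [Fin.ext_iff]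
  | succ s ih =>
    have key : UDef fun _ v => (v 0 : ℕ) ^ (s + 1) = v 2 := by
      obtain h := (ih.and (UDef.eq 1 2)).ex 1
      refine h.congr fun n v => ?_
      simp [Function.update_of_ne]
    refine ((key.and (UDef.mul 2 0 1)).ex 2).congr fun n v => ?_
    simp only [Function.update_self, Function.update_of_ne (show (0 : ℕ) ≠ 2 by decide),
      Function.update_of_ne (show (1 : ℕ) ≠ 2 by decide)]
    constructor
    · rintro ⟨a, h1, h2⟩
      rw [pow_succ, h1, h2]
    · intro h
      have : (v 0 : ℕ) ^ (s + 1) ≤ v 0 ^ (s + 1 + 1) := by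
        rcases Nat.eq_zero_or_pos (v 0 : ℕ) with h0 | h0
        · simp [h0]
        · exact Nat.pow_le_pow_right h0 (by omega)
      exact ⟨⟨(v 0 : ℕ) ^ (s + 1), by have := (v 1).2; omega⟩, rfl, by
        rw [← pow_succ]; exact h⟩

theorem UDef.le_root (K : ℕ) : UDef fun n v => (v 0 : ℕ) ≤ root (K + 1) n :=
  ((UDef.isPow K).ex 1).congr fun n v => by
    rw [le_root_iff (Nat.succ_ne_zero K) (v 0).pos]
    simp only [Function.update_self, Function.update_of_ne (show (0 : ℕ) ≠ 1 by decide)]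
    exact ⟨fun ⟨a, h⟩ => h ▸ a.2, fun h => ⟨⟨_, h⟩, rfl⟩⟩

/-- The range of the digits with respect to the base. -/
def rootBound (K : ℕ) : Bound where
  val := root (K + 1)
  definable := by
    obtain ⟨φ, h⟩ := (UDef.le_root K).exists_formula_one
    exact ⟨φ, fun n z => h n _⟩

/-- The range that is the whole domain. -/
def fullBound : Bound where
  val n := n
  definable := by
    obtain ⟨φ, h⟩ := (UDef.le 0 0).exists_formula_one
    exact ⟨φ, fun n z => (h n _).trans (by simp [z.2.le])⟩

/-- Variable `1` is the base times variable `0`. -/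
theorem UDef.mulBase (K : ℕ) : UDef fun n v => (v 0 : ℕ) * base (K + 1) n = v 1 := by
  have root_le : UDef fun n v => (v 2 : ℕ) ≤ root (K + 1) n :=
    ((UDef.eq 0 2).and (UDef.le_root K)).ex 0 |>.congr fun n v => by
      simp [Function.update_of_ne]
  have isRoot : UDef fun n v => (v 2 : ℕ) = root (K + 1) n := by
    have h3 : UDef fun n v => (v 3 : ℕ) ≤ root (K + 1) n :=
      ((UDef.eq 2 3).and root_le).ex 2 |>.congr fun n v => by
        simp [Function.update_of_ne]
    refine (root_le.and ((h3.and (UDef.le 3 2).not).not.all 3)).congr fun n v => ?_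
    have := root_lt (Nat.succ_ne_zero K) (v 0).pos
    simp only [Function.update_self, Function.update_of_ne (show (2 : ℕ) ≠ 3 by decide)]
    constructor
    · rintro ⟨h1, h2⟩
      by_contra h
      exact h2 ⟨root (K + 1) n, this⟩ ⟨le_rfl, by simp; omega⟩
    · intro h
      exact ⟨h.le, fun a => by omega⟩
  -- The base may lie outside the domain (for `n = 2`, say), but the root does not, so the product
  -- is expressed as `x * root + x`.
  refine (((isRoot.and ((UDef.mul 0 2 3).and (UDef.add 3 0 1))).ex 3).ex 2).congr fun n v => ?_
  have := root_lt (Nat.succ_ne_zero K) (v 0).pos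
  simp only [Function.update_self, Function.update_of_ne (show (2 : ℕ) ≠ 3 by decide),
    Function.update_of_ne (show (0 : ℕ) ≠ 3 by decide),
    Function.update_of_ne (show (1 : ℕ) ≠ 3 by decide),
    Function.update_of_ne (show (0 : ℕ) ≠ 2 by decide),
    Function.update_of_ne (show (1 : ℕ) ≠ 2 by decide)]
  unfold base
  constructor
  · rintro ⟨a, b, h1, h2, h3⟩
    rw [← h1, mul_add, h2, mul_one, h3]
  · intro h
    rw [mul_add, mul_one] at h
    exact ⟨⟨_, this⟩, ⟨v 0 * root (K + 1) n, by have := (v 1).2; omega⟩, rfl, rfl, h⟩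

/-- Variable `1` is the quotient of variable `0` by the base. -/
theorem UDef.divBase (K : ℕ) : UDef fun n v => (v 0 : ℕ) / base (K + 1) n = v 1 := by
  have mul : UDef fun n v => (v 1 : ℕ) * base (K + 1) n = v 2 :=
    (((UDef.mulBase K).and (UDef.eq 1 2)).ex 1 |>.and (UDef.eq 0 1)).ex 0 |>.congr fun n v => by
      simp [Function.update_of_ne]
  have root_le : UDef fun n v => (v 3 : ℕ) ≤ root (K + 1) n :=
    ((UDef.eq 0 3).and (UDef.le_root K)).ex 0 |>.congr fun n v => by
      simp [Function.update_of_ne]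
  -- Division with remainder: variable `2` is the quotient times the base, and variable `3` is the
  -- remainder, which is at most the root.
  refine (((mul.and (root_le.and (UDef.add 2 3 0))).ex 3).ex 2).congr fun n v => ?_
  simp only [Function.update_self, Function.update_of_ne (show (2 : ℕ) ≠ 3 by decide),
    Function.update_of_ne (show (0 : ℕ) ≠ 3 by decide),
    Function.update_of_ne (show (1 : ℕ) ≠ 3 by decide),
    Function.update_of_ne (show (0 : ℕ) ≠ 2 by decide),
    Function.update_of_ne (show (1 : ℕ) ≠ 2 by decide)]
  have hb := base_pos (K + 1) n
  constructor
  · rintro ⟨a, b, h1, h2, h3⟩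
    rw [← h3, ← h1, mul_comm, Nat.mul_add_div hb, Nat.div_eq_of_lt (by unfold base; omega)]
    rfl
  · intro h
    have h1 := Nat.div_add_mod (v 0 : ℕ) (base (K + 1) n)
    have h2 := Nat.mod_lt (v 0 : ℕ) hb
    have := (v 0).2
    rw [h, mul_comm] at h1
    refine ⟨⟨_, by omega⟩, ⟨(v 0 : ℕ) % base (K + 1) n, by omega⟩, rfl, ?_, h1⟩
    show _ % _ ≤ _
    unfold base at h2 ⊢
    omega

/-- Variable `1` is the first position of the block `x` at level `s`, where `x` is variable `0`. -/
theorem UDef.blockStart (K s : ℕ) :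
    UDef fun n v => (v 0 : ℕ) * base (K + 1) n ^ s = v 1 := by
  induction s with
  | zero => exact (UDef.eq 0 1).congr fun n v => by simp [Fin.ext_iff]
  | succ s ih =>
    have h1 : UDef fun n v => (v 0 : ℕ) * base (K + 1) n = v 2 :=
      ((UDef.mulBase K).and (UDef.eq 1 2)).ex 1 |>.congr fun n v => by
        simp [Function.update_of_ne]
    have h2 : UDef fun n v => (v 2 : ℕ) * base (K + 1) n ^ s = v 1 :=
      (ih.and (UDef.eq 0 2)).ex 0 |>.congr fun n v => by
        simp [Function.update_of_ne]
    refine (h1.and h2).ex 2 |>.congr fun n v => ?_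
    simp only [Function.update_self, Function.update_of_ne (show (0 : ℕ) ≠ 2 by decide),
      Function.update_of_ne (show (1 : ℕ) ≠ 2 by decide)]
    have hb := Nat.pow_pos (n := s) (base_pos (K + 1) n)
    rw [pow_succ', ← mul_assoc]
    constructor
    · rintro ⟨a, h1, h2⟩
      rw [h1, h2]
    · intro h
      have := Nat.le_mul_of_pos_right ((v 0 : ℕ) * base (K + 1) n) hb
      exact ⟨⟨v 0 * base (K + 1) n, by have := (v 1).2; omega⟩, rfl, h⟩

theorem UDef.isZero : UDef fun _ v => (v 1 : ℕ) = 0 :=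
  ((UDef.le 1 2).all 2).congr fun n v => by
    simp only [Function.update_self, Function.update_of_ne (show (1 : ℕ) ≠ 2 by decide)]
    exact ⟨fun h => by simpa using h ⟨0, (v 0).pos⟩, fun h a => by omega⟩

end DynFO

namespace DynFO

/-! ## Renaming of variables -/

/-- The extension of a renaming of variables to an additional last variable. -/
def extendRenaming {m m' : ℕ} (f : Fin m → Fin m') : Fin (m + 1) → Fin (m' + 1) :=
  Fin.snoc (fun i => (f i).castSucc) (Fin.last m')

theorem snoc_comp_extendRenaming {α : Type} {m m' : ℕ} (f : Fin m → Fin m') (v : Fin m' → α)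
    (a : α) : (Fin.snoc v a : Fin (m' + 1) → α) ∘ extendRenaming f = Fin.snoc (v ∘ f) a := by
  funext i
  refine Fin.lastCases ?_ (fun j => ?_) i <;> simp [extendRenaming]

open Classical in
theorem dite_existsUnique_congr {α : Type} {P Q : α → Prop} (h : P = Q) :
    (if h : ∃! a, P a then some h.choose else none) =
      if h : ∃! a, Q a then some h.choose else none := by
  rw [h]

section Rename

variable {σ : Schema}

-- Renaming serves `Cnd.maximal`, where one condition occurs under different numbers of bound
-- variables.
mutual

def Tm.rename : {m m' : ℕ} → (Fin m → Fin m') → Tm σ m → Tm σ m'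
  | _, _, f, .var i => .var (f i)
  | _, _, f, .add s t => .add (s.rename f) (t.rename f)
  | _, _, f, .mul s t => .mul (s.rename f) (t.rename f)
  | _, _, f, .app F args => .app F fun i => (args i).rename f
  | _, _, f, .ite c s t => .ite (c.rename f) (s.rename f) (t.rename f)
  | _, _, f, .unique g c => .unique g (c.rename (extendRenaming f))

def Cnd.rename : {m m' : ℕ} → (Fin m → Fin m') → Cnd σ m → Cnd σ m'
  | _, _, f, .le s t => .le (s.rename f) (t.rename f)
  | _, _, f, .eq s t => .eq (s.rename f) (t.rename f)
  | _, _, f, .rel R args => .rel R fun i => (args i).rename f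
  | _, _, f, .not c => .not (c.rename f)
  | _, _, f, .and c d => .and (c.rename f) (d.rename f)
  | _, _, f, .or c d => .or (c.rename f) (d.rename f)
  | _, _, f, .ex g c => .ex g (c.rename (extendRenaming f))

end

variable {n : ℕ} (A : Interp σ n)

mutual

theorem Tm.eval_rename : {m m' : ℕ} → (f : Fin m → Fin m') → (t : Tm σ m) →
    (v : Fin m' → Fin n) → (t.rename f).eval A v = t.eval A (v ∘ f)
  | _, _, f, .var i, v => by simp only [Tm.rename, Tm.eval, Function.comp]
  | _, _, f, .add s t, v => by
      simp only [Tm.rename, Tm.eval, Tm.eval_rename f s v, Tm.eval_rename f t v]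
  | _, _, f, .mul s t, v => by
      simp only [Tm.rename, Tm.eval, Tm.eval_rename f s v, Tm.eval_rename f t v]
  | _, _, f, .app F args, v => by
      simp only [Tm.rename, Tm.eval, fun i => Tm.eval_rename f (args i) v]
  | _, _, f, .ite c s t, v => by
      have h := Cnd.eval_rename f c v
      simp only [Tm.rename, Tm.eval, Tm.eval_rename f s v, Tm.eval_rename f t v]
      by_cases hc : c.eval A (v ∘ f)
      · rw [if_pos (h.mpr hc), if_pos hc]
      · rw [if_neg (h ▸ hc), if_neg hc]
  | _, _, f, .unique g c, v => by
      simp only [Tm.rename, Tm.eval]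
      refine dite_existsUnique_congr (funext fun a => ?_)
      rw [Cnd.eval_rename (extendRenaming f) c, snoc_comp_extendRenaming]

theorem Cnd.eval_rename : {m m' : ℕ} → (f : Fin m → Fin m') → (c : Cnd σ m) →
    (v : Fin m' → Fin n) → (c.rename f).eval A v = c.eval A (v ∘ f)
  | _, _, f, .le s t, v => by
      simp only [Cnd.rename, Cnd.eval, Tm.eval_rename f s v, Tm.eval_rename f t v]
  | _, _, f, .eq s t, v => by
      simp only [Cnd.rename, Cnd.eval, Tm.eval_rename f s v, Tm.eval_rename f t v]
  | _, _, f, .rel F args, v => by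
      simp only [Cnd.rename, Cnd.eval, fun i => Tm.eval_rename f (args i) v]
  | _, _, f, .not c, v => by simp only [Cnd.rename, Cnd.eval, Cnd.eval_rename f c v]
  | _, _, f, .and c d, v => by
      simp only [Cnd.rename, Cnd.eval, Cnd.eval_rename f c v, Cnd.eval_rename f d v]
  | _, _, f, .or c d, v => by
      simp only [Cnd.rename, Cnd.eval, Cnd.eval_rename f c v, Cnd.eval_rename f d v]
  | _, _, f, .ex g c, v => by
      simp only [Cnd.rename, Cnd.eval, fun w => Cnd.eval_rename (extendRenaming f) c w,
        snoc_comp_extendRenaming]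

end

mutual

theorem Tm.safe_rename : {m m' : ℕ} → (f : Fin m → Fin m') → (t : Tm σ m) →
    (v : Fin m' → Fin n) → (t.rename f).Safe A v = t.Safe A (v ∘ f)
  | _, _, f, .var i, v => by simp only [Tm.rename, Tm.Safe]
  | _, _, f, .add s t, v => by
      simp only [Tm.rename, Tm.Safe, Tm.safe_rename f s v, Tm.safe_rename f t v]
  | _, _, f, .mul s t, v => by
      simp only [Tm.rename, Tm.Safe, Tm.safe_rename f s v, Tm.safe_rename f t v]
  | _, _, f, .app F args, v => by
      simp only [Tm.rename, Tm.Safe, fun i => Tm.safe_rename f (args i) v]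
  | _, _, f, .ite c s t, v => by
      simp only [Tm.rename, Tm.Safe, Cnd.safe_rename f c v, Tm.safe_rename f s v,
        Tm.safe_rename f t v, Cnd.eval_rename]
  | _, _, f, .unique g c, v => by
      simp only [Tm.rename, Tm.Safe, fun w => Cnd.safe_rename (extendRenaming f) c w,
        snoc_comp_extendRenaming, Cnd.eval_rename]

theorem Cnd.safe_rename : {m m' : ℕ} → (f : Fin m → Fin m') → (c : Cnd σ m) →
    (v : Fin m' → Fin n) → (c.rename f).Safe A v = c.Safe A (v ∘ f)
  | _, _, f, .le s t, v => by
      simp only [Cnd.rename, Cnd.Safe, Tm.safe_rename f s v, Tm.safe_rename f t v]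
  | _, _, f, .eq s t, v => by
      simp only [Cnd.rename, Cnd.Safe, Tm.safe_rename f s v, Tm.safe_rename f t v]
  | _, _, f, .rel F args, v => by
      simp only [Cnd.rename, Cnd.Safe, fun i => Tm.safe_rename f (args i) v]
  | _, _, f, .not c, v => by simp only [Cnd.rename, Cnd.Safe, Cnd.safe_rename f c v]
  | _, _, f, .and c d, v => by
      simp only [Cnd.rename, Cnd.Safe, Cnd.safe_rename f c v, Cnd.safe_rename f d v]
  | _, _, f, .or c d, v => by
      simp only [Cnd.rename, Cnd.Safe, Cnd.safe_rename f c v, Cnd.safe_rename f d v]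
  | _, _, f, .ex g c, v => by
      simp only [Cnd.rename, Cnd.Safe, fun w => Cnd.safe_rename (extendRenaming f) c w,
        snoc_comp_extendRenaming]

end

variable (n)

mutual

theorem Tm.work_rename : {m m' : ℕ} → (f : Fin m → Fin m') → (t : Tm σ m) →
    (t.rename f).work n = t.work n
  | _, _, f, .var i => by simp only [Tm.rename, Tm.work]
  | _, _, f, .add s t => by
      simp only [Tm.rename, Tm.work, Tm.work_rename f s, Tm.work_rename f t]
  | _, _, f, .mul s t => by
      simp only [Tm.rename, Tm.work, Tm.work_rename f s, Tm.work_rename f t]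
  | _, _, f, .app F args => by
      simp only [Tm.rename, Tm.work, fun i => Tm.work_rename f (args i)]
  | _, _, f, .ite c s t => by
      simp only [Tm.rename, Tm.work, Cnd.work_rename f c, Tm.work_rename f s, Tm.work_rename f t]
  | _, _, f, .unique g c => by
      simp only [Tm.rename, Tm.work, Cnd.work_rename (extendRenaming f) c]

theorem Cnd.work_rename : {m m' : ℕ} → (f : Fin m → Fin m') → (c : Cnd σ m) →
    (c.rename f).work n = c.work n
  | _, _, f, .le s t => by
      simp only [Cnd.rename, Cnd.work, Tm.work_rename f s, Tm.work_rename f t]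
  | _, _, f, .eq s t => by
      simp only [Cnd.rename, Cnd.work, Tm.work_rename f s, Tm.work_rename f t]
  | _, _, f, .rel F args => by
      simp only [Cnd.rename, Cnd.work, fun i => Tm.work_rename f (args i)]
  | _, _, f, .not c => by simp only [Cnd.rename, Cnd.work, Cnd.work_rename f c]
  | _, _, f, .and c d => by
      simp only [Cnd.rename, Cnd.work, Cnd.work_rename f c, Cnd.work_rename f d]
  | _, _, f, .or c d => by
      simp only [Cnd.rename, Cnd.work, Cnd.work_rename f c, Cnd.work_rename f d]
  | _, _, f, .ex g c => by
      simp only [Cnd.rename, Cnd.work, Cnd.work_rename (extendRenaming f) c]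

end

end Rename

/-! ## Values of terms as natural numbers -/

section Num

variable {σ : Schema} {n m : ℕ} (A : Interp σ n) (v : Fin m → Fin n)

/-- The value of a term as a natural number. -/
noncomputable def Tm.num (t : Tm σ m) : Option ℕ := (t.eval A v).map Fin.val

/-- The function for a unary function symbol as a function on natural numbers. -/
noncomputable def Interp.num (f : σ.Fn) (x : ℕ) : Option ℕ :=
  if h : x < n then (A.fn f fun _ => ⟨x, h⟩).map Fin.val else none

/-- The term `f(t)` for a unary function symbol `f`. -/
def Tm.app₁ (f : σ.Fn) (t : Tm σ m) : Tm σ m := .app f fun _ => t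

/-- The atom `R(t)` for a unary relation symbol `R`. -/
def Cnd.rel₁ (R : σ.Rel) (t : Tm σ m) : Cnd σ m := .rel R fun _ => t

variable {A v}

theorem Tm.num_lt {t : Tm σ m} {x : ℕ} (h : t.num A v = some x) : x < n := by
  obtain ⟨a, _, rfl⟩ := Option.map_eq_some_iff.1 h
  exact a.2

theorem Tm.num_eq_some_iff {t : Tm σ m} {a : Fin n} :
    t.num A v = some (a : ℕ) ↔ t.eval A v = some a := by
  unfold Tm.num
  rw [Option.map_eq_some_iff]
  constructor
  · rintro ⟨b, h, e⟩
    rw [h, Fin.ext e]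
  · exact fun h => ⟨a, h, rfl⟩

theorem Tm.num_var (i : Fin m) : (Tm.var i : Tm σ m).num A v = some (v i : ℕ) := by
  simp [Tm.num, Tm.eval]

theorem Tm.num_add {s t : Tm σ m} {a b : ℕ} (hs : s.num A v = some a) (ht : t.num A v = some b) :
    (s.add t).num A v = if a + b < n then some (a + b) else none := by
  obtain ⟨a, hs', rfl⟩ := Option.map_eq_some_iff.1 hs
  obtain ⟨b, ht', rfl⟩ := Option.map_eq_some_iff.1 ht
  simp only [Tm.num, Tm.eval, hs', ht', Option.bind_some, toDomain]
  split_ifs <;> rfl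

theorem Tm.num_add_of_none {s t : Tm σ m} (hs : s.num A v = none) :
    (s.add t).num A v = none := by
  have hs : s.eval A v = none := Option.map_eq_none_iff.1 hs
  simp [Tm.num, Tm.eval, hs]

theorem Tm.num_ite_pos {c : Cnd σ m} {s t : Tm σ m} (h : c.eval A v) :
    (Tm.ite c s t).num A v = s.num A v := by
  simp [Tm.num, Tm.eval, h]

theorem Tm.num_ite_neg {c : Cnd σ m} {s t : Tm σ m} (h : ¬ c.eval A v) :
    (Tm.ite c s t).num A v = t.num A v := by
  simp [Tm.num, Tm.eval, h]

theorem tuple_some {β : Type} {k : ℕ} (u : Fin k → β) : tuple (fun i => some (u i)) = some u := by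
  have h : ∃ u' : Fin k → β, ∀ i, some (u i) = some (u' i) := ⟨u, fun _ => rfl⟩
  unfold tuple
  rw [dif_pos h]
  congr 1
  funext i
  exact (Option.some_injective _ (h.choose_spec i)).symm

theorem tuple_none {β : Type} {k : ℕ} (hk : k ≠ 0) :
    tuple (fun _ : Fin k => (none : Option β)) = none := by
  unfold tuple
  rw [dif_neg]
  rintro ⟨u, h⟩
  simpa using h ⟨0, Nat.pos_of_ne_zero hk⟩

theorem Tm.num_app₁ {f : σ.Fn} {t : Tm σ m} {x : ℕ} (h : t.num A v = some x) :
    (t.app₁ f).num A v = A.num f x := by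
  obtain ⟨a, h', rfl⟩ := Option.map_eq_some_iff.1 h
  simp only [Tm.num, Tm.app₁, Tm.eval, h', tuple_some, Option.bind_some, Interp.num, a.2, dif_pos]

theorem Tm.num_app₁_of_none {f : σ.Fn} {t : Tm σ m} (hf : σ.fnArity f ≠ 0)
    (h : t.num A v = none) : (t.app₁ f).num A v = none := by
  have h : t.eval A v = none := Option.map_eq_none_iff.1 h
  simp only [Tm.num, Tm.app₁, Tm.eval, h, tuple_none hf, Option.bind_none, Option.map_none]

theorem Cnd.eval_le {s t : Tm σ m} : (Cnd.le s t).eval A v ↔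
    ∃ a b, s.num A v = some a ∧ t.num A v = some b ∧ a ≤ b := by
  simp only [Cnd.eval]
  constructor
  · rintro ⟨a, b, h1, h2, h3⟩
    exact ⟨a, b, Tm.num_eq_some_iff.2 h1, Tm.num_eq_some_iff.2 h2, h3⟩
  · rintro ⟨a, b, h1, h2, h3⟩
    exact ⟨⟨a, Tm.num_lt h1⟩, ⟨b, Tm.num_lt h2⟩, Tm.num_eq_some_iff.1 h1,
      Tm.num_eq_some_iff.1 h2, h3⟩

theorem Cnd.eval_le_iff {s t : Tm σ m} {a b : ℕ} (hs : s.num A v = some a)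
    (ht : t.num A v = some b) : (Cnd.le s t).eval A v ↔ a ≤ b := by
  rw [Cnd.eval_le]
  simp [hs, ht]

theorem Cnd.eval_eq {s t : Tm σ m} : (Cnd.eq s t).eval A v ↔
    ∃ a, s.num A v = some a ∧ t.num A v = some a := by
  simp only [Cnd.eval]
  constructor
  · rintro ⟨a, h1, h2⟩
    exact ⟨a, Tm.num_eq_some_iff.2 h1, Tm.num_eq_some_iff.2 h2⟩
  · rintro ⟨a, h1, h2⟩
    exact ⟨⟨a, Tm.num_lt h1⟩, Tm.num_eq_some_iff.1 h1, Tm.num_eq_some_iff.1 h2⟩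

theorem Cnd.eval_not {c : Cnd σ m} : c.not.eval A v ↔ ¬ c.eval A v := by simp only [Cnd.eval]

theorem Cnd.eval_and {c d : Cnd σ m} : (c.and d).eval A v ↔ c.eval A v ∧ d.eval A v := by
  simp only [Cnd.eval]

theorem Cnd.eval_or {c d : Cnd σ m} : (c.or d).eval A v ↔ c.eval A v ∨ d.eval A v := by
  simp only [Cnd.eval]

theorem Cnd.eval_ex {g : Bound} {c : Cnd σ (m + 1)} :
    (Cnd.ex g c).eval A v ↔ ∃ a : Fin n, (a : ℕ) ≤ g.val n ∧ c.eval A (Fin.snoc v a) := by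
  simp only [Cnd.eval]

theorem Cnd.eval_rel₁ {R : σ.Rel} {t : Tm σ m} {a : Fin n} (h : t.num A v = some (a : ℕ))
    : (Cnd.rel₁ R t).eval A v ↔ A.rel R fun _ => a := by
  have h := Tm.num_eq_some_iff.1 h
  simp only [Cnd.rel₁, Cnd.eval, h]
  constructor
  · rintro ⟨u, h1, h2⟩
    have : u = fun _ => a := funext fun i => (Option.some_injective _ (h1 i)).symm
    rwa [← this]
  · exact fun h => ⟨_, fun _ => rfl, h⟩

/-- The condition `s < t`. -/
def Cnd.lt (s t : Tm σ m) : Cnd σ m := (Cnd.le s t).and (Cnd.le t s).not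

theorem Cnd.eval_lt {s t : Tm σ m} : (Cnd.lt s t).eval A v ↔
    ∃ a b, s.num A v = some a ∧ t.num A v = some b ∧ a < b := by
  simp only [Cnd.lt, Cnd.eval_and, Cnd.eval_not, Cnd.eval_le]
  constructor
  · rintro ⟨⟨a, b, h1, h2, h3⟩, h4⟩
    exact ⟨a, b, h1, h2, by by_contra h; exact h4 ⟨b, a, h2, h1, by omega⟩⟩
  · rintro ⟨a, b, h1, h2, h3⟩
    refine ⟨⟨a, b, h1, h2, h3.le⟩, ?_⟩
    rintro ⟨b', a', h4, h5, h6⟩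
    simp_all
    omega

theorem Cnd.eval_lt_iff {s t : Tm σ m} {a b : ℕ} (hs : s.num A v = some a)
    (ht : t.num A v = some b) : (Cnd.lt s t).eval A v ↔ a < b := by
  rw [Cnd.eval_lt]
  simp [hs, ht]

end Num

/-! ## Derived terms and conditions -/

section Derived

variable {σ : Schema} {n m : ℕ} {A : Interp σ n} {v : Fin m → Fin n} (K : ℕ)

/-- A condition that is always false. -/
def Cnd.ff : Cnd σ m :=
  -- The context may contain no variable at all, so a bound one is introduced. This costs one digit
  -- and is why later bounds have exponent at least one.
  let c := Cnd.ex (rootBound K) (.eq (.var (Fin.last m)) (.var (Fin.last m)))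
  c.and c.not

theorem Cnd.eval_ff : ¬ (Cnd.ff K : Cnd σ m).eval A v := by
  simp only [Cnd.ff, Cnd.eval_and, Cnd.eval_not]
  tauto

/-- The disjunction of the conditions `f i` for the `i` in a list. -/
def Cnd.any {ι : Type} (l : List ι) (f : ι → Cnd σ m) : Cnd σ m :=
  l.foldr (fun i c => (f i).or c) (Cnd.ff K)

theorem Cnd.eval_any {ι : Type} {l : List ι} {f : ι → Cnd σ m} :
    (Cnd.any K l f).eval A v ↔ ∃ i ∈ l, (f i).eval A v := by
  induction l with
  | nil => simpa [Cnd.any] using Cnd.eval_ff K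
  | cons i l ih =>
    have : (Cnd.any K (i :: l) f).eval A v ↔ (f i).eval A v ∨ (Cnd.any K l f).eval A v :=
      Cnd.eval_or
    rw [this, ih]
    simp

/-- The condition that `c` holds for some digit. -/
def Cnd.exDigit (c : Cnd σ (m + 1)) : Cnd σ m := .ex (rootBound K) c

theorem Cnd.eval_exDigit {c : Cnd σ (m + 1)} : (Cnd.exDigit K c).eval A v ↔
    ∃ a : Fin n, (a : ℕ) < base (K + 1) n ∧ c.eval A (Fin.snoc v a) := by
  unfold exDigit base
  rw [Cnd.eval_ex]
  simp only [rootBound, Nat.lt_succ_iff]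

/-- The condition that the last variable is the largest digit for which `c` holds. -/
def Cnd.maximal (c : Cnd σ (m + 1)) : Cnd σ (m + 1) :=
  -- The renamed copy of `c` skips the digit under test and speaks about the competing, newly bound
  -- one.
  c.and (Cnd.exDigit K ((c.rename (extendRenaming Fin.castSucc)).and
    (.lt (.var (Fin.last m).castSucc) (.var (Fin.last (m + 1)))))).not

theorem Cnd.eval_maximal {c : Cnd σ (m + 1)} {a : Fin n} :
    (Cnd.maximal K c).eval A (Fin.snoc v a) ↔ c.eval A (Fin.snoc v a) ∧
      ∀ a' : Fin n, (a' : ℕ) < base (K + 1) n → c.eval A (Fin.snoc v a') → a' ≤ a := by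
  simp only [Cnd.maximal, Cnd.eval_and, Cnd.eval_not, Cnd.eval_exDigit, Cnd.eval_rename,
    snoc_comp_extendRenaming, Cnd.eval_lt_iff (Tm.num_var _) (Tm.num_var _)]
  have h : ∀ a' : Fin n, (Fin.snoc v a : Fin (m + 1) → Fin n) ∘ Fin.castSucc = v := fun _ => by
    funext i; simp
  simp only [h a, Fin.snoc_castSucc, Fin.snoc_last]
  refine and_congr_right fun _ => ?_
  push Not
  exact Iff.rfl

/-- The largest digit for which `c` holds, and the value of `d` if there is none. -/
def Tm.greatest (c : Cnd σ (m + 1)) (d : Tm σ m) : Tm σ m :=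
  .ite (Cnd.exDigit K c) (.unique (rootBound K) (Cnd.maximal K c)) d

theorem Cnd.existsUnique_maximal {c : Cnd σ (m + 1)} (h : (Cnd.exDigit K c).eval A v) :
    ∃! a : Fin n, (a : ℕ) ≤ (rootBound K).val n ∧ (Cnd.maximal K c).eval A (Fin.snoc v a) := by
  classical
  rw [Cnd.eval_exDigit] at h
  obtain ⟨a, ha⟩ := h
  let S : Finset (Fin n) :=
    Finset.univ.filter fun a => (a : ℕ) < base (K + 1) n ∧ c.eval A (Fin.snoc v a)
  have hS : S.Nonempty := ⟨a, by simpa [S] using ha⟩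
  have h1 := S.max'_mem hS
  have h2 : ∀ a' : Fin n, (a' : ℕ) < base (K + 1) n → c.eval A (Fin.snoc v a') →
      a' ≤ S.max' hS := fun a' h h' => S.le_max' _ (by simp [S, h, h'])
  simp only [S, Finset.mem_filter, Finset.mem_univ, true_and] at h1
  refine ⟨S.max' hS, ⟨Nat.le_of_lt_succ h1.1, (Cnd.eval_maximal K).2 ⟨h1.2, h2⟩⟩, ?_⟩
  rintro b ⟨h3, h4⟩
  rw [Cnd.eval_maximal] at h4
  exact le_antisymm (h2 b (Nat.lt_succ_of_le h3) h4.1) (h4.2 _ h1.1 h1.2)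

theorem Tm.num_greatest {c : Cnd σ (m + 1)} {d : Tm σ m}
    (h : ∃ a : Fin n, (a : ℕ) < base (K + 1) n ∧ c.eval A (Fin.snoc v a)) :
    ∃ a : Fin n, (Tm.greatest K c d).num A v = some (a : ℕ) ∧ (a : ℕ) < base (K + 1) n ∧
      c.eval A (Fin.snoc v a) ∧
      ∀ a' : Fin n, (a' : ℕ) < base (K + 1) n → c.eval A (Fin.snoc v a') → a' ≤ a := by
  have h := (Cnd.eval_exDigit K).2 h
  have hu := Cnd.existsUnique_maximal K h
  have hs := hu.choose_spec.1
  refine ⟨hu.choose, ?_, Nat.lt_succ_of_le hs.1, (Cnd.eval_maximal K).1 hs.2⟩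
  unfold Tm.greatest
  rw [Tm.num_ite_pos h, Tm.num_eq_some_iff]
  simp only [Tm.eval]
  rw [dif_pos hu]

end Derived

/-! ## Unconditionally safe expressions of bounded work -/

section Nice

variable (K : ℕ) {σ : Schema} {m : ℕ}

/-- A term that is always safe, and whose work is bounded by a power of the base. -/
structure Tm.Nice (e : ℕ) (t : Tm σ m) : Prop where
  safe : ∀ {n : ℕ} (A : Interp σ n) (v : Fin m → Fin n), t.Safe A v
  work : ∀ n, t.work n ≤ base (K + 1) n ^ e

/-- A condition that is always safe, and whose work is bounded by a power of the base. -/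
structure Cnd.Nice (e : ℕ) (c : Cnd σ m) : Prop where
  safe : ∀ {n : ℕ} (A : Interp σ n) (v : Fin m → Fin n), c.Safe A v
  work : ∀ n, c.work n ≤ base (K + 1) n ^ e

theorem one_le_base_pow (n e : ℕ) : 1 ≤ base (K + 1) n ^ e := Nat.one_le_pow _ _ (base_pos _ _)

variable {K} {e e' : ℕ}

theorem Cnd.Nice.mono {c : Cnd σ m} (h : c.Nice K e) (he : e ≤ e') : c.Nice K e' :=
  ⟨h.safe, fun n => (h.work n).trans (Nat.pow_le_pow_right (base_pos _ _) he)⟩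

theorem Tm.Nice.var (i : Fin m) : (Tm.var i : Tm σ m).Nice K e :=
  ⟨fun _ _ => by simp only [Tm.Safe], fun n => by simpa only [Tm.work] using one_le_base_pow K n e⟩

theorem Tm.Nice.add {s t : Tm σ m} (hs : s.Nice K e) (ht : t.Nice K e) : (s.add t).Nice K e :=
  ⟨fun A v => by simpa only [Tm.Safe] using ⟨hs.safe A v, ht.safe A v⟩,
    fun n => by simpa only [Tm.work] using max_le (hs.work n) (ht.work n)⟩

theorem Tm.Nice.app₁ {f : σ.Fn} {t : Tm σ m} (ht : t.Nice K e) : (t.app₁ f).Nice K e :=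
  ⟨fun A v => by simpa only [Tm.app₁, Tm.Safe] using fun _ => ht.safe A v,
    fun n => by
      simpa only [Tm.app₁, Tm.work] using
        max_le (one_le_base_pow K n e) (Finset.sup_le fun _ _ => ht.work n)⟩

theorem Tm.Nice.ite {c : Cnd σ m} {s t : Tm σ m} (hc : c.Nice K e) (hs : s.Nice K e)
    (ht : t.Nice K e) : (Tm.ite c s t).Nice K e :=
  ⟨fun A v => by
      simpa only [Tm.Safe] using ⟨hc.safe A v, fun _ => hs.safe A v, fun _ => ht.safe A v⟩,
    fun n => by
      simpa only [Tm.work] using max_le (hc.work n) (max_le (hs.work n) (ht.work n))⟩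

theorem Cnd.Nice.le {s t : Tm σ m} (hs : s.Nice K e) (ht : t.Nice K e) : (Cnd.le s t).Nice K e :=
  ⟨fun A v => by simpa only [Cnd.Safe] using ⟨hs.safe A v, ht.safe A v⟩,
    fun n => by simpa only [Cnd.work] using max_le (hs.work n) (ht.work n)⟩

theorem Cnd.Nice.eq {s t : Tm σ m} (hs : s.Nice K e) (ht : t.Nice K e) : (Cnd.eq s t).Nice K e :=
  ⟨fun A v => by simpa only [Cnd.Safe] using ⟨hs.safe A v, ht.safe A v⟩,
    fun n => by simpa only [Cnd.work] using max_le (hs.work n) (ht.work n)⟩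

theorem Cnd.Nice.rel₁ {R : σ.Rel} {t : Tm σ m} (ht : t.Nice K e) : (Cnd.rel₁ R t).Nice K e :=
  ⟨fun A v => by simpa only [Cnd.rel₁, Cnd.Safe] using fun _ => ht.safe A v,
    fun n => by
      simpa only [Cnd.rel₁, Cnd.work] using
        max_le (one_le_base_pow K n e) (Finset.sup_le fun _ _ => ht.work n)⟩

theorem Cnd.Nice.not {c : Cnd σ m} (hc : c.Nice K e) : c.not.Nice K e :=
  ⟨fun A v => by simpa only [Cnd.Safe] using hc.safe A v,
    fun n => by simpa only [Cnd.work] using hc.work n⟩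

theorem Cnd.Nice.and {c d : Cnd σ m} (hc : c.Nice K e) (hd : d.Nice K e) : (c.and d).Nice K e :=
  ⟨fun A v => by simpa only [Cnd.Safe] using ⟨hc.safe A v, hd.safe A v⟩,
    fun n => by simpa only [Cnd.work] using max_le (hc.work n) (hd.work n)⟩

theorem Cnd.Nice.or {c d : Cnd σ m} (hc : c.Nice K e) (hd : d.Nice K e) : (c.or d).Nice K e :=
  ⟨fun A v => by simpa only [Cnd.Safe] using ⟨hc.safe A v, hd.safe A v⟩,
    fun n => by simpa only [Cnd.work] using max_le (hc.work n) (hd.work n)⟩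

theorem Cnd.Nice.lt {s t : Tm σ m} (hs : s.Nice K e) (ht : t.Nice K e) : (Cnd.lt s t).Nice K e :=
  (Cnd.Nice.le hs ht).and (Cnd.Nice.le ht hs).not

theorem Cnd.Nice.exDigit {c : Cnd σ (m + 1)} (hc : c.Nice K e) :
    (Cnd.exDigit K c).Nice K (e + 1) :=
  ⟨fun A v => by simpa only [Cnd.exDigit, Cnd.Safe] using fun a _ => hc.safe A _,
    fun n => by
      simp only [Cnd.exDigit, Cnd.work, rootBound]
      rw [pow_succ', base]
      exact Nat.mul_le_mul_left _ (hc.work n)⟩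

theorem Cnd.Nice.ff : (Cnd.ff K : Cnd σ m).Nice K (e + 1) :=
  have h := Cnd.Nice.exDigit (Cnd.Nice.eq (e := e) (Tm.Nice.var (Fin.last m))
    (Tm.Nice.var (σ := σ) (Fin.last m)))
  h.and h.not

/-- The work of a disjunction is a maximum, so finite disjunctions over levels or types are free. -/
theorem Cnd.Nice.any {ι : Type} {l : List ι} {f : ι → Cnd σ m} (h : ∀ i, (f i).Nice K (e + 1)) :
    (Cnd.any K l f).Nice K (e + 1) := by
  induction l with
  | nil => exact Cnd.Nice.ff
  | cons i l ih => exact (h i).or ih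

theorem Cnd.Nice.rename {m' : ℕ} {c : Cnd σ m} (h : c.Nice K e) (f : Fin m → Fin m') :
    (c.rename f).Nice K e :=
  ⟨fun A v => by rw [Cnd.safe_rename]; exact h.safe A _,
    fun n => by rw [Cnd.work_rename]; exact h.work n⟩

/-- The existence test in front makes the `unique` safe in every structure, whatever `c` is. One
factor of the base comes from `unique`, the other from the maximality test inside it. -/
theorem Tm.Nice.greatest {c : Cnd σ (m + 1)} {d : Tm σ m} (hc : c.Nice K e)
    (hd : d.Nice K (e + 2)) : (Tm.greatest K c d).Nice K (e + 2) := by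
  have hm : (Cnd.maximal K c).Nice K (e + 1) :=
    (hc.mono (Nat.le_succ e)).and
      (Cnd.Nice.exDigit ((hc.rename _).and (.lt (.var _) (.var _)))).not
  have hx := (Cnd.Nice.exDigit hc)
  constructor
  · intro n A v
    simp only [Tm.greatest, Tm.Safe]
    exact ⟨hx.safe A v, fun h => ⟨fun a _ => hm.safe A _, Cnd.existsUnique_maximal K h⟩,
      fun _ => hd.safe A v⟩
  · intro n
    simp only [Tm.greatest, Tm.work]
    refine max_le ((hx.mono (Nat.le_succ _)).work n) (max_le ?_ (hd.work n))
    rw [pow_succ']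
    exact Nat.mul_le_mul_left _ (hm.work n)

-- Safe procedures of bounded work

variable {τ loc : Schema} {b d : ℕ}

/-- A return-free procedure that is always safe, and whose work is bounded by a power of the
base. -/
structure Step.Nice (K e : ℕ) (P : Step τ loc b d) : Prop where
  safe : ∀ {n : ℕ} (A : Interp τ n) (v : Fin (b + d) → Fin n) (L : Interp loc n), P.Safe A v L
  work : ∀ n, P.work n ≤ base (K + 1) n ^ e

theorem Step.Nice.skip : (Step.skip : Step τ loc b d).Nice K e :=
  ⟨fun _ _ _ => by simp only [Step.Safe],
    fun n => by simpa only [Step.work] using one_le_base_pow K n e⟩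

theorem Step.Nice.seq {P Q : Step τ loc b d} (hP : P.Nice K e) (hQ : Q.Nice K e) :
    (P.seq Q).Nice K e :=
  ⟨fun A v L => by simpa only [Step.Safe] using ⟨hP.safe A v L, hQ.safe A v _⟩,
    fun n => by simpa only [Step.work] using max_le (hP.work n) (hQ.work n)⟩

theorem Step.Nice.assignFn {f : loc.Fn} {args : Fin (loc.fnArity f) → Tm (τ.sum loc) (b + d)}
    {t : Tm (τ.sum loc) (b + d)} {g} (ha : ∀ i, (args i).Nice K e) (ht : t.Nice K e) :
    (Step.assignFn f args t g).Nice K e :=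
  ⟨fun A v L => by simpa only [Step.Safe] using ⟨fun i => (ha i).safe _ v, ht.safe _ v⟩,
    fun n => by
      simpa only [Step.work] using max_le (ht.work n) (Finset.sup_le fun i _ => (ha i).work n)⟩

theorem Step.num_run_assignFn {n : ℕ} {A : Interp τ n} {v : Fin (b + d) → Fin n}
    {L : Interp loc n} {f : loc.Fn} {a t : Tm (τ.sum loc) (b + d)} {g} {x : ℕ}
    (h : a.num (A.sum L) v = some x) :
    ((Step.assignFn f (fun _ => a) t g).run A v L).num f x = t.num (A.sum L) v := by
  have hx := Tm.num_lt h
  have h : a.eval (A.sum L) v = some ⟨x, hx⟩ := Tm.num_eq_some_iff.1 h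
  simp [Interp.num, hx, Step.run, h, Tm.num]

theorem Step.num_run_assignFn_of_ne {n : ℕ} {A : Interp τ n} {v : Fin (b + d) → Fin n}
    {L : Interp loc n} {f f' : loc.Fn} {args : Fin (loc.fnArity f) → Tm (τ.sum loc) (b + d)}
    {t : Tm (τ.sum loc) (b + d)} {g} {x : ℕ} (h : f' ≠ f) :
    ((Step.assignFn f args t g).run A v L).num f' x = L.num f' x := by
  simp [Interp.num, Step.run, h]

end Nice

end DynFO

namespace DynFO

/-! ## Blocks -/

section Blocks

variable {k : ℕ}

theorem div_pow_succ (i B s : ℕ) : i / B ^ (s + 1) = i / B ^ s / B := by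
  rw [pow_succ, Nat.div_div_eq_div_mul]

/-- The tree paths of two positions agree at level `s` and differ at level `0`, so they part at some
level in between. There the two ancestors are different siblings. -/
theorem exists_level_of_ne {B i j : ℕ} (hij : i ≠ j) :
    ∀ {s : ℕ}, i / B ^ s = j / B ^ s →
      ∃ t < s, i / B ^ (t + 1) = j / B ^ (t + 1) ∧ i / B ^ t ≠ j / B ^ t
  | 0, h => by simp at h; exact absurd h hij
  | s + 1, h => by
    by_cases hs : i / B ^ s = j / B ^ s
    · obtain ⟨t, h1, h2⟩ := exists_level_of_ne hij hs
      exact ⟨t, by omega, h2⟩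
    · exact ⟨s, by omega, h, hs⟩

theorem div_pow_eq_of_le {B i j s t : ℕ} (h : i / B ^ s = j / B ^ s) (hst : s ≤ t) :
    i / B ^ t = j / B ^ t := by
  induction t, hst using Nat.le_induction with
  | base => exact h
  | succ t _ ih => rw [div_pow_succ, ih, div_pow_succ]

theorem lt_of_div_lt {i j d : ℕ} (h : i / d < j / d) : i < j := by
  by_contra h'
  exact absurd (Nat.div_le_div_right (c := d) (not_lt.1 h')) (by omega)

/-- The positions in the blocks of level `s` that are left siblings of the block `c`. -/
def leftSiblings (n B s c : ℕ) : Finset ℕ :=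
  (Finset.range n).filter fun j => j / B ^ (s + 1) = c / B ∧ j / B ^ s < c

theorem mem_leftSiblings {n B s c j : ℕ} :
    j ∈ leftSiblings n B s c ↔ j < n ∧ j / B ^ (s + 1) = c / B ∧ j / B ^ s < c := by
  simp [leftSiblings]

/-- This bounds the stored count of a nonempty block by one of its positions, so the count is a
domain element. -/
theorem leftSiblings_subset {n B s i : ℕ} : leftSiblings n B s (i / B ^ s) ⊆ Finset.range i := by
  intro j hj
  rw [mem_leftSiblings] at hj
  exact Finset.mem_range.2 (lt_of_div_lt hj.2.2)

/-- The positions left of `i` in the same block of level `s`. -/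
def blockBefore (B s i : ℕ) : Finset ℕ :=
  (Finset.range i).filter fun j => j / B ^ s = i / B ^ s

/-- A position left of `i` in the parent block lies either in the child of `i` or in a left sibling
of that child. Iterating this up to the root splits all positions left of `i` into one set of left
siblings per level. -/
theorem blockBefore_succ {n B s i : ℕ} (hi : i < n) :
    blockBefore B (s + 1) i = blockBefore B s i ∪ leftSiblings n B s (i / B ^ s) := by
  ext j
  simp only [blockBefore, Finset.mem_union, Finset.mem_filter, Finset.mem_range,
    mem_leftSiblings, ← div_pow_succ]
  constructor
  · rintro ⟨h1, h2⟩
    rcases (Nat.div_le_div_right (c := B ^ s) h1.le).eq_or_lt with h | h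
    · exact .inl ⟨h1, h⟩
    · exact .inr ⟨by omega, h2, h⟩
  · rintro (⟨h1, h2⟩ | ⟨h1, h2, h3⟩)
    · exact ⟨h1, div_pow_eq_of_le h2 (Nat.le_succ s)⟩
    · exact ⟨lt_of_div_lt h3, h2⟩

theorem disjoint_blockBefore {n B s i : ℕ} :
    Disjoint (blockBefore B s i) (leftSiblings n B s (i / B ^ s)) := by
  rw [Finset.disjoint_left]
  intro j h1 h2
  rw [mem_leftSiblings] at h2
  simp only [blockBefore, Finset.mem_filter] at h1
  omega

theorem blockBefore_zero (B i : ℕ) : blockBefore B 0 i = ∅ := by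
  ext j
  simp [blockBefore]

theorem blockBefore_eq_range {B s i : ℕ} (h : i < B ^ s) : blockBefore B s i = Finset.range i := by
  ext j
  simp only [blockBefore, Finset.mem_filter, Finset.mem_range, and_iff_left_iff_imp]
  intro hj
  rw [Nat.div_eq_of_lt h, Nat.div_eq_of_lt (hj.trans h)]

/-- A position in the block `c` of level `s` where the height is minimal, or `none` if the block
is empty. -/
def IsArgmin (n B s : ℕ) (w : ℕ → Option (Paren k)) (c : ℕ) : Option ℕ → Prop
  | none => ∀ j < n, j / B ^ s ≠ c
  | some q => q < n ∧ q / B ^ s = c ∧ ∀ j < n, j / B ^ s = c → height w q ≤ height w j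

theorem IsArgmin.exists_eq_some {n B s : ℕ} {w : ℕ → Option (Paren k)} {c : ℕ} {o : Option ℕ}
    (h : IsArgmin n B s w c o) {i : ℕ} (hi : i < n) (hc : i / B ^ s = c) :
    ∃ q, o = some q ∧ q < n ∧ q / B ^ s = c ∧
      ∀ j < n, j / B ^ s = c → height w q ≤ height w j := by
  cases o with
  | none => exact absurd hc (h i hi)
  | some q => exact ⟨q, rfl, h⟩

theorem exists_height_eq_add {w w' : ℕ → Option (Paren k)} {p : ℕ} (h : ∀ j, j ≠ p → w' j = w j) :
    ∃ d : ℤ, ∀ j, height w' j = height w j + if p < j then d else 0 := by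
  -- Height increments agree away from `p`, so the difference just after `p` persists forever, and
  -- there is none up to `p`.
  refine ⟨height w' (p + 1) - height w (p + 1), fun j => ?_⟩
  have key : ∀ j, j ≠ p →
      height w' (j + 1) - height w' j = height w (j + 1) - height w j := by
    intro j hj
    simp only [height, parenCount_range_succ, h j hj]
    push_cast
    ring
  have low : ∀ j ≤ p, height w' j = height w j := by
    intro j
    induction j with
    | zero => intro _; simp [height, parenCount]
    | succ j ih =>
      intro hj
      have := ih (by omega)
      have := key j (by omega)
      omega
  split_ifs with hj
  · induction j, hj using Nat.le_induction with
    | base => ring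
    | succ j hj ih =>
      have := key j (by omega)
      omega
  · rw [low j (by omega), add_zero]

/-- A block without `p` lies entirely on one side of `p`, so all its heights are shifted by the same
amount and a minimum remains one. -/
theorem IsArgmin.congr {n B s : ℕ} {w w' : ℕ → Option (Paren k)} {p c : ℕ} {o : Option ℕ}
    (h : ∀ j, j ≠ p → w' j = w j) (hc : c ≠ p / B ^ s) (ho : IsArgmin n B s w c o) :
    IsArgmin n B s w' c o := by
  cases o with
  | none => exact ho
  | some q =>
    obtain ⟨h1, h2, h3⟩ := ho
    refine ⟨h1, h2, fun j hj hjc => ?_⟩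
    obtain ⟨d, hd⟩ := exists_height_eq_add h
    have := h3 j hj hjc
    have hpq : p < q ↔ p < j := by
      have a : ∀ i i' : ℕ, i / B ^ s = c → i' / B ^ s = c → p < i → p < i' := by
        intro i i' e e' hi
        by_contra hi'
        have h1 := Nat.div_le_div_right (c := B ^ s) hi.le
        have h2 := Nat.div_le_div_right (c := B ^ s) (not_lt.1 hi')
        omega
      exact ⟨a q j h2 hjc, a j q hjc h2⟩
    rw [hd, hd]
    simp only [hpq]
    omega

/-- Each position `j` of the block lies in the child with digit `(j / B ^ s) % B`. This digit is at
most `j`, so it is a domain element and was among those compared. -/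
theorem isArgmin_of_children {n B s : ℕ} (hB : 0 < B) {w : ℕ → Option (Paren k)} {P a q : ℕ}
    {o : ℕ → Option ℕ} (ho : ∀ a < n, a < B → IsArgmin n B s w (P * B + a) (o a))
    (haB : a < B) (han : a < n) (hq : o a = some q)
    (hle : ∀ a' < n, a' < B → ∀ q', o a' = some q' → height w q ≤ height w q') :
    IsArgmin n B (s + 1) w P (some q) := by
  have h := ho a han haB
  rw [hq] at h
  refine ⟨h.1, ?_, fun j hj hjP => ?_⟩
  · rw [div_pow_succ, h.2.1, mul_comm, Nat.mul_add_div hB, Nat.div_eq_of_lt haB, add_zero]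
  · have hmod := Nat.mod_lt (j / B ^ s) hB
    have h1 : (j / B ^ s) % B ≤ j := (Nat.mod_le _ _).trans (Nat.div_le_self _ _)
    have h2 : P * B + (j / B ^ s) % B = j / B ^ s := by
      rw [← hjP, div_pow_succ, mul_comm, Nat.div_add_mod]
    obtain ⟨q', e, _, _, h3⟩ := (ho _ (by omega) hmod).exists_eq_some hj h2.symm
    exact (hle _ (by omega) hmod q' e).trans (h3 j hj h2.symm)

end Blocks

/-! ## The auxiliary structure -/

/-- The function symbols: multiplication and division by the base, successor and predecessor,
the numbers of parentheses in left siblings, and positions of minimal height in blocks. -/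
inductive Sym (K : ℕ) : Type
  | mulBase
  | divBase
  | succ
  | pred
  | count (b : Bool) (s : Fin (K + 1))
  | argmin (s : Fin (K + 1))

instance (K : ℕ) : Finite (Sym K) := by
  refine Finite.of_surjective
    (α := Fin 4 ⊕ (Bool × Fin (K + 1)) ⊕ Fin (K + 1))
    (fun
      | .inl 0 => .mulBase
      | .inl 1 => .divBase
      | .inl 2 => .succ
      | .inl 3 => .pred
      | .inr (.inl (b, s)) => .count b s
      | .inr (.inr s) => .argmin s) fun y => ?_
  cases y with
  | mulBase => exact ⟨.inl 0, rfl⟩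
  | divBase => exact ⟨.inl 1, rfl⟩
  | succ => exact ⟨.inl 2, rfl⟩
  | pred => exact ⟨.inl 3, rfl⟩
  | count b s => exact ⟨.inr (.inl (b, s)), rfl⟩
  | argmin s => exact ⟨.inr (.inr s), rfl⟩

instance (k : ℕ) : Finite (Paren k) :=
  Finite.of_surjective (α := Fin k ⊕ Fin k) (Sum.elim .op .cl) fun
    | .op i => ⟨.inl i, rfl⟩
    | .cl i => ⟨.inr i, rfl⟩

/-- The relation symbols tell which parenthesis is at a position, or whether it is an opening
or a closing one. -/
abbrev RelSym (k : ℕ) : Type := Paren k ⊕ Bool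

/-- The parentheses at the positions in a relation. -/
def RelSym.Sat {k : ℕ} : RelSym k → Paren k → Prop
  | .inl x, y => y = x
  | .inr b, y => y.isOp = b

abbrev auxSchema (k K : ℕ) : Schema where
  Rel := RelSym k
  Fn := Sym K
  relArity _ := 1
  fnArity _ := 1
  finiteRel := inferInstance
  finiteFn := inferInstance

/-- The schema with one unary function symbol for each level. -/
abbrev locSchema (K : ℕ) : Schema where
  Rel := Empty
  Fn := Fin (K + 1)
  relArity _ := 0
  fnArity _ := 1
  finiteRel := inferInstance
  finiteFn := inferInstance

/-- The level `s` as an index of a symbol. -/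
def lev (K s : ℕ) : Fin (K + 1) := Fin.ofNat (K + 1) s

theorem lev_ne {K s t : ℕ} (hs : s ≤ K) (ht : t ≤ K) (h : s ≠ t) : lev K s ≠ lev K t := by
  intro e
  have := congrArg Fin.val e
  simp only [lev, Fin.val_ofNat] at this
  rw [Nat.mod_eq_of_lt (by omega), Nat.mod_eq_of_lt (by omega)] at this
  exact h this

theorem lev_val {K : ℕ} (s : Fin (K + 1)) : lev K s = s := by
  ext; simp [lev]

/-- An embedding of the auxiliary schema into a schema. -/
structure Emb (k K : ℕ) (σ : Schema) where
  rel : RelSym k → σ.Rel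
  fn : Sym K → σ.Fn
  fn_arity : ∀ f, σ.fnArity (fn f) ≠ 0

/-- Heads of update rules see only the auxiliary schema, while bodies also see local symbols. Terms
over an embedding serve for both. -/
def Emb.refl (k K : ℕ) : Emb k K (auxSchema k K) := ⟨id, id, fun _ => one_ne_zero⟩

def Emb.inl (k K : ℕ) : Emb k K ((auxSchema k K).sum (locSchema K)) :=
  ⟨.inl, .inl, fun _ => one_ne_zero⟩

variable {k K : ℕ} {σ : Schema} {n m : ℕ}

/-- The arithmetical functions have the intended values. -/
structure Arithmetical (E : Emb k K σ) (A : Interp σ n) : Prop where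
  mulBase : ∀ c < n, A.num (E.fn .mulBase) c =
    if c * base (K + 1) n < n then some (c * base (K + 1) n) else none
  divBase : ∀ c < n, A.num (E.fn .divBase) c = some (c / base (K + 1) n)
  succ : ∀ x < n, A.num (E.fn .succ) x = if x + 1 < n then some (x + 1) else none
  pred : ∀ x, x + 1 < n → A.num (E.fn .pred) (x + 1) = some x

/-- The structure stores the intended information about the word `w`. -/
structure Represents (E : Emb k K σ) (A : Interp σ n) (w : ℕ → Option (Paren k)) : Prop
    extends Arithmetical E A where
  rel : ∀ R (i : Fin n), A.rel (E.rel R) (fun _ => i) ↔ ∃ x, w i = some x ∧ R.Sat x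
  -- Only blocks containing a position `i` are considered: an empty block could have `n` parentheses
  -- in its left siblings, and `n` is not in the domain.
  count : ∀ b, ∀ s ≤ K, ∀ i < n, A.num (E.fn (.count b (lev K s))) (i / base (K + 1) n ^ s) =
    some (parenCount w b (leftSiblings n (base (K + 1) n) s (i / base (K + 1) n ^ s)))
  argmin : ∀ s ≤ K, ∀ c < n,
    IsArgmin n (base (K + 1) n) s w c (A.num (E.fn (.argmin (lev K s))) c)

theorem num_sum_inr {τ loc : Schema} (A : Interp τ n) (L : Interp loc n) (f : loc.Fn) (x : ℕ) :
    (A.sum L).num (.inr f : (τ.sum loc).Fn) x = L.num f x := rfl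

theorem Represents.sum {A : Interp (auxSchema k K) n} {w : ℕ → Option (Paren k)}
    (h : Represents (Emb.refl k K) A w) (L : Interp (locSchema K) n) :
    Represents (Emb.inl k K) (A.sum L) w where
  mulBase := h.mulBase
  divBase := h.divBase
  succ := h.succ
  pred := h.pred
  rel := h.rel
  count := h.count
  argmin := h.argmin

/-! ## Terms and conditions over the auxiliary structure -/

section Terms

variable (E : Emb k K σ)

/-- The block of level `s` that contains the position `t`. -/
def blockT : ℕ → Tm σ m → Tm σ m
  | 0, t => t
  | s + 1, t => .app₁ (E.fn .divBase) (blockT s t)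

/-- The child of the block `c` with digit `z`. -/
def childT (c z : Tm σ m) : Tm σ m := .add (.app₁ (E.fn .mulBase) c) z

/-- The number of parentheses left of `t` in the block of level `s + 1` that contains `t`. -/
def partialCountT (b : Bool) : ℕ → Tm σ m → Tm σ m
  | 0, t => .app₁ (E.fn (.count b (lev K 0))) t
  | s + 1, t => .add (partialCountT b s t)
      (.app₁ (E.fn (.count b (lev K (s + 1)))) (blockT E (s + 1) t))

/-- The number of parentheses left of `t`. -/
def countT (b : Bool) (t : Tm σ m) : Tm σ m := partialCountT E b K t

/-- The condition that the height at `t` is at most the height at `u`, where the terms `N`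
give the numbers of parentheses left of a position. -/
def heightLe (N : Bool → Tm σ m → Tm σ m) (t u : Tm σ m) : Cnd σ m :=
  .le (.add (N true t) (N false u)) (.add (N true u) (N false t))

/-- The condition that there is no parenthesis at `t`. -/
def emptyC (t : Tm σ m) : Cnd σ m :=
  .and (.not (.rel₁ (E.rel (.inr true)) t)) (.not (.rel₁ (E.rel (.inr false)) t))

variable {E} {A : Interp σ n} {v : Fin m → Fin n} {w : ℕ → Option (Paren k)}

theorem num_blockT (h : Arithmetical E A) {t : Tm σ m} {x : ℕ} (ht : t.num A v = some x) :
    ∀ s, (blockT E s t).num A v = some (x / base (K + 1) n ^ s)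
  | 0 => by simpa [blockT] using ht
  | s + 1 => by
    have ih := num_blockT h ht s
    rw [blockT, Tm.num_app₁ ih, h.divBase _ (Tm.num_lt ih), div_pow_succ]

theorem num_childT (h : Arithmetical E A) {t z : Tm σ m} {c a : ℕ} (ht : t.num A v = some c)
    (hz : z.num A v = some a) : (childT E t z).num A v =
      if c * base (K + 1) n + a < n then some (c * base (K + 1) n + a) else none := by
  have h1 := h.mulBase c (Tm.num_lt ht)
  rw [← Tm.num_app₁ ht] at h1
  unfold childT
  split_ifs at h1 with hc
  · rw [Tm.num_add h1 hz]
  · rw [Tm.num_add_of_none h1, if_neg (by omega)]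

/-- Adds up the decomposition `blockBefore_succ`. Each partial sum counts positions left of `i`, so
no addition leaves the domain. -/
theorem num_partialCountT (h : Represents E A w) (b : Bool) {t : Tm σ m} {i : ℕ}
    (ht : t.num A v = some i) : ∀ s ≤ K, (partialCountT E b s t).num A v =
      some (parenCount w b (blockBefore (base (K + 1) n) (s + 1) i)) := by
  have hi := Tm.num_lt ht
  intro s
  induction s with
  | zero =>
    intro _
    have := h.count b 0 (Nat.zero_le K) i hi
    rw [partialCountT, Tm.num_app₁ ht, blockBefore_succ hi, blockBefore_zero, Finset.empty_union]
    simpa using this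
  | succ s ih =>
    intro hs
    have h1 := h.count b (s + 1) hs i hi
    rw [← Tm.num_app₁ (num_blockT h.toArithmetical ht (s + 1))] at h1
    rw [partialCountT, Tm.num_add (ih (by omega)) h1, ← parenCount_union _ _ disjoint_blockBefore,
      ← blockBefore_succ hi, if_pos]
    have h2 := parenCount_mono w b
      (show blockBefore (base (K + 1) n) (s + 1 + 1) i ⊆ Finset.range i from
        Finset.filter_subset _ _)
    have h3 : parenCount w b (Finset.range i) ≤ (Finset.range i).card :=
      Finset.card_filter_le _ _
    rw [Finset.card_range] at h3
    omega

theorem num_countT (h : Represents E A w) (b : Bool) {t : Tm σ m} {i : ℕ}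
    (ht : t.num A v = some i) :
    (countT E b t).num A v = some (parenCount w b (Finset.range i)) := by
  rw [countT, num_partialCountT h b ht K le_rfl, blockBefore_eq_range]
  exact (Tm.num_lt ht).trans_le (le_base_pow (Nat.succ_ne_zero K))

/-- Both counts concern positions below `max x y`, and no position is counted twice. -/
theorem count_add_count_lt (w : ℕ → Option (Paren k)) {x y : ℕ} (hx : x < n) (hy : y < n) :
    parenCount w true (Finset.range x) + parenCount w false (Finset.range y) < n := by
  have h1 := parenCount_mono w true (Finset.range_mono (le_max_left x y))
  have h2 := parenCount_mono w false (Finset.range_mono (le_max_right x y))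
  have h3 := parenCount_true_add_false_le w (Finset.range (max x y))
  rw [Finset.card_range] at h3
  have := max_lt hx hy
  omega

/-- Heights may be negative, so an inequality of differences is rearranged to one of sums, which are
defined by `count_add_count_lt`. The counting terms `N` are kept general in order to compare heights
before and after a change. -/
theorem eval_heightLe {N : Bool → Tm σ m → Tm σ m} {t u : Tm σ m} {x y : ℕ} (hx : x < n)
    (hy : y < n) (ht : ∀ b, (N b t).num A v = some (parenCount w b (Finset.range x)))
    (hu : ∀ b, (N b u).num A v = some (parenCount w b (Finset.range y))) :
    (heightLe N t u).eval A v ↔ height w x ≤ height w y := by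
  have h1 := Tm.num_add (ht true) (hu false)
  have h2 := Tm.num_add (hu true) (ht false)
  rw [if_pos (count_add_count_lt w hx hy)] at h1
  rw [if_pos (count_add_count_lt w hy hx)] at h2
  rw [heightLe, Cnd.eval_le_iff h1 h2]
  unfold height
  omega

theorem eval_heightLe_countT (h : Represents E A w) {t u : Tm σ m} {x y : ℕ}
    (ht : t.num A v = some x) (hu : u.num A v = some y) :
    (heightLe (countT E) t u).eval A v ↔ height w x ≤ height w y :=
  eval_heightLe (Tm.num_lt ht) (Tm.num_lt hu) (fun b => num_countT h b ht)
    fun b => num_countT h b hu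

theorem eval_rel₁ (h : Represents E A w) {t : Tm σ m} {i : ℕ} (ht : t.num A v = some i)
    (R : RelSym k) : (Cnd.rel₁ (E.rel R) t).eval A v ↔ ∃ x, w i = some x ∧ R.Sat x := by
  have hi := Tm.num_lt ht
  rw [Cnd.eval_rel₁ (a := ⟨i, hi⟩) ht, h.rel]

theorem eval_rel₁_isOp (h : Represents E A w) {t : Tm σ m} {i : ℕ} (ht : t.num A v = some i)
    (b : Bool) : (Cnd.rel₁ (E.rel (.inr b)) t).eval A v ↔ (w i).map Paren.isOp = some b := by
  rw [eval_rel₁ h ht, Option.map_eq_some_iff]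
  rfl

theorem eval_emptyC (h : Represents E A w) {t : Tm σ m} {i : ℕ} (ht : t.num A v = some i) :
    (emptyC E t).eval A v ↔ w i = none := by
  rw [emptyC, Cnd.eval_and, Cnd.eval_not, Cnd.eval_not, eval_rel₁_isOp h ht, eval_rel₁_isOp h ht]
  cases w i with
  | none => simp
  | some x => cases hx : x.isOp <;> simp [hx]

variable {e : ℕ}

theorem nice_blockT {t : Tm σ m} (h : t.Nice K e) : ∀ s, (blockT E s t).Nice K e
  | 0 => h
  | s + 1 => (nice_blockT h s).app₁

theorem nice_childT {c z : Tm σ m} (h : c.Nice K e) (h' : z.Nice K e) :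
    (childT E c z).Nice K e := h.app₁.add h'

theorem nice_countT {b : Bool} {t : Tm σ m} (h : t.Nice K e) : (countT E b t).Nice K e := by
  have : ∀ s, (partialCountT E b s t).Nice K e := by
    intro s
    induction s with
    | zero => exact h.app₁
    | succ s ih => exact ih.add (nice_blockT h _).app₁
  exact this K

theorem nice_heightLe {N : Bool → Tm σ m → Tm σ m} {t u : Tm σ m} (ht : ∀ b, (N b t).Nice K e)
    (hu : ∀ b, (N b u).Nice K e) : (heightLe N t u).Nice K e :=
  .le ((ht _).add (hu _)) ((hu _).add (ht _))

theorem nice_emptyC {t : Tm σ m} (h : t.Nice K e) : (emptyC E t).Nice K e :=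
  (Cnd.Nice.rel₁ h).not.and (Cnd.Nice.rel₁ h).not

end Terms

end DynFO

namespace DynFO

variable {k K : ℕ} {σ : Schema} {n m : ℕ}

/-! ## The effect of a change operation -/

/-- The content of the changed position after the change. -/
def WordChange.new {α : Type} : WordChange α → Option α → Option α
  | .set x, none => some x
  | .set _, some y => some y
  | .reset, _ => none

/-- The word `w'` arises from `w` by the change `δ` at position `p`. -/
structure Changed (δ : WordChange (Paren k)) (p : ℕ) (w w' : ℕ → Option (Paren k)) : Prop where
  ne : ∀ j, j ≠ p → w' j = w j
  self : w' p = δ.new (w p)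

theorem changed_extend (δ : WordChange (Paren k)) (p : Fin n) (w : Fin n → Option (Paren k)) :
    Changed δ p (extend w) (extend (δ.apply w p)) := by
  constructor
  · intro j hj
    unfold extend
    split_ifs with h
    · have : (⟨j, h⟩ : Fin n) ≠ p := fun e => hj (congrArg Fin.val e)
      cases δ <;> simp [WordChange.apply, this]
    · rfl
  · rw [extend_val, extend_val]
    cases δ with
    | set x => cases h : w p <;> simp [WordChange.apply, WordChange.new, h]
    | reset => simp [WordChange.apply, WordChange.new]

section Change

variable (E : Emb k K σ) (δ : WordChange (Paren k))

/-- The condition that `δ` adds an opening or closing parenthesis at `p`. -/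
def incC (b : Bool) (p : Tm σ m) : Cnd σ m :=
  match δ with
  -- Setting an occupied position has no effect.
  | .set x => if x.isOp = b then emptyC E p else .ff K
  | .reset => .ff K

/-- The condition that `δ` removes an opening or closing parenthesis at `p`. -/
def decC (b : Bool) (p : Tm σ m) : Cnd σ m :=
  match δ with
  | .set _ => .ff K
  | .reset => .rel₁ (E.rel (.inr b)) p

/-- The number `t` of opening or closing parentheses in a set, adapted to the change `δ` at `p`,
where `c` says whether `p` is in the set. -/
def changedT (b : Bool) (p : Tm σ m) (c : Cnd σ m) (t : Tm σ m) : Tm σ m :=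
  .ite (c.and (incC E δ b p)) (.app₁ (E.fn .succ) t)
    (.ite (c.and (decC E δ b p)) (.app₁ (E.fn .pred) t) t)

/-- The number of parentheses left of `t` after the change `δ` at `p`. -/
def newCountT (p : Tm σ m) (b : Bool) (t : Tm σ m) : Tm σ m :=
  changedT E δ b p (.lt p t) (countT E b t)

variable {E δ} {A : Interp σ n} {v : Fin m → Fin n} {w w' : ℕ → Option (Paren k)} {e : ℕ}

theorem nice_incC {b : Bool} {p : Tm σ m} (h : p.Nice K (e + 1)) :
    (incC E δ b p).Nice K (e + 1) := by
  cases δ with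
  | set x =>
    simp only [incC]
    split_ifs
    · exact nice_emptyC h
    · exact .ff
  | reset => exact .ff

theorem nice_decC {b : Bool} {p : Tm σ m} (h : p.Nice K (e + 1)) :
    (decC E δ b p).Nice K (e + 1) := by
  cases δ with
  | set x => exact .ff
  | reset => exact .rel₁ h

theorem nice_changedT {b : Bool} {p : Tm σ m} {c : Cnd σ m} {t : Tm σ m} (hp : p.Nice K (e + 1))
    (hc : c.Nice K (e + 1)) (ht : t.Nice K (e + 1)) : (changedT E δ b p c t).Nice K (e + 1) :=
  .ite (hc.and (nice_incC hp)) ht.app₁ (.ite (hc.and (nice_decC hp)) ht.app₁ ht)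

theorem nice_newCountT {b : Bool} {p t : Tm σ m} (hp : p.Nice K (e + 1))
    (ht : t.Nice K (e + 1)) : (newCountT E δ p b t).Nice K (e + 1) :=
  nice_changedT hp (.lt hp ht) (nice_countT ht)

theorem eval_incC (h : Represents E A w) {p : ℕ} (hw : Changed δ p w w') {tp : Tm σ m}
    (hp : tp.num A v = some p) (b : Bool) : (incC E δ b tp).eval A v ↔
      (w p).map Paren.isOp ≠ some b ∧ (w' p).map Paren.isOp = some b := by
  rw [hw.self]
  cases δ with
  | set x =>
    simp only [incC]
    split_ifs with hb
    · rw [eval_emptyC h hp]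
      cases w p <;> simp [WordChange.new, hb]
    · refine iff_of_false (Cnd.eval_ff K) ?_
      cases w p <;> simp [WordChange.new, hb]
  | reset =>
    refine iff_of_false (Cnd.eval_ff K) ?_
    simp [WordChange.new]

theorem eval_decC (h : Represents E A w) {p : ℕ} (hw : Changed δ p w w') {tp : Tm σ m}
    (hp : tp.num A v = some p) (b : Bool) : (decC E δ b tp).eval A v ↔
      (w' p).map Paren.isOp ≠ some b ∧ (w p).map Paren.isOp = some b := by
  rw [hw.self]
  cases δ with
  | set x =>
    refine iff_of_false (Cnd.eval_ff K) ?_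
    cases w p <;> simp [WordChange.new]
  | reset =>
    simp only [decC]
    rw [eval_rel₁_isOp h hp]
    simp [WordChange.new]

/-- A change at one position alters a count by at most one, so successor or predecessor suffices.
The bound `hD` ensures that the successor is defined. -/
theorem num_changedT (h : Represents E A w) {p : ℕ} (hw : Changed δ p w w') {tp t : Tm σ m}
    (hp : tp.num A v = some p) {b : Bool} {c : Cnd σ m} {D : Finset ℕ}
    (hc : c.eval A v ↔ p ∈ D) (ht : t.num A v = some (parenCount w b D))
    (hD : parenCount w' b D < n) :
    (changedT E δ b tp c t).num A v = some (parenCount w' b D) := by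
  have hinc := eval_incC h hw hp b
  have hdec := eval_decC h hw hp b
  unfold changedT
  by_cases h1 : (c.and (incC E δ b tp)).eval A v
  · rw [Tm.num_ite_pos h1, Tm.num_app₁ ht, h.succ _ (Tm.num_lt ht)]
    rw [Cnd.eval_and, hc, hinc] at h1
    have := parenCount_eq_succ h1.1 hw.ne h1.2.1 h1.2.2
    rw [← this, if_pos hD]
  rw [Tm.num_ite_neg h1]
  by_cases h2 : (c.and (decC E δ b tp)).eval A v
  · rw [Tm.num_ite_pos h2, Tm.num_app₁ ht]
    rw [Cnd.eval_and, hc, hdec] at h2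
    have h3 := parenCount_eq_succ h2.1 (fun j hj => (hw.ne j hj).symm) h2.2.1 h2.2.2
    have h4 := Tm.num_lt ht
    rw [h3] at h4 ⊢
    exact h.pred _ h4
  rw [Tm.num_ite_neg h2, ht]
  rw [Cnd.eval_and, hc, hinc] at h1
  rw [Cnd.eval_and, hc, hdec] at h2
  congr 1
  refine parenCount_congr fun j hj => ?_
  by_cases hjp : j = p
  · subst hjp
    tauto
  · rw [hw.ne j hjp]

theorem num_newCountT (h : Represents E A w) {p : ℕ} (hw : Changed δ p w w') {tp t : Tm σ m}
    (hp : tp.num A v = some p) {x : ℕ} (ht : t.num A v = some x) (b : Bool) :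
    (newCountT E δ tp b t).num A v = some (parenCount w' b (Finset.range x)) := by
  refine num_changedT h hw hp ?_ (num_countT h b ht) ?_
  · rw [Cnd.eval_lt_iff hp ht, Finset.mem_range]
  · have h3 : parenCount w' b (Finset.range x) ≤ (Finset.range x).card :=
      Finset.card_filter_le _ _
    rw [Finset.card_range] at h3
    exact h3.trans_lt (Tm.num_lt ht)

end Change

/-! ## Recomputing positions of minimal height -/

section Argmin

/-- The value of the local function of level `s`. -/
def locT (s : ℕ) (t : Tm ((auxSchema k K).sum (locSchema K)) m) :
    Tm ((auxSchema k K).sum (locSchema K)) m :=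
  .app₁ (.inr (lev K s)) t

/-- A position of minimal height in the child with digit `z` of the block of level `s + 1` of `p`,
after the change at `p`, where the local function of level `s` has the value for the block of
`p`. -/
def candidateT (s : ℕ) (p z : Tm ((auxSchema k K).sum (locSchema K)) m) :
    Tm ((auxSchema k K).sum (locSchema K)) m :=
  let c := childT (Emb.inl k K) (blockT (Emb.inl k K) (s + 1) p) z
  .ite (.eq c (blockT (Emb.inl k K) s p)) (locT s p)
    (.app₁ ((Emb.inl k K).fn (.argmin (lev K s))) c)

/-- The condition that the last variable is the digit of a child with minimal height. -/
def bestC (δ : WordChange (Paren k)) (s : ℕ) (i : Fin m) :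
    Cnd ((auxSchema k K).sum (locSchema K)) (m + 1) :=
  let cand := candidateT s (.var i.castSucc) (.var (Fin.last m))
  let cand₁ := candidateT s (.var i.castSucc.castSucc) (.var (Fin.last m).castSucc)
  let cand₂ := candidateT s (.var i.castSucc.castSucc) (.var (Fin.last (m + 1)))
  -- Equating a candidate with itself tests that it is defined, that is, that the child is not
  -- empty.
  .and (.eq cand cand) (.not (.exDigit K (.and (.eq cand₂ cand₂)
    (.not (heightLe (newCountT (Emb.inl k K) δ (.var i.castSucc.castSucc)) cand₁ cand₂)))))

/-- A position of minimal height in the block of level `s + 1`. -/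
def newArgminT (δ : WordChange (Paren k)) (s : ℕ) (i : Fin m) :
    Tm ((auxSchema k K).sum (locSchema K)) m :=
  -- The default digit is never used, since the block contains the changed position and hence has a
  -- best child.
  candidateT s (.var i) (.greatest K (bestC δ s i) (.var i))

variable {e : ℕ} {δ : WordChange (Paren k)}

theorem nice_candidateT {s : ℕ} {p z : Tm ((auxSchema k K).sum (locSchema K)) m}
    (hp : p.Nice K e) (hz : z.Nice K e) : (candidateT s p z).Nice K e :=
  have h := nice_childT (E := Emb.inl k K) (nice_blockT hp (s + 1)) hz
  .ite (.eq h (nice_blockT hp s)) hp.app₁ h.app₁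

/-- The exponent is composed of one for comparing new heights, one for the competing child, and two
for `Tm.greatest`. -/
theorem nice_newArgminT {s : ℕ} {i : Fin m} : (newArgminT (K := K) δ s i).Nice K 4 := by
  refine nice_candidateT (.var _) (.greatest (e := 2) (.and ?_ (.not (.exDigit (.and ?_ (.not ?_)))))
    (.var _))
  · exact .eq (nice_candidateT (.var _) (.var _)) (nice_candidateT (.var _) (.var _))
  · exact .eq (nice_candidateT (.var _) (.var _)) (nice_candidateT (.var _) (.var _))
  · exact nice_heightLe (e := 1)
      (fun b => nice_newCountT (e := 0) (.var _) (nice_candidateT (.var _) (.var _)))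
      (fun b => nice_newCountT (e := 0) (.var _) (nice_candidateT (.var _) (.var _)))

variable {A : Interp (auxSchema k K) n} {L : Interp (locSchema K) n} {v : Fin m → Fin n}
  {w w' : ℕ → Option (Paren k)} {p : ℕ}

/-- The child containing `p` is covered by the local function. Every other child keeps its stored
minimum by `IsArgmin.congr`. If the number of the child is not in the domain, the child is empty and
the candidate is undefined. -/
theorem isArgmin_num_candidateT (h : Represents (Emb.refl k K) A w) (hw : Changed δ p w w')
    {s : ℕ} (hs : s ≤ K)
    (hL : IsArgmin n (base (K + 1) n) s w' (p / base (K + 1) n ^ s) (L.num (lev K s) p))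
    {tp z : Tm ((auxSchema k K).sum (locSchema K)) m} (hp : tp.num (A.sum L) v = some p) {a : ℕ}
    (hz : z.num (A.sum L) v = some a) :
    IsArgmin n (base (K + 1) n) s w' (p / base (K + 1) n ^ (s + 1) * base (K + 1) n + a)
      ((candidateT s tp z).num (A.sum L) v) := by
  have h' := h.sum L
  have hb := fun s => num_blockT h'.toArithmetical hp s
  have hc := num_childT h'.toArithmetical (hb (s + 1)) hz
  unfold candidateT
  simp only
  split_ifs at hc with hlt
  · by_cases heq : p / base (K + 1) n ^ (s + 1) * base (K + 1) n + a = p / base (K + 1) n ^ s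
    · rw [Tm.num_ite_pos (Cnd.eval_eq.2 ⟨_, hc, heq ▸ hb s⟩), locT, Tm.num_app₁ hp, heq]
      exact hL
    · rw [Tm.num_ite_neg, Tm.num_app₁ hc]
      · exact (h.argmin s hs _ hlt).congr hw.ne heq
      · rw [Cnd.eval_eq]
        rintro ⟨x, h1, h2⟩
        rw [hc] at h1
        rw [hb] at h2
        simp_all
  · rw [Tm.num_ite_neg, Tm.num_app₁_of_none ((Emb.inl k K).fn_arity _) hc]
    · intro j hj e
      have := Nat.div_le_self j (base (K + 1) n ^ s)
      omega
    · rw [Cnd.eval_eq]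
      rintro ⟨x, h1, h2⟩
      rw [hc] at h1
      simp at h1

/-- The candidate term occurs under different numbers of variables. The function `o` records that
its value depends on the digit only. -/
theorem eval_bestC (h : Represents (Emb.refl k K) A w) (hw : Changed δ p w w') {i : Fin m}
    (hi : (v i : ℕ) = p) {s : ℕ} {o : ℕ → Option ℕ}
    (ho : ∀ {m' : ℕ} (v' : Fin m' → Fin n) (i' j : Fin m'), (v' i' : ℕ) = p →
      (candidateT s (.var i') (.var j)).num (A.sum L) v' = o (v' j)) (a : Fin n) :
    (bestC δ s i).eval (A.sum L) (Fin.snoc v a) ↔ ∃ q, o a = some q ∧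
      ∀ a' < n, a' < base (K + 1) n → ∀ q', o a' = some q' → height w' q ≤ height w' q' := by
  have h' := h.sum L
  have hq : ∀ a q, o a = some q → a < n → q < n := by
    intro a q hq ha
    have := ho (m' := 2) (fun j => if j = 0 then v i else ⟨a, ha⟩) 0 1 (by simp [hi])
    simp only [Fin.isValue, one_ne_zero, if_false] at this
    rw [hq] at this
    exact Tm.num_lt this
  have e1 : (candidateT s (.var i.castSucc) (.var (Fin.last m))).num (A.sum L) (Fin.snoc v a) =
      o a := by
    rw [ho _ _ _ (by simpa using hi)]; simp
  unfold bestC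
  simp only
  rw [Cnd.eval_and, Cnd.eval_not, Cnd.eval_exDigit, Cnd.eval_eq]
  simp only [e1, Cnd.eval_and, Cnd.eval_not, Cnd.eval_eq, and_self]
  have e2 : ∀ a', (candidateT s (.var i.castSucc.castSucc) (.var (Fin.last (m + 1)))).num (A.sum L)
      (Fin.snoc (Fin.snoc v a : Fin (m + 1) → Fin n) a' : Fin (m + 2) → Fin n) = o a' := by
    intro a'
    rw [ho _ _ _ (by simpa using hi)]; simp
  have e3 : ∀ a', (candidateT s (.var i.castSucc.castSucc) (.var (Fin.last m).castSucc)).num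
      (A.sum L) (Fin.snoc (Fin.snoc v a : Fin (m + 1) → Fin n) a' : Fin (m + 2) → Fin n) =
      o a := by
    intro a'
    rw [ho _ _ _ (by simpa using hi)]; simp
  have e4 : ∀ a', (Tm.var i.castSucc.castSucc : Tm ((auxSchema k K).sum (locSchema K)) _).num
      (A.sum L) (Fin.snoc (Fin.snoc v a : Fin (m + 1) → Fin n) a' : Fin (m + 2) → Fin n) =
      some p := by
    intro a'
    rw [Tm.num_var]; simpa using hi
  have key : ∀ (a' : Fin n) q q', o a = some q → o a' = some q' →
      ((heightLe (newCountT (Emb.inl k K) δ (.var i.castSucc.castSucc))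
        (candidateT s (.var i.castSucc.castSucc) (.var (Fin.last m).castSucc))
        (candidateT s (.var i.castSucc.castSucc) (.var (Fin.last (m + 1))))).eval (A.sum L)
        (Fin.snoc (Fin.snoc v a : Fin (m + 1) → Fin n) a' : Fin (m + 2) → Fin n) ↔
      height w' q ≤ height w' q') := by
    intro a' q q' h1 h2
    exact eval_heightLe (hq _ _ h1 a.2) (hq _ _ h2 a'.2)
      (fun b => num_newCountT h' hw (e4 a') ((e3 a').trans h1) b)
      (fun b => num_newCountT h' hw (e4 a') ((e2 a').trans h2) b)
  simp only [e2]
  constructor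
  · rintro ⟨⟨q, h1⟩, h2⟩
    refine ⟨q, h1, fun a' ha' hB q' h3 => ?_⟩
    by_contra h4
    exact h2 ⟨⟨a', ha'⟩, hB, ⟨q', h3⟩, fun h5 => h4 ((key ⟨a', ha'⟩ q q' h1 h3).1 h5)⟩
  · rintro ⟨q, h1, h2⟩
    refine ⟨⟨q, h1⟩, ?_⟩
    rintro ⟨a', hB, ⟨q', h3⟩, h4⟩
    exact h4 ((key a' q q' h1 h3).2 (h2 a' a'.2 hB q' h3))

theorem isArgmin_num_newArgminT (h : Represents (Emb.refl k K) A w) (hw : Changed δ p w w')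
    {s : ℕ} (hs : s ≤ K)
    (hL : IsArgmin n (base (K + 1) n) s w' (p / base (K + 1) n ^ s) (L.num (lev K s) p))
    {i : Fin m} (hi : (v i : ℕ) = p) :
    IsArgmin n (base (K + 1) n) (s + 1) w' (p / base (K + 1) n ^ (s + 1))
      ((newArgminT δ s i).num (A.sum L) v) := by
  classical
  set B := base (K + 1) n with hBdef
  have hB : 0 < B := base_pos _ _
  have hp : p < n := hi ▸ (v i).2
  have h' := h.sum L
  -- A canonical valuation by the changed position and the digit `a`, from which `o` is read off.
  -- Its value for `a ≥ n` is irrelevant.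
  let v₂ : ℕ → Fin 2 → Fin n := fun a j => if j = 0 then v i else if ha : a < n then ⟨a, ha⟩ else v i
  let o : ℕ → Option ℕ := fun a => (candidateT s (.var 0) (.var 1)).num (A.sum L) (v₂ a)
  have num_candidateT : ∀ {m₁ m₂ : ℕ} (v₁ : Fin m₁ → Fin n) (v₂ : Fin m₂ → Fin n)
      (p₁ z₁ : Tm ((auxSchema k K).sum (locSchema K)) m₁)
      (p₂ z₂ : Tm ((auxSchema k K).sum (locSchema K)) m₂) {a : ℕ},
      p₁.num (A.sum L) v₁ = some p → p₂.num (A.sum L) v₂ = some p →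
      z₁.num (A.sum L) v₁ = some a → z₂.num (A.sum L) v₂ = some a →
      (candidateT s p₁ z₁).num (A.sum L) v₁ = (candidateT s p₂ z₂).num (A.sum L) v₂ := by
    intro m₁ m₂ v₁ v₂ p₁ z₁ p₂ z₂ a hp₁ hp₂ hz₁ hz₂
    have b₁ := fun s => num_blockT h'.toArithmetical hp₁ s
    have b₂ := fun s => num_blockT h'.toArithmetical hp₂ s
    have c₁ := num_childT h'.toArithmetical (b₁ (s + 1)) hz₁
    have c₂ := num_childT h'.toArithmetical (b₂ (s + 1)) hz₂
    have hc := c₁.trans c₂.symm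
    have heq : (Cnd.eq (childT (Emb.inl k K) (blockT (Emb.inl k K) (s + 1) p₁) z₁)
        (blockT (Emb.inl k K) s p₁)).eval (A.sum L) v₁ ↔
        (Cnd.eq (childT (Emb.inl k K) (blockT (Emb.inl k K) (s + 1) p₂) z₂)
        (blockT (Emb.inl k K) s p₂)).eval (A.sum L) v₂ := by
      rw [Cnd.eval_eq, Cnd.eval_eq, hc, b₁, b₂]
    unfold candidateT
    simp only
    by_cases hd : (Cnd.eq (childT (Emb.inl k K) (blockT (Emb.inl k K) (s + 1) p₁) z₁)
        (blockT (Emb.inl k K) s p₁)).eval (A.sum L) v₁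
    · rw [Tm.num_ite_pos hd, Tm.num_ite_pos (heq.1 hd), locT, locT, Tm.num_app₁ hp₁,
        Tm.num_app₁ hp₂]
    · rw [Tm.num_ite_neg hd, Tm.num_ite_neg (fun h => hd (heq.2 h))]
      split_ifs at c₁ c₂ with hlt
      · rw [Tm.num_app₁ c₁, Tm.num_app₁ c₂]
      · rw [Tm.num_app₁_of_none ((Emb.inl k K).fn_arity _) c₁,
          Tm.num_app₁_of_none ((Emb.inl k K).fn_arity _) c₂]
  have hv₀ : ∀ a, (Tm.var 0 : Tm ((auxSchema k K).sum (locSchema K)) 2).num (A.sum L) (v₂ a) =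
      some p := by
    intro a
    rw [Tm.num_var]
    simp [v₂, hi]
  have hv₁ : ∀ a < n, (Tm.var 1 : Tm ((auxSchema k K).sum (locSchema K)) 2).num (A.sum L) (v₂ a) =
      some a := by
    intro a ha
    rw [Tm.num_var]
    simp [v₂, ha]
  have hoA : ∀ a < n, a < B → IsArgmin n B s w' (p / B ^ (s + 1) * B + a) (o a) := by
    intro a ha _
    exact isArgmin_num_candidateT h hw hs hL (hv₀ a) (hv₁ a ha)
  have ho : ∀ {m' : ℕ} (v' : Fin m' → Fin n) (i' j : Fin m'), (v' i' : ℕ) = p →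
      (candidateT s (.var i') (.var j)).num (A.sum L) v' = o (v' j) := by
    intro m' v' i' j hi'
    exact num_candidateT _ _ _ _ _ _ (by rw [Tm.num_var, hi']) (hv₀ _) (Tm.num_var _)
      (hv₁ _ (v' j).2)
  have hbest := fun a => eval_bestC (v := v) h hw hi ho a
  -- The child that contains a minimum of the whole block is a best one.
  have hex : ∃ a : Fin n, (a : ℕ) < B ∧ (bestC δ s i).eval (A.sum L) (Fin.snoc v a) := by
    obtain ⟨j, hj, hmin⟩ := Finset.exists_min_image
      ((Finset.range n).filter fun j => j / B ^ (s + 1) = p / B ^ (s + 1)) (height w')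
      ⟨p, by simp [hp]⟩
    simp only [Finset.mem_filter, Finset.mem_range] at hj hmin
    have hmod := Nat.mod_lt (j / B ^ s) hB
    have h1 : (j / B ^ s) % B ≤ j := (Nat.mod_le _ _).trans (Nat.div_le_self _ _)
    have h2 : p / B ^ (s + 1) * B + (j / B ^ s) % B = j / B ^ s := by
      rw [← hj.2, div_pow_succ, mul_comm, Nat.div_add_mod]
    obtain ⟨q, e, _, _, h3⟩ := (hoA _ (by omega) hmod).exists_eq_some hj.1 h2.symm
    refine ⟨⟨(j / B ^ s) % B, by omega⟩, hmod, (hbest _).2 ⟨q, e, fun a' ha' hB' q' hq' => ?_⟩⟩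
    have h4 := hoA a' ha' hB'
    rw [hq'] at h4
    refine (h3 j hj.1 h2.symm).trans (hmin q' ⟨h4.1, ?_⟩)
    rw [div_pow_succ, h4.2.1, mul_comm, Nat.mul_add_div hB, Nat.div_eq_of_lt hB', add_zero]
  obtain ⟨a, ha, haB, hab, _⟩ := Tm.num_greatest K (d := .var i) hex
  obtain ⟨q, hq, hle⟩ := (hbest a).1 hab
  have : (newArgminT δ s i).num (A.sum L) v = some q := by
    rw [newArgminT, num_candidateT _ (v₂ a) _ _ (.var 0) (.var 1) (by rw [Tm.num_var, hi]) (hv₀ _) ha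
      (hv₁ _ a.2)]
    exact hq
  rw [this]
  exact isArgmin_of_children hB hoA haB a.2 hq hle

/-- The assignment of `t` to the local function of level `s` at the first variable. -/
def assignFirst (s : ℕ) (t : Tm ((auxSchema k K).sum (locSchema K)) 1) :
    Step (auxSchema k K) (locSchema K) 1 0 :=
  .assignFn (lev K s) (fun _ => .var 0) t fun j => j.elim0

/-- The computation of positions of minimal height in the blocks that contain the changed
position, up to level `s`. -/
def recompute (δ : WordChange (Paren k)) : ℕ → Step (auxSchema k K) (locSchema K) 1 0
  | 0 => assignFirst 0 (.var 0)
  | s + 1 => .seq (recompute δ s) (assignFirst (s + 1) (newArgminT δ s 0))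

theorem nice_recompute : ∀ s, (recompute (K := K) δ s).Nice K 4
  | 0 => .assignFn (fun _ => .var _) (.var _)
  | s + 1 => (nice_recompute s).seq (.assignFn (fun _ => .var _) nice_newArgminT)

/-- Each level has its own local symbol, so later assignments leave the lower levels intact. -/
theorem isArgmin_num_recompute (h : Represents (Emb.refl k K) A w) (hw : Changed δ p w w')
    {v : Fin (1 + 0) → Fin n} (hv : (v 0 : ℕ) = p) : ∀ s ≤ K, ∀ t ≤ s,
      IsArgmin n (base (K + 1) n) t w' (p / base (K + 1) n ^ t)
        (((recompute δ s).run A v L).num (lev K t) p) := by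
  intro s
  have h0 : ∀ L, (Tm.var 0 : Tm ((auxSchema k K).sum (locSchema K)) (1 + 0)).num (A.sum L) v =
      some p := by
    intro L
    rw [Tm.num_var, hv]
  induction s with
  | zero =>
    intro _ t ht
    obtain rfl : t = 0 := by omega
    rw [recompute, assignFirst, Step.num_run_assignFn (h0 _), h0]
    refine ⟨hv ▸ (v 0).2, rfl, fun j _ hj => ?_⟩
    simp only [pow_zero, Nat.div_one] at hj
    rw [hj]
  | succ s ih =>
    intro hs t ht
    rw [recompute, Step.run, assignFirst]
    rcases ht.eq_or_lt with rfl | ht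
    · rw [Step.num_run_assignFn (h0 _)]
      exact isArgmin_num_newArgminT h hw (by omega) (ih (by omega) s le_rfl) hv
    · rw [Step.num_run_assignFn_of_ne (lev_ne (by omega) hs (by omega))]
      exact ih (by omega) t (by omega)

end Argmin

end DynFO

namespace DynFO

variable {k K : ℕ} {n : ℕ}

theorem Interp.num_of_lt {σ : Schema} (A : Interp σ n) (f : σ.Fn) {x : ℕ} (h : x < n) :
    A.num f x = (A.fn f fun _ => ⟨x, h⟩).map Fin.val := dif_pos h

theorem Interp.num_of_not_lt {σ : Schema} (A : Interp σ n) (f : σ.Fn) {x : ℕ} (h : ¬ x < n) :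
    A.num f x = none := dif_neg h

theorem Program.start_fn_eq {Pb : DynProblem} (P : Program Pb) {f : P.aux.Fn}
    {u : Fin (P.aux.fnArity f) → Fin n} {o : Option (Fin n)}
    (h : ∀ a : Fin n, (P.initFn f).Realize
      (Fin.snoc u a : Fin (P.aux.fnArity f + 1) → Fin n) ↔ o = some a) :
    (P.start n).fn f u = o := by
  unfold Program.start
  cases o with
  | none => exact dif_neg fun ⟨a, ha, _⟩ => by simpa using (h a).1 ha
  | some y =>
    have hex : ∃! a : Fin n, (P.initFn f).Realize
        (Fin.snoc u a : Fin (P.aux.fnArity f + 1) → Fin n) :=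
      ⟨y, (h y).2 rfl, fun b hb => (Option.some_injective _ ((h b).1 hb)).symm⟩
    exact (dif_pos hex).trans ((h _).1 hex.choose_spec.1).symm

/-! ## Update rules with one digit -/

section Rules

/-- An update rule for a unary function that ranges over one digit. -/
def digitFnRule (P : Step (auxSchema k K) (locSchema K) 1 0) (h : Tm (auxSchema k K) (1 + 1))
    (t : Tm ((auxSchema k K).sum (locSchema K)) (1 + 1)) : Rule (auxSchema k K) 1 1 Tm where
  loc := locSchema K
  ell := 1
  bound _ := rootBound K
  head _ := h
  pre := P
  main := .ret t

/-- An update rule for a unary relation that ranges over one digit. -/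
def digitRelRule (h : Tm (auxSchema k K) (1 + 1))
    (c : Cnd ((auxSchema k K).sum (locSchema K)) (1 + 1)) : Rule (auxSchema k K) 1 1 Cnd where
  loc := locSchema K
  ell := 1
  bound _ := rootBound K
  head _ := h
  pre := .skip
  main := .ret c

variable {P : Step (auxSchema k K) (locSchema K) 1 0} {h : Tm (auxSchema k K) (1 + 1)}
  {t : Tm ((auxSchema k K).sum (locSchema K)) (1 + 1)}
  {c : Cnd ((auxSchema k K).sum (locSchema K)) (1 + 1)} {A : Interp (auxSchema k K) n}
  {p : Fin 1 → Fin n}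

theorem prod_rootBound : ∏ _i : Fin 1, ((rootBound K).val n + 1) = base (K + 1) n := by
  simp [rootBound, base]

theorem work_digitFnRule_le (hP : P.Nice K 4) (hh : h.Nice K 3) (ht : t.Nice K 3) (n : ℕ) :
    (digitFnRule P h t).work n (Tm.work n) ≤ base (K + 1) n ^ 4 := by
  have e : (digitFnRule P h t).work n (Tm.work n) = max (P.work n)
      ((∏ _i : Fin 1, ((rootBound K).val n + 1)) *
        max (Finset.univ.sup fun _ : Fin 1 => h.work n) (t.work n)) := rfl
  rw [e, prod_rootBound, pow_succ']
  exact max_le ((hP.work n).trans_eq (pow_succ' _ 3))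
    (Nat.mul_le_mul_left _ (max_le (Finset.sup_le fun _ _ => hh.work n) (ht.work n)))

theorem work_digitRelRule_le (hh : h.Nice K 3) (hc : c.Nice K 3) (n : ℕ) :
    (digitRelRule h c).work n (Cnd.work n) ≤ base (K + 1) n ^ 4 := by
  have e : (digitRelRule h c).work n (Cnd.work n) = max 1
      ((∏ _i : Fin 1, ((rootBound K).val n + 1)) *
        max (Finset.univ.sup fun _ : Fin 1 => h.work n) (c.work n)) := rfl
  rw [e, prod_rootBound, pow_succ']
  exact max_le ((one_le_base_pow K n 4).trans_eq (pow_succ' _ 3))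
    (Nat.mul_le_mul_left _ (max_le (Finset.sup_le fun _ _ => hh.work n) (hc.work n)))

theorem relSafe_digitRelRule (hh : h.Nice K 3) (hc : c.Nice K 3) :
    relSafe (digitRelRule h c) A p :=
  ⟨⟨by simp only [digitRelRule, Step.Safe], fun _ _ => ⟨fun _ => hh.safe _ _, trivial⟩⟩,
    fun _ _ => hc.safe _ _⟩

theorem append_zero (x : Fin 1 → Fin n) : (Fin.append p x : Fin (1 + 1) → Fin n) 0 = p 0 := rfl

theorem hits_digitFnRule_iff {x : Fin 1 → Fin n} {u : Fin n} :
    (digitFnRule P h t).Hits A p x (fun _ => u) ↔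
      (x 0 : ℕ) < base (K + 1) n ∧ h.num A (Fin.append p x) = some (u : ℕ) := by
  rw [Tm.num_eq_some_iff]
  constructor
  · exact fun ⟨h1, h2⟩ => ⟨Nat.lt_succ_of_le (h1 (0 : Fin 1)), h2 0⟩
  · rintro ⟨h1, h2⟩
    refine ⟨fun i => ?_, fun _ => h2⟩
    obtain rfl : i = (0 : Fin 1) := Subsingleton.elim (α := Fin 1) _ _
    exact Nat.le_of_lt_succ h1

theorem hits_digitRelRule_iff {x : Fin 1 → Fin n} {u : Fin n} :
    (digitRelRule h c).Hits A p x (fun _ => u) ↔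
      (x 0 : ℕ) < base (K + 1) n ∧ h.num A (Fin.append p x) = some (u : ℕ) := by
  rw [Tm.num_eq_some_iff]
  constructor
  · exact fun ⟨h1, h2⟩ => ⟨Nat.lt_succ_of_le (h1 (0 : Fin 1)), h2 0⟩
  · rintro ⟨h1, h2⟩
    refine ⟨fun i => ?_, fun _ => h2⟩
    obtain rfl : i = (0 : Fin 1) := Subsingleton.elim (α := Fin 1) _ _
    exact Nat.le_of_lt_succ h1

/-- The value that the rule assigns to an element is determined by the element. -/
def ValueOf (P : Step (auxSchema k K) (locSchema K) 1 0) (h : Tm (auxSchema k K) (1 + 1))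
    (t : Tm ((auxSchema k K).sum (locSchema K)) (1 + 1)) (A : Interp (auxSchema k K) n)
    (p : Fin 1 → Fin n) (val : ℕ → Option ℕ) : Prop :=
  ∀ V : Fin (1 + 1) → Fin n, V 0 = p 0 → (V 1 : ℕ) < base (K + 1) n → ∀ u, h.num A V = some u →
    t.num (A.sum (P.run A p (Interp.empty (locSchema K) n))) V = val u

theorem map_fnResult (hv : ∃ val, ValueOf P h t A p val) {x y : Fin 1 → Fin n} {u : Fin 1 → Fin n}
    (hx : (digitFnRule P h t).Hits A p x u) (hy : (digitFnRule P h t).Hits A p y u) :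
    fnResult (digitFnRule P h t) A p x = fnResult (digitFnRule P h t) A p y := by
  obtain ⟨val, hv⟩ := hv
  obtain ⟨u, rfl⟩ : ∃ u', u = fun _ => u' := ⟨u 0, funext fun i => by rw [Subsingleton.elim i 0]⟩
  rw [hits_digitFnRule_iff] at hx hy
  have h1 := hv _ (append_zero x) hx.1 _ hx.2
  have h2 := hv _ (append_zero y) hy.1 _ hy.2
  exact Option.map_injective Fin.val_injective (h1.trans h2.symm)

theorem fnSafe_digitFnRule (hP : P.Nice K 4) (hh : h.Nice K 3) (ht : t.Nice K 3)
    (hv : ∃ val, ValueOf P h t A p val) : fnSafe (digitFnRule P h t) A p :=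
  ⟨⟨hP.safe _ _ _, fun _ _ => ⟨fun _ => hh.safe _ _, trivial⟩⟩, fun _ _ => ht.safe _ _,
    fun _ _ _ hx hy => map_fnResult hv hx hy⟩

theorem map_updateFn_of_hit {val : ℕ → Option ℕ} (hv : ValueOf P h t A p val)
    {old : (Fin 1 → Fin n) → Option (Fin n)} {u : Fin n} {V : Fin (1 + 1) → Fin n}
    (h0 : V 0 = p 0) (h1 : (V 1 : ℕ) < base (K + 1) n) (hu : h.num A V = some (u : ℕ)) :
    (updateFn (digitFnRule P h t) A p old fun _ => u).map Fin.val = val u := by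
  have hV : V = Fin.append p (fun _ : Fin 1 => V 1) := by
    funext i
    fin_cases i
    · exact h0
    · rfl
  have hex : ∃ x, (digitFnRule P h t).Hits A p x fun _ => u :=
    ⟨fun _ : Fin 1 => V 1, hits_digitFnRule_iff.2 ⟨h1, hV ▸ hu⟩⟩
  rw [updateFn, dif_pos hex]
  have hs := hits_digitFnRule_iff.1 hex.choose_spec
  exact hv _ (append_zero hex.choose) hs.1 _ hs.2

theorem map_updateFn_of_not_hit {old : (Fin 1 → Fin n) → Option (Fin n)} {u : Fin n}
    (hu : ∀ V : Fin (1 + 1) → Fin n, V 0 = p 0 → (V 1 : ℕ) < base (K + 1) n →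
      h.num A V ≠ some (u : ℕ)) :
    updateFn (digitFnRule P h t) A p old (fun _ => u) = old fun _ => u := by
  rw [updateFn, dif_neg]
  rintro ⟨x, hx⟩
  have hx := hits_digitFnRule_iff.1 hx
  exact hu _ (append_zero x) hx.1 hx.2

/-- All digits write the same truth value to the changed position, so the digit plays no role here.
It only gives relations and functions rules of the same shape. -/
theorem updateRel_digitRelRule {old : (Fin 1 → Fin n) → Prop} {u : Fin n} {val : Prop}
    (hv : ∀ V : Fin (1 + 1) → Fin n, V 0 = p 0 →
      (c.eval (A.sum (Interp.empty (locSchema K) n)) V ↔ val)) :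
    updateRel (digitRelRule (.var 0) c) A p old (fun _ => u) ↔
      (u = p 0 ∧ val) ∨ (u ≠ p 0 ∧ old fun _ => u) := by
  have hn : 0 < n := u.pos
  have hits : ∀ x : Fin 1 → Fin n, (digitRelRule (.var 0) c).Hits A p x (fun _ => u) ↔
      (x 0 : ℕ) < base (K + 1) n ∧ u = p 0 := by
    intro x
    rw [hits_digitRelRule_iff, Tm.num_var, append_zero, Option.some_inj, Fin.val_inj, eq_comm]
  have hres : ∀ x, relResult (digitRelRule (.var 0) c) A p x ↔ val :=
    fun x => hv _ (append_zero x)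
  have hex : (∃ x : Fin 1 → Fin n, (x 0 : ℕ) < base (K + 1) n) :=
    ⟨fun _ => ⟨0, hn⟩, base_pos _ _⟩
  unfold updateRel
  constructor
  · rintro (⟨x, h1, h2⟩ | ⟨h1, h2⟩)
    · exact .inl ⟨((hits x).1 h1).2, (hres x).1 h2⟩
    · refine .inr ⟨fun e => h2 ?_, h1⟩
      obtain ⟨x, hx⟩ := hex
      exact ⟨x, (hits x).2 ⟨hx, e⟩⟩
  · rintro (⟨h1, h2⟩ | ⟨h1, h2⟩)
    · obtain ⟨x, hx⟩ := hex
      exact .inl ⟨x, (hits x).2 ⟨hx, h1⟩, (hres x).2 h2⟩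
    · exact .inr ⟨h2, fun ⟨x, hx⟩ => h1 ((hits x).1 hx).2⟩

end Rules

/-! ## The dynamic program -/

section Program

/-- The places where a function is updated. -/
def fnHead : Sym K → Tm (auxSchema k K) (1 + 1)
  -- All siblings of the ancestor of the changed position are rewritten. Those not to its right
  -- receive their old value.
  | .count _ s => childT (Emb.refl k K) (blockT (Emb.refl k K) (s + 1) (.var 0)) (.var 1)
  | .argmin s => blockT (Emb.refl k K) s (.var 0)
  | _ => .var 0

def fnPre (δ : WordChange (Paren k)) : Sym K → Step (auxSchema k K) (locSchema K) 1 0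
  | .argmin s => recompute δ s
  | _ => .skip

/-- The updated number of parentheses in the left siblings of a child. -/
def newSiblingCountT (δ : WordChange (Paren k)) (b : Bool) (s : Fin (K + 1)) :
    Tm ((auxSchema k K).sum (locSchema K)) (1 + 1) :=
  let c := childT (Emb.inl k K) (blockT (Emb.inl k K) (s + 1) (.var 0)) (.var 1)
  changedT (Emb.inl k K) δ b (.var 0) (.lt (blockT (Emb.inl k K) s (.var 0)) c)
    (.app₁ ((Emb.inl k K).fn (.count b s)) c)

/-- The new value of a function. -/
def fnValue (δ : WordChange (Paren k)) : Sym K → Tm ((auxSchema k K).sum (locSchema K)) (1 + 1)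
  | .count b s => newSiblingCountT δ b s
  | .argmin s => locT s (.var 0)
  -- The arithmetical functions are static: a value is overwritten by itself.
  | f => .app₁ ((Emb.inl k K).fn f) (.var 0)

open Classical in
/-- The new value of a relation at the changed position. -/
noncomputable def relValue (δ : WordChange (Paren k)) (R : RelSym k) :
    Cnd ((auxSchema k K).sum (locSchema K)) (1 + 1) :=
  match δ with
  | .set x => if R.Sat x then
      .or (.rel₁ ((Emb.inl k K).rel R) (.var 0)) (emptyC (Emb.inl k K) (.var 0))
      else .rel₁ ((Emb.inl k K).rel R) (.var 0)
  | .reset => .ff K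

/-- The initial graph of a function, on the variables `0` and `1`. -/
def initGraph : Sym K → ∀ n, (ℕ → Fin n) → Prop
  | .mulBase, n, v => (v 0 : ℕ) * base (K + 1) n = v 1
  | .divBase, n, v => (v 0 : ℕ) / base (K + 1) n = v 1
  | .succ, _, v => (v 0 : ℕ) + 1 = v 1
  | .pred, _, v => (v 1 : ℕ) + 1 = v 0
  | .count _ _, _, v => (v 1 : ℕ) = 0
  -- All heights of the empty word are zero, so the first position of a block serves as its minimum.
  -- If it is outside the domain, the block is empty.
  | .argmin s, n, v => (v 0 : ℕ) * base (K + 1) n ^ (s : ℕ) = v 1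

theorem uDef_initGraph : ∀ f : Sym K, UDef (initGraph f)
  | .mulBase => UDef.mulBase K
  | .divBase => UDef.divBase K
  | .succ => UDef.isSucc
  | .pred => UDef.isPred
  | .count _ _ => UDef.isZero
  | .argmin s => UDef.blockStart K s

/-- The dynamic program with a given rule for range queries. -/
noncomputable def dyckProgram (k K : ℕ) (q : QueryRule (auxSchema k K) 2) :
    Program (RangeMember (dyck k)) where
  aux := auxSchema k K
  initRel _ := ⊥
  initFn f := (uDef_initGraph f).exists_formula_two.choose
  relRule δ R := digitRelRule (.var 0) (relValue δ R)
  fnRule δ f := digitFnRule (fnPre δ f) (fnHead f) (fnValue δ f)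
  qryRule _ := q

variable {δ : WordChange (Paren k)}

theorem nice_relValue {R : RelSym k} : (relValue (K := K) δ R).Nice K 3 := by
  cases δ with
  | set x =>
    simp only [relValue]
    split_ifs
    · exact .or (.rel₁ (.var _)) (nice_emptyC (.var _))
    · exact .rel₁ (.var _)
  | reset => exact .ff

theorem nice_fnHead : ∀ f : Sym K, (fnHead (k := k) f).Nice K 3
  | .mulBase => .var _
  | .divBase => .var _
  | .succ => .var _
  | .pred => .var _
  | .count _ _ => nice_childT (nice_blockT (.var _) _) (.var _)
  | .argmin _ => nice_blockT (.var _) _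

theorem nice_fnValue : ∀ f : Sym K, (fnValue δ f).Nice K 3
  | .mulBase => .app₁ (.var _)
  | .divBase => .app₁ (.var _)
  | .succ => .app₁ (.var _)
  | .pred => .app₁ (.var _)
  | .count _ _ =>
    nice_changedT (.var _) (.lt (nice_blockT (.var _) _) (nice_childT (nice_blockT (.var _) _)
      (.var _))) (.app₁ (nice_childT (nice_blockT (.var _) _) (.var _)))
  | .argmin _ => .app₁ (.var _)

theorem nice_fnPre : ∀ f : Sym K, (fnPre δ f).Nice K 4
  | .mulBase => .skip
  | .divBase => .skip
  | .succ => .skip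
  | .pred => .skip
  | .count _ _ => .skip
  | .argmin _ => nice_recompute _

-- Correctness of the update rules

variable {A : Interp (auxSchema k K) n} {w w' : ℕ → Option (Paren k)} {p : Fin 1 → Fin n}

/-- The values that the update rule assigns to the function symbol `f`. -/
noncomputable def newValue (δ : WordChange (Paren k)) (f : Sym K) (A : Interp (auxSchema k K) n)
    (p : Fin 1 → Fin n) (u : ℕ) : Option ℕ :=
  match f with
  | .argmin s =>
    ((recompute δ s).run A p (Interp.empty (locSchema K) n)).num s (p 0)
  | .count b s => if hu : u < n then (newSiblingCountT δ b s).num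
      (A.sum (Interp.empty (locSchema K) n)) ![p 0, ⟨u % base (K + 1) n,
        (Nat.mod_le _ _).trans_lt hu⟩] else none
  | f => A.num f u

theorem childT_mod (h : Arithmetical (Emb.refl k K) A) {s u : ℕ} {V : Fin (1 + 1) → Fin n}
    (h1 : (V 1 : ℕ) < base (K + 1) n)
    (hu : (childT (Emb.refl k K) (blockT (Emb.refl k K) (s + 1) (.var 0)) (.var 1)).num A V =
      some u) : u = (V 0 : ℕ) / base (K + 1) n ^ (s + 1) * base (K + 1) n + V 1 ∧
        u % base (K + 1) n = V 1 ∧ u / base (K + 1) n = (V 0 : ℕ) / base (K + 1) n ^ (s + 1) ∧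
        u < n := by
  have hn := Tm.num_lt hu
  rw [num_childT h (num_blockT h (Tm.num_var 0) _) (Tm.num_var 1)] at hu
  have hb := base_pos (K + 1) n
  split_ifs at hu with hlt
  · simp only [Option.some.injEq] at hu
    refine ⟨hu.symm, ?_, ?_, hn⟩
    · rw [← hu, mul_comm, Nat.mul_add_mod, Nat.mod_eq_of_lt h1]
    · rw [← hu, mul_comm, Nat.mul_add_div hb, Nat.div_eq_of_lt h1, add_zero]

/-- For counts, the digit can be recovered from the updated block as its remainder modulo the base.
For the other symbols the value does not depend on the digit. -/
theorem valueOf_newValue (h : Represents (Emb.refl k K) A w) (f : Sym K) :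
    ValueOf (fnPre δ f) (fnHead f) (fnValue δ f) A p (newValue δ f A p) := by
  intro V h0 h1 u hu
  have stat : ∀ f : Sym K, (Tm.var 0 : Tm (auxSchema k K) (1 + 1)).num A V = some u →
      ((Tm.var 0 : Tm ((auxSchema k K).sum (locSchema K)) (1 + 1)).app₁ ((Emb.inl k K).fn f)).num
        (A.sum (Interp.empty (locSchema K) n)) V = A.num f u := by
    intro f hu
    rw [Tm.num_app₁ (x := u)]
    · rfl
    · rw [Tm.num_var] at hu ⊢
      exact hu
  cases f with
  | mulBase => exact stat _ hu
  | divBase => exact stat _ hu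
  | succ => exact stat _ hu
  | pred => exact stat _ hu
  | argmin s =>
    simp only [fnValue, locT, newValue, lev_val]
    rw [Tm.num_app₁ (Tm.num_var 0), h0]
    rfl
  | count b s =>
    obtain ⟨_, h2, _, hn⟩ := childT_mod h.toArithmetical h1 hu
    simp only [newValue, dif_pos hn]
    have : V = ![p 0, ⟨u % base (K + 1) n, (Nat.mod_le _ _).trans_lt hn⟩] := by
      funext i
      fin_cases i
      · exact h0
      · exact Fin.ext h2.symm
    rw [← this]
    rfl

variable {q : QueryRule (auxSchema k K) 2}

theorem num_update_of_hit (h : Represents (Emb.refl k K) A w) {f : Sym K} {u : ℕ}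
    {V : Fin (1 + 1) → Fin n} (h0 : V 0 = p 0) (h1 : (V 1 : ℕ) < base (K + 1) n)
    (hu : (fnHead f).num A V = some u) :
    ((dyckProgram k K q).update δ p A).num f u = newValue δ f A p u := by
  have hn := Tm.num_lt hu
  exact (dif_pos hn).trans (map_updateFn_of_hit (u := ⟨u, hn⟩) (valueOf_newValue h f) h0 h1 hu)

theorem num_update_of_not_hit {f : Sym K} {u : ℕ}
    (hu : ∀ V : Fin (1 + 1) → Fin n, V 0 = p 0 → (V 1 : ℕ) < base (K + 1) n →
      (fnHead f).num A V ≠ some u) :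
    ((dyckProgram k K q).update δ p A).num f u = A.num f u := by
  by_cases hn : u < n
  · exact (Interp.num_of_lt _ _ hn).trans
      ((congrArg _ (map_updateFn_of_not_hit (u := ⟨u, hn⟩) hu)).trans (A.num_of_lt _ hn).symm)
  · exact (Interp.num_of_not_lt _ _ hn).trans (A.num_of_not_lt _ hn).symm

theorem num_update_of_static (h : Represents (Emb.refl k K) A w) {f : Sym K}
    (hf : newValue δ f A p = A.num f) (u : ℕ) :
    ((dyckProgram k K q).update δ p A).num f u = A.num f u := by
  by_cases hu : ∀ V : Fin (1 + 1) → Fin n, V 0 = p 0 → (V 1 : ℕ) < base (K + 1) n →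
      (fnHead f).num A V ≠ some u
  · exact num_update_of_not_hit hu
  · push Not at hu
    obtain ⟨V, h0, h1, hu⟩ := hu
    rw [num_update_of_hit h h0 h1 hu, hf]

theorem Represents.rel_update (h : Represents (Emb.refl k K) A w) (hw : Changed δ (p 0) w w')
    (R : RelSym k) (i : Fin n) : ((dyckProgram k K q).update δ p A).rel R (fun _ => i) ↔
      ∃ x, w' i = some x ∧ R.Sat x := by
  have key : ∀ V : Fin (1 + 1) → Fin n, V 0 = p 0 →
      ((relValue δ R).eval (A.sum (Interp.empty (locSchema K) n)) V ↔
        ∃ x, w' (p 0) = some x ∧ R.Sat x) := by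
    intro V h0
    have hv : (Tm.var 0 : Tm ((auxSchema k K).sum (locSchema K)) (1 + 1)).num
        (A.sum (Interp.empty (locSchema K) n)) V = some (p 0 : ℕ) := by rw [Tm.num_var, h0]
    have h' := h.sum (Interp.empty (locSchema K) n)
    rw [hw.self]
    cases δ with
    | set x =>
      simp only [relValue]
      split_ifs with hx
      · rw [Cnd.eval_or, eval_rel₁ h' hv, eval_emptyC h' hv]
        cases w (p 0) <;> simp [WordChange.new, hx]
      · rw [eval_rel₁ h' hv]
        cases w (p 0) <;> simp [WordChange.new, hx]
    | reset => exact iff_of_false (Cnd.eval_ff K) (by simp [WordChange.new])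
  refine (updateRel_digitRelRule key).trans ?_
  by_cases hi : i = p 0
  · subst hi
    simp
  · have hne : (i : ℕ) ≠ p 0 := fun e => hi (Fin.ext e)
    simp only [hi, false_and, ne_eq, not_false_eq_true, true_and, false_or, hw.ne _ hne]
    exact h.rel R i

/-- If `p` and `i` have the same ancestor at level `s + 1`, the block of `i` is a child that the
rule visits. Otherwise it is not visited, and its left siblings do not contain `p`. -/
theorem Represents.num_count_update (h : Represents (Emb.refl k K) A w)
    (hw : Changed δ (p 0) w w') (b : Bool) {s : ℕ} (hs : s ≤ K) {i : ℕ} (hi : i < n) :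
    ((dyckProgram k K q).update δ p A).num (.count b (lev K s)) (i / base (K + 1) n ^ s) =
      some (parenCount w' b (leftSiblings n (base (K + 1) n) s (i / base (K + 1) n ^ s))) := by
  set B := base (K + 1) n with hBdef
  have hB : 0 < B := base_pos _ _
  have hlev : ((lev K s : Fin (K + 1)) : ℕ) = s := by
    simp only [lev, Fin.val_ofNat]
    exact Nat.mod_eq_of_lt (by omega)
  have hin : i / B ^ s < n := (Nat.div_le_self _ _).trans_lt hi
  have hcount := h.count b s hs i hi
  by_cases hpi : (p 0 : ℕ) / B ^ (s + 1) = i / B ^ (s + 1)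
  · have hmod := Nat.mod_lt (i / B ^ s) hB
    have hmn : (i / B ^ s) % B < n := (Nat.mod_le _ _).trans_lt hin
    let V : Fin (1 + 1) → Fin n := ![p 0, ⟨(i / B ^ s) % B, hmn⟩]
    have hsum : (p 0 : ℕ) / B ^ (s + 1) * B + (i / B ^ s) % B = i / B ^ s := by
      rw [hpi, div_pow_succ, mul_comm, Nat.div_add_mod]
    have hhead : (fnHead (.count b (lev K s))).num A V = some (i / B ^ s) := by
      rw [fnHead, num_childT h.toArithmetical (num_blockT h.toArithmetical (Tm.num_var 0) _)
        (Tm.num_var 1), hlev]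
      show (if (p 0 : ℕ) / B ^ (s + 1) * B + (i / B ^ s) % B < n then _ else _) = _
      rw [if_pos (by rw [hsum]; exact hin)]
      exact congrArg some hsum
    rw [num_update_of_hit h (V := V) rfl hmod hhead]
    simp only [newValue, dif_pos hin]
    have h' := h.sum (Interp.empty (locSchema K) n)
    have hp : (Tm.var 0 : Tm ((auxSchema k K).sum (locSchema K)) (1 + 1)).num
        (A.sum (Interp.empty (locSchema K) n)) V = some (p 0 : ℕ) := Tm.num_var 0
    have hc : (childT (Emb.inl k K) (blockT (Emb.inl k K) (s + 1) (.var 0)) (.var 1)).num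
        (A.sum (Interp.empty (locSchema K) n)) V = some (i / B ^ s) := by
      rw [num_childT h'.toArithmetical (num_blockT h'.toArithmetical (Tm.num_var 0) _)
        (Tm.num_var 1)]
      show (if (p 0 : ℕ) / B ^ (s + 1) * B + (i / B ^ s) % B < n then _ else _) = _
      rw [if_pos (by rw [hsum]; exact hin)]
      exact congrArg some hsum
    show (newSiblingCountT δ b (lev K s)).num _ V = _
    unfold newSiblingCountT
    simp only [hlev]
    refine num_changedT h' hw hp ?_ ?_ ?_
    · rw [Cnd.eval_lt_iff (num_blockT h'.toArithmetical hp s) hc, mem_leftSiblings, ← div_pow_succ]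
      exact ⟨fun h => ⟨(p 0).2, hpi, h⟩, fun h => h.2.2⟩
    · rw [Tm.num_app₁ hc]
      exact hcount
    · have h1 := parenCount_mono w' b (leftSiblings_subset (n := n) (B := B) (s := s) (i := i))
      have h3 : parenCount w' b (Finset.range i) ≤ (Finset.range i).card :=
        Finset.card_filter_le _ _
      rw [Finset.card_range] at h3
      omega
  · rw [num_update_of_not_hit]
    · refine hcount.trans (congrArg some (parenCount_congr fun j hj => ?_))
      rw [mem_leftSiblings, ← div_pow_succ] at hj
      rw [hw.ne j fun e => hpi (by rw [← e]; exact hj.2.1)]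
    · intro V h0 h1 hu
      have := (childT_mod h.toArithmetical h1 hu).2.2.1
      rw [hlev, h0, ← div_pow_succ] at this
      exact hpi this.symm

/-- Only the block of the changed position is written, with the value of `recompute`. The other
blocks rely on `IsArgmin.congr`. -/
theorem Represents.isArgmin_update (h : Represents (Emb.refl k K) A w)
    (hw : Changed δ (p 0) w w') {s : ℕ} (hs : s ≤ K) {c : ℕ} (hc : c < n) :
    IsArgmin n (base (K + 1) n) s w' c
      (((dyckProgram k K q).update δ p A).num (.argmin (lev K s)) c) := by
  have hlev : ((lev K s : Fin (K + 1)) : ℕ) = s := by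
    simp only [lev, Fin.val_ofNat]
    exact Nat.mod_eq_of_lt (by omega)
  have hhead : ∀ V : Fin (1 + 1) → Fin n, V 0 = p 0 →
      (fnHead (.argmin (lev K s))).num A V = some ((p 0 : ℕ) / base (K + 1) n ^ s) := by
    intro V h0
    rw [fnHead, num_blockT h.toArithmetical (Tm.num_var 0), hlev, h0]
  by_cases hpc : c = (p 0 : ℕ) / base (K + 1) n ^ s
  · rw [hpc, num_update_of_hit h (V := ![p 0, ⟨0, (p 0).pos⟩]) rfl (base_pos _ _) (hhead _ rfl)]
    simp only [newValue, hlev]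
    exact isArgmin_num_recompute h hw rfl s hs s le_rfl
  · rw [num_update_of_not_hit]
    · exact (h.argmin s hs c hc).congr hw.ne hpc
    · intro V h0 _ hu
      rw [hhead V h0] at hu
      exact hpc (Option.some_injective _ hu).symm

theorem Represents.update (h : Represents (Emb.refl k K) A w) (hw : Changed δ (p 0) w w') :
    Represents (Emb.refl k K) ((dyckProgram k K q).update δ p A) w' where
  mulBase c hc := (num_update_of_static h rfl c).trans (h.mulBase c hc)
  divBase c hc := (num_update_of_static h rfl c).trans (h.divBase c hc)
  succ x hx := (num_update_of_static h rfl x).trans (h.succ x hx)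
  pred x hx := (num_update_of_static h rfl (x + 1)).trans (h.pred x hx)
  rel := h.rel_update hw
  count b _ hs _ hi := h.num_count_update hw b hs hi
  argmin _ hs _ hc := h.isArgmin_update hw hs hc

-- The initial structure and the invariant

theorem num_start {f : Sym K} {x : ℕ} {o : Option ℕ} (hx : x < n) (ho : ∀ y, o = some y → y < n)
    (h : ∀ a : Fin n, initGraph f n (fun i => if i = 0 then ⟨x, hx⟩ else a) ↔ o = some (a : ℕ)) :
    ((dyckProgram k K q).start n).num f x = o := by
  have hf : ∀ a : Fin n, ((dyckProgram k K q).initFn f).Realize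
      (Fin.snoc (fun _ => ⟨x, hx⟩) a : Fin (1 + 1) → Fin n) ↔ o = some (a : ℕ) := by
    intro a
    rw [← h a]
    exact (uDef_initGraph f).exists_formula_two.choose_spec n _
  refine (Interp.num_of_lt _ _ hx).trans ?_
  cases o with
  | none =>
    exact congrArg (Option.map Fin.val) (Program.start_fn_eq (dyckProgram k K q) (f := f)
      (o := none) fun a => (hf a).trans (by simp))
  | some y =>
    exact congrArg (Option.map Fin.val) (Program.start_fn_eq (dyckProgram k K q) (f := f)
      (o := some ⟨y, ho y rfl⟩) fun a => (hf a).trans (by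
        rw [Option.some_inj, Option.some_inj, Fin.ext_iff]))

theorem represents_start : Represents (Emb.refl k K) ((dyckProgram k K q).start n)
    fun _ => none where
  mulBase c hc := by
    refine num_start (f := .mulBase) hc (fun y hy => ?_) fun a => ?_
    · split_ifs at hy with h
      · simp only [Option.some.injEq] at hy; omega
    · show c * base (K + 1) n = (a : ℕ) ↔ _
      have := a.2
      split_ifs
      · simp
      · simp; omega
  divBase c hc := by
    refine num_start (f := .divBase) hc (fun y hy => ?_) fun a => ?_
    · simp only [Option.some.injEq] at hy
      exact hy ▸ (Nat.div_le_self _ _).trans_lt hc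
    · exact Option.some_inj.symm
  succ x hx := by
    refine num_start (f := .succ) hx (fun y hy => ?_) fun a => ?_
    · split_ifs at hy with h
      · simp only [Option.some.injEq] at hy; omega
    · show x + 1 = (a : ℕ) ↔ _
      have := a.2
      split_ifs
      · simp
      · simp; omega
  pred x hx := by
    refine num_start (f := .pred) hx (fun y hy => ?_) fun a => ?_
    · simp only [Option.some.injEq] at hy; omega
    · show (a : ℕ) + 1 = x + 1 ↔ _
      rw [Option.some_inj]
      omega
  rel R i := by simp [dyckProgram, Program.start]
  count b s hs i hi := by
    have hn : i / base (K + 1) n ^ s < n := (Nat.div_le_self _ _).trans_lt hi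
    refine num_start (f := .count b (lev K s)) hn (fun y hy => ?_) fun a => ?_
    · simp [parenCount] at hy; omega
    · show (a : ℕ) = 0 ↔ _
      simp [parenCount, eq_comm]
  argmin s hs c hc := by
    have hlev : ((lev K s : Fin (K + 1)) : ℕ) = s := by
      simp only [lev, Fin.val_ofNat]
      exact Nat.mod_eq_of_lt (by omega)
    have e : ((dyckProgram k K q).start n).num (.argmin (lev K s)) c =
        if c * base (K + 1) n ^ s < n then some (c * base (K + 1) n ^ s) else none := by
      refine num_start hc (fun y hy => ?_) fun a => ?_
      · split_ifs at hy with h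
        · simp only [Option.some.injEq] at hy; omega
      · show c * base (K + 1) n ^ ((lev K s : Fin (K + 1)) : ℕ) = (a : ℕ) ↔ _
        rw [hlev]
        have := a.2
        split_ifs
        · simp
        · simp; omega
    show IsArgmin _ _ _ _ _ (((dyckProgram k K q).start n).num (.argmin (lev K s)) c)
    rw [e]
    split_ifs with h
    · exact ⟨h, Nat.mul_div_cancel _ (Nat.pow_pos (base_pos _ _)), fun j _ _ => by
        simp [height, parenCount]⟩
    · intro j hj e
      have := Nat.div_mul_le_self j (base (K + 1) n ^ s)
      rw [e] at this
      omega

theorem represents_of_reach {I : (RangeMember (dyck k)).State n}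
    {A : Interp (dyckProgram k K q).aux n} (h : (dyckProgram k K q).Reach I A) : Represents (Emb.refl k K) A (extend I) := by
  induction h with
  | start =>
    have : extend (fun _ : Fin n => (none : Option (Paren k))) = fun _ => none := by
      funext i; simp [extend]
    have h := represents_start (k := k) (K := K) (n := n) (q := q)
    rw [← this] at h
    exact h
  | change _ δ p ih => exact ih.update (changed_extend δ _ _)

/-- The program maintains the Dyck language if the query rule answers correctly. -/
theorem dyckProgram_maintains
    (hq : ∀ {n : ℕ} (A : Interp (auxSchema k K) n) (I : Fin n → Option (Paren k)),
      Represents (Emb.refl k K) A (extend I) → ∀ p : Fin 2 → Fin n,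
        q.Safe A p ∧ (q.Holds A p ↔ factor I (p 0) (p 1) ∈ dyck k)) :
    (dyckProgram k K q).Maintains := by
  intro n I A h
  have h := represents_of_reach h
  exact ⟨fun δ p => ⟨fun R => relSafe_digitRelRule (.var _) nice_relValue, fun f =>
    fnSafe_digitFnRule (nice_fnPre f) (nice_fnHead f) (nice_fnValue f) ⟨_, valueOf_newValue h f⟩⟩,
    fun _ p => hq A I h p⟩

theorem dyckProgram_changeWork {f : ℕ → ℝ}
    (h : Asymptotics.IsBigO Filter.atTop (fun n => ((base (K + 1) n : ℝ)) ^ 4) f) :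
    (dyckProgram k K q).ChangeWork f := by
  refine fun δ => ⟨fun R => ?_, fun F => ?_⟩
  · refine Asymptotics.IsBigO.trans (.of_bound 1 (.of_forall fun n => ?_)) h
    rw [Real.norm_natCast, one_mul, norm_pow, Real.norm_natCast]
    exact_mod_cast work_digitRelRule_le (.var _) nice_relValue n
  · refine Asymptotics.IsBigO.trans (.of_bound 1 (.of_forall fun n => ?_)) h
    rw [Real.norm_natCast, one_mul, norm_pow, Real.norm_natCast]
    exact_mod_cast work_digitFnRule_le (nice_fnPre F) (nice_fnHead F) (nice_fnValue F) n

end Program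

end DynFO

namespace DynFO

variable {k K : ℕ} {σ : Schema} {n m : ℕ}

/-! ## Queries about heights -/

section Heights

variable (E : Emb k K σ)

/-- The condition that the block `c` of level `s` is left of that of `u` and contains a position
whose height is below that of `t`. -/
def belowC (s : ℕ) (c u t : Tm σ m) : Cnd σ m :=
  .and (.lt c (blockT E s u))
    (.not (heightLe (countT E) t (.app₁ (E.fn (.argmin (lev K s))) c)))

/-- The condition that a sibling of the block of `x` of level `s`, given by a digit, is right of
the block of `l`, left of that of `r`, and contains a position whose height is below that of
`l`. -/
def violationC (s : ℕ) (l r x : Fin m) : Cnd σ (m + 1) :=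
  let c := childT E (blockT E (s + 1) (.var x.castSucc)) (.var (Fin.last m))
  .and (.lt (blockT E s (.var l.castSucc)) c) (belowC E s c (.var r.castSucc) (.var l.castSucc))

/-- The condition that the heights before `l` and after `r` agree, if the height before `l` is at
most that before `r`. -/
def endC (l r : Tm σ m) : Cnd σ m :=
  .or (.and (.rel₁ (E.rel (.inr false)) r)
      (.eq (.add (countT E true r) (countT E false l))
        (.app₁ (E.fn .succ) (.add (countT E true l) (countT E false r)))))
    (.and (emptyC E r) (heightLe (countT E) r l))

/-- The condition that the word at `l, …, r` is well-balanced if the types are ignored. -/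
def balancedC (l r : Fin m) : Cnd σ m :=
  .and (.and (endC E (.var l) (.var r)) (heightLe (countT E) (.var l) (.var r)))
    (.not (.any K (List.range (K + 1)) fun s =>
      .exDigit K (.or (violationC E s l r l) (violationC E s l r r))))

variable {E} {A : Interp σ n} {v : Fin m → Fin n} {w : ℕ → Option (Paren k)} {e : ℕ}

theorem nice_belowC {s : ℕ} {c u t : Tm σ m} (hc : c.Nice K e) (hu : u.Nice K e)
    (ht : t.Nice K e) : (belowC E s c u t).Nice K e :=
  .and (.lt hc (nice_blockT hu _))
    (.not (nice_heightLe (fun _ => nice_countT ht) fun _ => nice_countT hc.app₁))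

theorem nice_violationC {s : ℕ} {l r x : Fin m} : (violationC E s l r x).Nice K e :=
  have h := nice_childT (E := E) (nice_blockT (.var x.castSucc) (s + 1)) (.var (Fin.last m))
  .and (.lt (nice_blockT (.var _) _) h) (nice_belowC h (.var _) (.var _))

theorem nice_balancedC {l r : Fin m} : (balancedC E l r).Nice K (e + 1) := by
  refine .and (.and ?_ ?_) (.not (.any fun s => .exDigit (.or nice_violationC nice_violationC)))
  · exact .or (.and (.rel₁ (.var _)) (.eq (.add (nice_countT (.var _)) (nice_countT (.var _)))
      (.app₁ (.add (nice_countT (.var _)) (nice_countT (.var _))))))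
      (.and (nice_emptyC (.var _))
        (nice_heightLe (fun _ => nice_countT (.var _)) fun _ => nice_countT (.var _)))
  · exact nice_heightLe (fun _ => nice_countT (.var _)) fun _ => nice_countT (.var _)

/-- A block left of that of `u` starts inside the domain, so its minimum is defined. Without this
guard the negated comparison would be true for empty blocks. -/
theorem eval_belowC (h : Represents E A w) {s : ℕ} (hs : s ≤ K) {c u t : Tm σ m} {c₀ x y : ℕ}
    (hc : c.num A v = if c₀ < n then some c₀ else none) (hu : u.num A v = some x)
    (ht : t.num A v = some y) : (belowC E s c u t).eval A v ↔ c₀ < x / base (K + 1) n ^ s ∧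
      ∃ i < n, i / base (K + 1) n ^ s = c₀ ∧ height w i < height w y := by
  have hb := num_blockT h.toArithmetical hu s
  rw [belowC, Cnd.eval_and, Cnd.eval_not]
  by_cases hlt : c₀ < x / base (K + 1) n ^ s
  · have hcn : c₀ < n := hlt.trans (Tm.num_lt hb)
    rw [if_pos hcn] at hc
    have hxn := Tm.num_lt hu
    have hmul : c₀ * base (K + 1) n ^ s < n := by
      have h1 := Nat.mul_le_mul_right (base (K + 1) n ^ s) hlt.le
      have h2 := Nat.div_mul_le_self x (base (K + 1) n ^ s)
      omega
    obtain ⟨q, hq, hqn, hqc, hmin⟩ := (h.argmin s hs c₀ hcn).exists_eq_some hmul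
      (Nat.mul_div_cancel _ (Nat.pow_pos (base_pos _ _)))
    rw [← Tm.num_app₁ hc] at hq
    rw [Cnd.eval_lt_iff hc hb, eval_heightLe_countT h ht hq, not_le]
    refine and_congr_right fun _ => ⟨fun hh => ⟨q, hqn, hqc, hh⟩, ?_⟩
    rintro ⟨i, hi, hic, hh⟩
    exact (hmin i hi hic).trans_lt hh
  · refine iff_of_false (fun hh => hlt ?_) (fun hh => hlt hh.1)
    obtain ⟨a, b, h1, h2, h3⟩ := Cnd.eval_lt.1 hh.1
    rw [hb] at h2
    rw [hc] at h1
    split_ifs at h1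
    simp_all

theorem eval_violationC (h : Represents E A w) {s : ℕ} (hs : s ≤ K) {l r x : Fin m} {a : Fin n} :
    (violationC E s l r x).eval A (Fin.snoc v a) ↔
      ∃ i < n, (v l : ℕ) / base (K + 1) n ^ s < i / base (K + 1) n ^ s ∧
        i / base (K + 1) n ^ s < (v r : ℕ) / base (K + 1) n ^ s ∧
        i / base (K + 1) n ^ s = (v x : ℕ) / base (K + 1) n ^ (s + 1) * base (K + 1) n + a ∧
        height w i < height w (v l) := by
  have hv : ∀ y : Fin m, (Tm.var y.castSucc : Tm σ (m + 1)).num A (Fin.snoc v a) =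
      some (v y : ℕ) := by
    intro y; rw [Tm.num_var]; simp
  have ha : (Tm.var (Fin.last m) : Tm σ (m + 1)).num A (Fin.snoc v a) = some (a : ℕ) := by
    rw [Tm.num_var]; simp
  have hc := num_childT h.toArithmetical (num_blockT h.toArithmetical (hv x) (s + 1)) ha
  have hl := num_blockT h.toArithmetical (hv l) s
  unfold violationC
  simp only
  rw [Cnd.eval_and, eval_belowC h hs hc (hv r) (hv l)]
  constructor
  · rintro ⟨h1, h2, i, hi, h3, h4⟩
    obtain ⟨b, d, e1, e2, e3⟩ := Cnd.eval_lt.1 h1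
    rw [hl] at e1
    rw [hc] at e2
    split_ifs at e2 with hlt
    simp only [Option.some.injEq] at e1 e2
    exact ⟨i, hi, by omega, by omega, h3, h4⟩
  · rintro ⟨i, hi, h1, h2, h3, h4⟩
    have hin : i / base (K + 1) n ^ s < n := (Nat.div_le_self _ _).trans_lt hi
    rw [h3] at hin
    rw [if_pos hin] at hc
    exact ⟨(Cnd.eval_lt_iff hl hc).2 (by omega), by omega, i, hi, h3, h4⟩

/-- The position `y + 1` may be outside the domain, so its height is inferred from the letter at
`y`. By `hh` that letter cannot be an opening parenthesis, and the other two cases fix the height at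
`y`. -/
theorem eval_endC (h : Represents E A w) {l r : Tm σ m} {x y : ℕ} (hl : l.num A v = some x)
    (hr : r.num A v = some y) (hh : height w x ≤ height w y) :
    (endC E l r).eval A v ↔ height w (y + 1) = height w x := by
  have hx := Tm.num_lt hl
  have hy := Tm.num_lt hr
  have c := fun b => num_countT h b hl
  have d := fun b => num_countT h b hr
  have h1 := Tm.num_add (d true) (c false)
  have h2 := Tm.num_add (c true) (d false)
  have lt1 := count_add_count_lt w hy hx
  rw [if_pos lt1] at h1
  rw [if_pos (count_add_count_lt w hx hy)] at h2
  have h3 := Tm.num_app₁ (f := E.fn .succ) h2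
  rw [h.succ _ (Tm.num_lt h2)] at h3
  rw [endC, Cnd.eval_or, Cnd.eval_and, Cnd.eval_and, eval_rel₁_isOp h hr, eval_emptyC h hr,
    eval_heightLe_countT h hr hl, Cnd.eval_eq, h1, h3]
  have heq : (∃ a, some (parenCount w true (Finset.range y) + parenCount w false (Finset.range x)) =
      some a ∧ (if parenCount w true (Finset.range x) + parenCount w false (Finset.range y) + 1 < n
        then some (parenCount w true (Finset.range x) + parenCount w false (Finset.range y) + 1)
        else none) = some a) ↔ height w y = height w x + 1 := by
    unfold height
    constructor
    · rintro ⟨a, e1, e2⟩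
      split_ifs at e2
      simp only [Option.some.injEq] at e1 e2
      omega
    · intro e
      refine ⟨_, rfl, ?_⟩
      rw [if_pos (by omega), Option.some_inj]
      omega
  rw [heq]
  match hw : w y with
  | none =>
    rw [height_succ_none hw]
    simp
    omega
  | some (.op t) =>
    rw [height_succ_op hw]
    simp [Paren.isOp]
    omega
  | some (.cl t) =>
    rw [height_succ_cl hw]
    simp [Paren.isOp]
    omega

/-- Besides the end points, each position between `l` and `r` lies in a block that is strictly
between the blocks of `l` and `r` of its level and is a sibling of one of them, so the stored minima
of these siblings decide. -/
theorem eval_balancedC (h : Represents E A w) {l r : Fin m} (hlr : v l ≤ v r) :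
    (balancedC E l r).eval A v ↔ HeightsBalanced w (v l) (v r + 1) := by
  have hlr : (v l : ℕ) ≤ v r := hlr
  have hn := (v r).2
  set B := base (K + 1) n with hBdef
  have hB : 0 < B := base_pos _ _
  have lt_pow : ∀ {i}, i < n → i / B ^ (K + 1) = 0 := fun hi =>
    Nat.div_eq_of_lt (hi.trans_le (le_base_pow (Nat.succ_ne_zero K)))
  rw [balancedC, Cnd.eval_and, Cnd.eval_and, Cnd.eval_not, Cnd.eval_any,
    eval_heightLe_countT h (Tm.num_var l) (Tm.num_var r)]
  simp only [Cnd.eval_exDigit, List.mem_range]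
  constructor
  · rintro ⟨⟨h1, h2⟩, h3⟩
    rw [eval_endC h (Tm.num_var l) (Tm.num_var r) h2] at h1
    refine ⟨h1, fun j hj1 hj2 => ?_⟩
    by_contra hlt
    rw [not_le] at hlt
    have hjl : (v l : ℕ) ≠ j := by rintro rfl; omega
    have hjr : j ≠ v r := by rintro rfl; omega
    have hjr' : j ≠ v r + 1 := by rintro rfl; omega
    have hjn : j < n := by omega
    have viol : ∀ s ≤ K, ∀ x : Fin m, (x = l ∨ x = r) → j / B ^ (s + 1) = v x / B ^ (s + 1) →
        (v l : ℕ) / B ^ s < j / B ^ s → j / B ^ s < v r / B ^ s → False := by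
      intro s hs x hx e e1 e2
      have hmod := Nat.mod_lt (j / B ^ s) hB
      have hmn : (j / B ^ s) % B < n :=
        ((Nat.mod_le _ _).trans (Nat.div_le_self _ _)).trans_lt hjn
      have key := (eval_violationC (E := E) (v := v) (l := l) (r := r) (x := x)
        (a := ⟨(j / B ^ s) % B, hmn⟩) h hs).2 ⟨j, hjn, e1, e2, by
          rw [← hBdef, ← e, div_pow_succ, mul_comm, Nat.div_add_mod], hlt⟩
      refine h3 ⟨s, by omega, ⟨(j / B ^ s) % B, hmn⟩, hmod, ?_⟩
      rw [Cnd.eval_or]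
      rcases hx with rfl | rfl
      · exact .inl key
      · exact .inr key
    -- The block of `j` is right of that of `l` below their common ancestor. If it is also left of
    -- that of `r`, a sibling of `l` is violated.
    obtain ⟨s, hs, e1, e2⟩ := exists_level_of_ne (B := B) hjl (s := K + 1)
      ((lt_pow (v l).2).trans (lt_pow hjn).symm)
    have e3 : (v l : ℕ) / B ^ s < j / B ^ s := lt_of_le_of_ne (Nat.div_le_div_right hj1) e2
    rcases (Nat.div_le_div_right (c := B ^ s) (show j ≤ v r by omega)).eq_or_lt with e4 | e4
    -- Here `j` and `r` share a block at level `s` and part at a lower level `t`. As `l` was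
    -- separated from `j` already at level `s`, a sibling of `r` is violated.
    · obtain ⟨t, ht, e5, e6⟩ := exists_level_of_ne hjr e4
      refine viol t (by omega) r (.inr rfl) e5 ?_
        (lt_of_le_of_ne (Nat.div_le_div_right (by omega)) e6)
      refine lt_of_le_of_ne (Nat.div_le_div_right hj1) fun e7 => ?_
      exact e2 (div_pow_eq_of_le e7 ht.le)
    · exact viol s (by omega) l (.inl rfl) e1.symm e3 e4
  · rintro ⟨h1, h2⟩
    have h3 := h2 (v r) hlr (by omega)
    refine ⟨⟨(eval_endC h (Tm.num_var l) (Tm.num_var r) h3).2 h1, h3⟩, ?_⟩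
    have viol : ∀ s ≤ K, ∀ (x : Fin m) (a : Fin n),
        ¬ (violationC E s l r x).eval A (Fin.snoc v a) := by
      intro s hs x a hx
      rw [eval_violationC h hs] at hx
      obtain ⟨i, _, e1, e2, _, e3⟩ := hx
      have := h2 i (lt_of_div_lt e1).le (by have := lt_of_div_lt e2; omega)
      omega
    rintro ⟨s, hs, a, _, hx⟩
    rw [Cnd.eval_or] at hx
    rcases hx with hx | hx
    · exact viol s (by omega) _ _ hx
    · exact viol s (by omega) _ _ hx

end Heights

/-! ## Finding matching positions -/

section Matching

section

variable (E : Emb k K σ)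

/-- The condition that the block of `x` of level `s` has a position left of `x` whose height is
below that of `x`. -/
def lowerInBlockC (s : ℕ) (x : Fin m) : Cnd σ m :=
  .any K (List.range s) fun t => .exDigit K (belowC E t
    (childT E (blockT E (t + 1) (.var x.castSucc)) (.var (Fin.last m)))
    (.var x.castSucc) (.var x.castSucc))

/-- The condition that the block `c` of level `s` has a position left of `x` whose height is below
that of `x`. -/
def lowerC (s : ℕ) (c : Tm σ m) (x : Fin m) : Cnd σ m :=
  .or (belowC E s c (.var x) (.var x))
    (.and (.eq c (blockT E s (.var x))) (lowerInBlockC E s x))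

variable {E} {A : Interp σ n} {v : Fin m → Fin n} {w : ℕ → Option (Paren k)} {e : ℕ}

theorem nice_lowerC {s : ℕ} {c : Tm σ m} (hc : c.Nice K (e + 1)) {x : Fin m} :
    (lowerC E s c x).Nice K (e + 1) :=
  .or (nice_belowC hc (.var _) (.var _)) (.and (.eq hc (nice_blockT (.var _) _))
    (.any fun _ => .exDigit (nice_belowC (nice_childT (nice_blockT (.var _) _) (.var _))
      (.var _) (.var _))))

/-- A position left of `x` in the same block parts from `x` at a level `t < s`, where it lies in a
left sibling of the block of `x`. -/
theorem eval_lowerInBlockC (h : Represents E A w) {s : ℕ} (hs : s ≤ K) {x : Fin m} :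
    (lowerInBlockC E s x).eval A v ↔ ∃ i < (v x : ℕ),
      i / base (K + 1) n ^ s = (v x : ℕ) / base (K + 1) n ^ s ∧ height w i < height w (v x) := by
  set B := base (K + 1) n with hBdef
  have hB : 0 < B := base_pos _ _
  have hv : ∀ a : Fin n, (Tm.var x.castSucc : Tm σ (m + 1)).num A (Fin.snoc v a) =
      some (v x : ℕ) := by
    intro a; rw [Tm.num_var]; simp
  have ha : ∀ a : Fin n, (Tm.var (Fin.last m) : Tm σ (m + 1)).num A (Fin.snoc v a) =
      some (a : ℕ) := by
    intro a; rw [Tm.num_var]; simp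
  have hc := fun t a =>
    num_childT h.toArithmetical (num_blockT h.toArithmetical (hv a) (t + 1)) (ha a)
  rw [lowerInBlockC, Cnd.eval_any]
  simp only [Cnd.eval_exDigit, List.mem_range]
  constructor
  · rintro ⟨t, ht, a, haB, hx⟩
    rw [eval_belowC h (by omega) (hc t a) (hv a) (hv a)] at hx
    obtain ⟨h1, i, hi, h2, h3⟩ := hx
    rw [← h2] at h1
    refine ⟨i, lt_of_div_lt h1, div_pow_eq_of_le ?_ (show t + 1 ≤ s by omega), h3⟩
    rw [div_pow_succ, h2, mul_comm, Nat.mul_add_div hB, Nat.div_eq_of_lt haB, add_zero]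
  · rintro ⟨i, hi, h1, h2⟩
    obtain ⟨t, ht, h3, h4⟩ := exists_level_of_ne hi.ne h1
    have hmod := Nat.mod_lt (i / B ^ t) hB
    have hxn := (v x).2
    have hmn : (i / B ^ t) % B < n :=
      ((Nat.mod_le _ _).trans (Nat.div_le_self _ _)).trans_lt (by omega)
    have e1 : (v x : ℕ) / B ^ (t + 1) * B + (i / B ^ t) % B = i / B ^ t := by
      rw [← h3, div_pow_succ, mul_comm, Nat.div_add_mod]
    refine ⟨t, ht, ⟨_, hmn⟩, hmod, ?_⟩
    rw [eval_belowC h (by omega) (hc t _) (hv _) (hv _)]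
    refine ⟨?_, i, by omega, e1.symm, h2⟩
    show (v x : ℕ) / B ^ (t + 1) * B + (i / B ^ t) % B < _
    rw [e1]
    exact lt_of_le_of_ne (Nat.div_le_div_right hi.le) h4

theorem eval_lowerC (h : Represents E A w) {s : ℕ} (hs : s ≤ K) {c : Tm σ m} {c₀ : ℕ}
    (hc : c.num A v = if c₀ < n then some c₀ else none) {x : Fin m} :
    (lowerC E s c x).eval A v ↔ ∃ i < (v x : ℕ),
      i / base (K + 1) n ^ s = c₀ ∧ height w i < height w (v x) := by
  have hb := num_blockT h.toArithmetical (Tm.num_var (A := A) (v := v) x) s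
  have hxn := (v x).2
  rw [lowerC, Cnd.eval_or, eval_belowC h hs hc (Tm.num_var x) (Tm.num_var x), Cnd.eval_and,
    eval_lowerInBlockC h hs, Cnd.eval_eq]
  constructor
  · rintro (⟨h1, i, _, h2, h3⟩ | ⟨⟨a, h1, h2⟩, i, hi, h3, h4⟩)
    · exact ⟨i, lt_of_div_lt (h2 ▸ h1), h2, h3⟩
    · rw [hc] at h1
      rw [hb] at h2
      split_ifs at h1
      simp only [Option.some.injEq] at h1 h2
      exact ⟨i, hi, by omega, h4⟩
  · rintro ⟨i, hi, h1, h2⟩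
    rcases (Nat.div_le_div_right (c := base (K + 1) n ^ s) hi.le).eq_or_lt with h3 | h3
    · have hin : i / base (K + 1) n ^ s < n := (Nat.div_le_self _ _).trans_lt (by omega)
      rw [h1] at hin
      rw [if_pos hin] at hc
      exact .inr ⟨⟨c₀, hc, by rw [hb, ← h3, h1]⟩, i, hi, h3, h2⟩
    · exact .inl ⟨by omega, i, by omega, h1, h2⟩

end

/-- The block of level `K - i + 1` that contains the position matching `x`. -/
def matchParentT (i : ℕ) (x : Fin m) : Tm ((auxSchema k K).sum (locSchema K)) m :=
  if i = 0 then blockT (Emb.inl k K) (K + 1) (.var x) else locT (K - i + 1) (.var x)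

/-- The block of level `K - i` that contains the position matching `x`. -/
def matchT (i : ℕ) (x : Fin m) : Tm ((auxSchema k K).sum (locSchema K)) m :=
  childT (Emb.inl k K) (matchParentT i x)
    (.greatest K (lowerC (Emb.inl k K) (K - i)
      (childT (Emb.inl k K) (matchParentT i x.castSucc) (.var (Fin.last m))) x.castSucc) (.var x))

/-- The computation of the blocks of the `i` highest levels that contain the position
matching the last variable. -/
def descend : ℕ → Step (auxSchema k K) (locSchema K) 2 1
  | 0 => .skip
  | i + 1 => .seq (descend i) (.assignFn (lev K (K - i)) (fun _ => .var 2) (matchT i 2)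
      fun j => ⟨by have := j.2; show (j : ℕ) < 1; omega, by
        obtain rfl : j = 0 := Subsingleton.elim _ _
        rfl⟩)

theorem nice_matchParentT {i : ℕ} {x : Fin m} {e : ℕ} :
    (matchParentT (k := k) (K := K) i x).Nice K e := by
  unfold matchParentT
  split_ifs
  · exact nice_blockT (.var _) _
  · exact .app₁ (.var _)

theorem nice_matchT {i : ℕ} {x : Fin m} : (matchT (k := k) (K := K) i x).Nice K 3 :=
  nice_childT nice_matchParentT (.greatest (e := 1)
    (nice_lowerC (e := 0) (nice_childT nice_matchParentT (.var _))) (.var _))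

theorem nice_descend : ∀ i, (descend (k := k) (K := K) i).Nice K 3
  | 0 => .skip
  | i + 1 => (nice_descend i).seq (.assignFn (fun _ => .var _) nice_matchT)

variable {A : Interp (auxSchema k K) n} {L : Interp (locSchema K) n} {v : Fin m → Fin n}
  {w : ℕ → Option (Paren k)}

/-- The match `y` is the last position left of `x` with smaller height, so its child is the
rightmost one that contains such a position. -/
theorem num_matchT (h : Represents (Emb.refl k K) A w) {i : ℕ} (hi : i ≤ K) {x : Fin m} {y : ℕ}
    (hy : IsMatch w y (v x))
    (hL : i ≠ 0 → L.num (lev K (K - i + 1)) (v x) = some (y / base (K + 1) n ^ (K - i + 1))) :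
    (matchT i x).num (A.sum L) v = some (y / base (K + 1) n ^ (K - i)) := by
  set B := base (K + 1) n with hBdef
  have hB : 0 < B := base_pos _ _
  have h' := h.sum L
  have hxn := (v x).2
  have hyx := hy.1
  have lt_pow : ∀ {i}, i < n → i / B ^ (K + 1) = 0 := fun hi =>
    Nat.div_eq_of_lt (hi.trans_le (le_base_pow (Nat.succ_ne_zero K)))
  have hpar : ∀ {m' : ℕ} (v' : Fin m' → Fin n) (x' : Fin m'), v' x' = v x →
      (matchParentT i x').num (A.sum L) v' = some (y / B ^ (K - i + 1)) := by
    intro m' v' x' hx'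
    unfold matchParentT
    split_ifs with h0
    · rw [num_blockT h'.toArithmetical (Tm.num_var x'), hx', h0, Nat.sub_zero, ← hBdef,
        lt_pow hxn, lt_pow (by omega)]
    · rw [locT, Tm.num_app₁ (Tm.num_var x'), hx']
      exact hL h0
  have hmod := Nat.mod_lt (y / B ^ (K - i)) hB
  have hmn : (y / B ^ (K - i)) % B < n :=
    ((Nat.mod_le _ _).trans (Nat.div_le_self _ _)).trans_lt (by omega)
  have hsum : y / B ^ (K - i + 1) * B + (y / B ^ (K - i)) % B = y / B ^ (K - i) := by
    rw [div_pow_succ, mul_comm, Nat.div_add_mod]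
  have hlow : ∀ a : Fin n, (lowerC (Emb.inl k K) (K - i)
      (childT (Emb.inl k K) (matchParentT i x.castSucc) (.var (Fin.last m))) x.castSucc).eval
        (A.sum L) (Fin.snoc v a) ↔ ∃ j < (v x : ℕ),
          j / B ^ (K - i) = y / B ^ (K - i + 1) * B + a ∧ height w j < height w (v x) := by
    intro a
    have ha : (Tm.var (Fin.last m) : Tm ((auxSchema k K).sum (locSchema K)) (m + 1)).num (A.sum L)
        (Fin.snoc v a) = some (a : ℕ) := by
      rw [Tm.num_var]; simp
    have hc := num_childT h'.toArithmetical (hpar (Fin.snoc v a) x.castSucc (by simp)) ha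
    rw [eval_lowerC h' (by omega) hc]
    simp only [Fin.snoc_castSucc]
    exact Iff.rfl
  obtain ⟨a, ha, haB, haL, hmax⟩ := Tm.num_greatest K (d := .var x) ⟨⟨_, hmn⟩, hmod, (hlow _).2
    ⟨y, hyx, hsum.symm, hy.2.1⟩⟩
  have hle := hmax ⟨_, hmn⟩ hmod ((hlow _).2 ⟨y, hyx, hsum.symm, hy.2.1⟩)
  have hle : (y / B ^ (K - i)) % B ≤ a := hle
  obtain ⟨j, hj, e1, e2⟩ := (hlow a).1 haL
  -- Maximality places the chosen child at or right of that of `y`. Its witness `j` cannot lie right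
  -- of `y`, so both are in the same child.
  have hjy : j ≤ y := by
    by_contra hjy
    have := hy.2.2 j (by omega) hj
    omega
  have hdiv := Nat.div_le_div_right (c := B ^ (K - i)) hjy
  have heq : (a : ℕ) = (y / B ^ (K - i)) % B := by omega
  unfold matchT
  rw [num_childT h'.toArithmetical (hpar v x rfl) ha, ← hBdef, heq, hsum, if_pos]
  exact (Nat.div_le_self _ _).trans_lt (by omega)

/-- After `i` rounds the levels `s ≥ K + 1 - i` are settled. After `K + 1` rounds level `0` holds
the match itself. -/
theorem num_descend (h : Represents (Emb.refl k K) A w) {v : Fin (2 + 1) → Fin n} {y : ℕ}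
    (hy : IsMatch w y (v 2)) : ∀ i ≤ K + 1, ∀ s ≤ K, K + 1 ≤ s + i →
      ((descend i).run A v L).num (lev K s) (v 2) = some (y / base (K + 1) n ^ s) := by
  intro i
  induction i with
  | zero => intro _ s hs h1; omega
  | succ i ih =>
    intro hi s hs h1
    have h2 : ∀ L, (Tm.var 2 : Tm ((auxSchema k K).sum (locSchema K)) (2 + 1)).num (A.sum L) v =
        some (v 2 : ℕ) := fun L => Tm.num_var 2
    rw [descend, Step.run]
    by_cases hsi : s = K - i
    · rw [hsi, Step.num_run_assignFn (h2 _)]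
      exact num_matchT h (by omega) hy fun h0 => ih (by omega) _ (by omega) (by omega)
    · rw [Step.num_run_assignFn_of_ne (lev_ne hs (by omega) hsi)]
      exact ih (by omega) s hs (by omega)

end Matching

end DynFO

namespace DynFO

variable {k K : ℕ} {n : ℕ}

/-! ## Query rules -/

section Queries

theorem or_congr_of_not {a a' b b' : Prop} (h : a ↔ a') (h' : ¬ a' → (b ↔ b')) :
    a ∨ b ↔ a' ∨ b' := by
  by_cases ha : a'
  · simp [h, ha]
  · rw [h, h' ha]

/-- The query rule for one type of parentheses. -/
def dyckOneQuery (K : ℕ) : QueryRule (auxSchema 1 K) 2 where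
  loc := locSchema K
  body := .ret (.or (.lt (.var 1) (.var 0)) (balancedC (Emb.inl 1 K) 0 1))

theorem dyckOneQuery_work_le (n : ℕ) : (dyckOneQuery K).work n ≤ base (K + 1) n ^ 4 :=
  (Cnd.Nice.or (K := K) (.lt (.var _) (.var _)) (nice_balancedC (e := 3))).work n

theorem dyckOneQuery_correct (A : Interp (auxSchema 1 K) n) (I : Fin n → Option (Paren 1))
    (h : Represents (Emb.refl 1 K) A (extend I)) (p : Fin 2 → Fin n) :
    (dyckOneQuery K).Safe A p ∧
      ((dyckOneQuery K).Holds A p ↔ factor I (p 0) (p 1) ∈ dyck 1) := by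
  refine ⟨⟨trivial, (Cnd.Nice.or (K := K) (.lt (.var _) (.var _))
    (nice_balancedC (e := 0))).safe _ _⟩, ?_⟩
  have h' := h.sum (Interp.empty (locSchema K) n)
  rw [factor_mem_dyck_iff]
  refine Cnd.eval_or.trans ?_
  refine or_congr_of_not ?_ ?_
  · exact Cnd.eval_lt_iff (Tm.num_var 1) (Tm.num_var 0)
  · intro hlr
    refine (eval_balancedC h' (l := (0 : Fin 2)) (r := 1) (not_lt.1 hlr)).trans ?_
    rw [and_iff_left (typesMatch_of_subsingleton _ _ _)]

/-- The condition that there is a closing parenthesis in the range from variable `0` to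
variable `1` that is not matched with an opening one of the same type. -/
def mismatchC (k K : ℕ) : Cnd ((auxSchema k K).sum (locSchema K)) 2 :=
  .ex fullBound (.and (.and (.le (.var 0) (.var 2)) (.le (.var 2) (.var 1)))
    (.any K (List.finRange k) fun t =>
      .and (.rel₁ ((Emb.inl k K).rel (.inl (.cl t))) (.var 2))
        (.not (.rel₁ ((Emb.inl k K).rel (.inl (.op t))) (locT 0 (.var 2))))))

/-- The query rule for several types of parentheses. -/
def dyckQuery (k K : ℕ) : QueryRule (auxSchema k K) 2 where
  loc := locSchema K
  body := .step (.par fullBound (descend (K + 1)))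
    (.ret (.or (.lt (.var 1) (.var 0)) (.and (balancedC (Emb.inl k K) 0 1) (.not (mismatchC k K)))))

theorem nice_mismatch_body :
    (Cnd.and (.and (.le (.var 0) (.var 2)) (.le (.var 2) (.var 1)))
    (.any K (List.finRange k) fun t =>
      .and (.rel₁ ((Emb.inl k K).rel (.inl (.cl t))) (.var 2))
        (.not (.rel₁ ((Emb.inl k K).rel (.inl (.op t))) (locT 0 (.var 2))))) :
      Cnd ((auxSchema k K).sum (locSchema K)) 3).Nice K 4 :=
  .and (.and (.le (.var _) (.var _)) (.le (.var _) (.var _)))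
    (.any fun _ => .and (.rel₁ (.var _)) (.not (.rel₁ (.app₁ (.var _)))))

theorem dyckQuery_work_le (n : ℕ) : (dyckQuery k K).work n ≤ (n + 1) * base (K + 1) n ^ 4 := by
  have le_mul : ∀ {x}, x ≤ base (K + 1) n ^ 4 → x ≤ (n + 1) * base (K + 1) n ^ 4 :=
    fun h => h.trans (Nat.le_mul_of_pos_left _ (Nat.succ_pos n))
  refine max_le ?_ (max_le ?_ (max_le ?_ ?_))
  · exact Nat.mul_le_mul_left _ (((nice_descend (K + 1)).work n).trans
      (Nat.pow_le_pow_right (base_pos _ _) (by norm_num)))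
  · exact le_mul ((Cnd.Nice.lt (K := K) (.var _) (.var _)).work n)
  · exact le_mul ((nice_balancedC (e := 3)).work n)
  · exact Nat.mul_le_mul_left _ (nice_mismatch_body.work n)

theorem num_run_par {A : Interp (auxSchema k K) n} {L : Interp (locSchema K) n}
    {P : Step (auxSchema k K) (locSchema K) 2 1} {p : Fin 2 → Fin n} (f : Fin (K + 1))
    (j : Fin n) : ((Step.par fullBound P : Step _ _ 2 0).run A p L).num f j =
      (P.run A (Fin.snoc p j : Fin (2 + 1) → Fin n) L).num f j := by
  rw [Interp.num_of_lt _ _ j.2, Interp.num_of_lt _ _ j.2, Step.run]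
  simp only
  rw [dif_pos ⟨Nat.one_pos, j.2.le⟩]

/-- Values computed for positions without a match are meaningless. They do no harm: types are
compared only at closing parentheses of a range whose heights are balanced, and these have matches.
-/
theorem dyckQuery_correct (A : Interp (auxSchema k K) n) (I : Fin n → Option (Paren k))
    (h : Represents (Emb.refl k K) A (extend I)) (p : Fin 2 → Fin n) :
    (dyckQuery k K).Safe A p ∧
      ((dyckQuery k K).Holds A p ↔ factor I (p 0) (p 1) ∈ dyck k) := by
  constructor
  · refine ⟨⟨?_, trivial⟩, ⟨?_, ?_, ?_⟩⟩
    · exact fun a _ => (nice_descend (K + 1)).safe _ _ _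
    · exact (Cnd.Nice.lt (K := K) (e := 0) (.var _) (.var _)).safe _ _
    · exact (nice_balancedC (e := 0)).safe _ _
    · exact fun a _ => nice_mismatch_body.safe _ _
  set L := (Step.par fullBound (descend (K + 1)) : Step _ _ 2 0).run A p
    (Interp.empty (locSchema K) n) with hL
  have h' := h.sum L
  rw [factor_mem_dyck_iff]
  refine Cnd.eval_or.trans ?_
  refine or_congr_of_not ?_ ?_
  · exact Cnd.eval_lt_iff (Tm.num_var 1) (Tm.num_var 0)
  intro hlr
  refine Cnd.eval_and.trans ?_
  change (balancedC (Emb.inl k K) 0 1).eval (A.sum L) p ∧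
    (mismatchC k K).not.eval (A.sum L) p ↔ _
  rw [Cnd.eval_not]
  have hb := eval_balancedC h' (l := (0 : Fin 2)) (r := 1) (v := p) (not_lt.1 hlr)
  refine (and_congr_left' hb).trans (and_congr_right fun hbal => ?_)
  have hmatch : ∀ j : Fin n, (p 0 : ℕ) ≤ j → (j : ℕ) ≤ p 1 → ∀ t,
      extend I j = some (.cl t) → ∃ i, IsMatch (extend I) i j ∧
        ((Cnd.rel₁ ((Emb.inl k K).rel (.inl (.op t))) (locT 0 (.var 2))).eval (A.sum L)
          (Fin.snoc p j : Fin (2 + 1) → Fin n) ↔ extend I i = some (.op t)) := by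
    intro j h1 h2 t ht
    have h3 := height_succ_cl ht
    have h4 := hbal.2 (j + 1) (by omega) (by omega)
    -- A closing parenthesis at the left end would violate the balance. So `j` has a larger height
    -- than the left end, which yields a match.
    have h5 : (p 0 : ℕ) ≠ j := by
      intro e
      rw [e] at h4
      omega
    obtain ⟨i, _, hi⟩ := exists_isMatch (extend I) (l := p 0) (j := j) (by omega) (by omega)
    have hnum := num_descend (L := Interp.empty (locSchema K) n) h
      (v := (Fin.snoc p j : Fin (2 + 1) → Fin n)) hi (K + 1) le_rfl 0 (Nat.zero_le _) (by omega)
    refine ⟨i, hi, ?_⟩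
    have hloc : (locT 0 (.var 2) : Tm ((auxSchema k K).sum (locSchema K)) 3).num (A.sum L)
        (Fin.snoc p j : Fin (2 + 1) → Fin n) = some i := by
      rw [locT, Tm.num_app₁ (Tm.num_var 2), num_sum_inr, hL]
      refine (num_run_par _ j).trans (hnum.trans ?_)
      rw [pow_zero, Nat.div_one]
    rw [eval_rel₁ h' hloc]
    simp only [RelSym.Sat]
    constructor
    · rintro ⟨x, e, rfl⟩
      exact e
    · exact fun e => ⟨_, e, rfl⟩
  have hcl : ∀ (j : Fin n) (t : Fin k),
      (Cnd.rel₁ ((Emb.inl k K).rel (.inl (.cl t))) (.var 2)).eval (A.sum L)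
        (Fin.snoc p j : Fin (2 + 1) → Fin n) ↔ extend I j = some (.cl t) := by
    intro j t
    rw [eval_rel₁ h' (Tm.num_var 2)]
    constructor
    · rintro ⟨x, e, hx⟩
      cases hx
      exact e
    · exact fun e => ⟨_, e, rfl⟩
  unfold mismatchC
  rw [Cnd.eval_ex]
  simp only [Cnd.eval_and, Cnd.eval_any, Cnd.eval_not]
  have hle : ∀ j : Fin n, (((Cnd.le (.var 0) (.var 2)) :
      Cnd ((auxSchema k K).sum (locSchema K)) 3).eval (A.sum L)
        (Fin.snoc p j : Fin (2 + 1) → Fin n) ↔ (p 0 : ℕ) ≤ j) ∧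
      (((Cnd.le (.var 2) (.var 1)) :
      Cnd ((auxSchema k K).sum (locSchema K)) 3).eval (A.sum L)
        (Fin.snoc p j : Fin (2 + 1) → Fin n) ↔ (j : ℕ) ≤ p 1) := fun j =>
    ⟨Cnd.eval_le_iff (Tm.num_var 0) (Tm.num_var 2), Cnd.eval_le_iff (Tm.num_var 2) (Tm.num_var 1)⟩
  constructor
  · intro hno j h1 h2 t ht i hi
    have hjn : j < n := by have := (p 1).2; omega
    obtain ⟨i', hi', hop⟩ := hmatch ⟨j, hjn⟩ h1 (by simp; omega) t ht
    rw [hi.unique hi', ← hop]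
    by_contra hne
    exact hno ⟨⟨j, hjn⟩, hjn.le, ⟨(hle _).1.2 h1, (hle _).2.2 (by simp; omega)⟩, t,
      List.mem_finRange t, (hcl _ t).2 ht, hne⟩
  · rintro htm ⟨j, _, ⟨h1, h2⟩, t, _, ht, hne⟩
    have h1 := (hle j).1.1 h1
    have h2 := (hle j).2.1 h2
    have ht := (hcl j t).1 ht
    obtain ⟨i, hi, hop⟩ := hmatch j h1 h2 t ht
    exact hne (hop.2 (htm j h1 (by omega) t ht i hi))

end Queries

/-! ## Work bounds -/

theorem isBigO_base_pow {ε : ℝ} (hK : 4 / (K + 1 : ℝ) ≤ ε) :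
    Asymptotics.IsBigO Filter.atTop (fun n : ℕ => ((base (K + 1) n : ℝ)) ^ 4)
      fun n : ℕ => (n : ℝ) ^ ε := by
  -- The base is at most twice the real root of `n`, and `2 ^ 4 = 16`.
  refine .of_bound 16 ?_
  filter_upwards [Filter.eventually_ge_atTop 1] with n hn
  have hn1 : (1 : ℝ) ≤ n := by exact_mod_cast hn
  have hK1 : (0 : ℝ) < K + 1 := by positivity
  have h1 : ((root (K + 1) n : ℕ) : ℝ) ≤ (n : ℝ) ^ (1 / (K + 1 : ℝ)) := by
    have h2 : ((root (K + 1) n : ℕ) : ℝ) ^ (K + 1 : ℝ) ≤ n := by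
      have := root_pow_lt (Nat.succ_ne_zero K) hn
      have h3 : ((root (K + 1) n : ℕ) : ℝ) ^ (K + 1) ≤ n := by exact_mod_cast this.le
      rw [← Real.rpow_natCast] at h3
      push_cast at h3
      exact h3
    calc ((root (K + 1) n : ℕ) : ℝ)
        = (((root (K + 1) n : ℕ) : ℝ) ^ (K + 1 : ℝ)) ^ (1 / (K + 1 : ℝ)) := by
          rw [← Real.rpow_mul (Nat.cast_nonneg _), mul_one_div_cancel hK1.ne', Real.rpow_one]
      _ ≤ _ := Real.rpow_le_rpow (by positivity) h2 (by positivity)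
  have h4 : (1 : ℝ) ≤ (n : ℝ) ^ (1 / (K + 1 : ℝ)) := Real.one_le_rpow hn1 (by positivity)
  have h5 : (base (K + 1) n : ℝ) ≤ 2 * (n : ℝ) ^ (1 / (K + 1 : ℝ)) := by
    unfold base
    push_cast
    linarith
  rw [Real.norm_of_nonneg (by positivity), Real.norm_of_nonneg (by positivity)]
  calc (base (K + 1) n : ℝ) ^ 4 ≤ (2 * (n : ℝ) ^ (1 / (K + 1 : ℝ))) ^ 4 :=
        pow_le_pow_left₀ (Nat.cast_nonneg _) h5 4
    _ = 16 * (n : ℝ) ^ (4 / (K + 1 : ℝ)) := by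
        rw [mul_pow, ← Real.rpow_mul_natCast (Nat.cast_nonneg n)]
        norm_num
        congr 1
        ring
    _ ≤ 16 * (n : ℝ) ^ ε := by
        have := Real.rpow_le_rpow_of_exponent_le hn1 hK
        linarith

theorem isBigO_mul_base_pow {ε : ℝ} (hK : 4 / (K + 1 : ℝ) ≤ ε) :
    Asymptotics.IsBigO Filter.atTop (fun n : ℕ => ((n : ℝ) + 1) * ((base (K + 1) n : ℝ)) ^ 4)
      fun n : ℕ => (n : ℝ) ^ (1 + ε) := by
  have h1 : Asymptotics.IsBigO Filter.atTop (fun n : ℕ => (n : ℝ) + 1) fun n : ℕ => (n : ℝ) := by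
    refine .of_bound 2 ?_
    filter_upwards [Filter.eventually_ge_atTop 1] with n hn
    have hn1 : (1 : ℝ) ≤ n := by exact_mod_cast hn
    rw [Real.norm_of_nonneg (by positivity), Real.norm_of_nonneg (by positivity)]
    linarith
  refine (h1.mul (isBigO_base_pow hK)).congr' Filter.EventuallyEq.rfl ?_
  filter_upwards [Filter.eventually_ge_atTop 1] with n hn
  rw [Real.rpow_add (by exact_mod_cast hn), Real.rpow_one]

end DynFO

theorem mainTheorem7 (ε : ℝ) (hε : 0 < ε) (k : ℕ) (hk : 1 < k) :
    DynFO.MaintainableWithWork (DynFO.RangeMember (dyck 1))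
      (fun n : ℕ => (n : ℝ) ^ ε) (fun n : ℕ => (n : ℝ) ^ ε) ∧
    DynFO.MaintainableWithWork (DynFO.RangeMember (dyck k))
      (fun n : ℕ => (n : ℝ) ^ ε) (fun n : ℕ => (n : ℝ) ^ (1 + ε)) := by
  -- All costs per change, and per position in a query, are at most the fourth power of the base,
  -- that is `O(n ^ (4 / (K + 1)))`.
  obtain ⟨K, hK⟩ := exists_nat_ge (4 / ε)
  have hK : 4 / (K + 1 : ℝ) ≤ ε := by
    rw [div_le_iff₀ hε] at hK
    rw [div_le_iff₀ (by positivity)]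
    linarith
  refine ⟨⟨DynFO.dyckProgram 1 K (DynFO.dyckOneQuery K),
      DynFO.dyckProgram_maintains DynFO.dyckOneQuery_correct,
      DynFO.dyckProgram_changeWork (DynFO.isBigO_base_pow hK), fun _ => ?_⟩,
    ⟨DynFO.dyckProgram k K (DynFO.dyckQuery k K),
      DynFO.dyckProgram_maintains DynFO.dyckQuery_correct,
      DynFO.dyckProgram_changeWork (DynFO.isBigO_base_pow hK), fun _ => ?_⟩⟩
  · refine Asymptotics.IsBigO.trans (.of_bound 1 (.of_forall fun n => ?_))
      (DynFO.isBigO_base_pow hK)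
    rw [Real.norm_natCast, one_mul, norm_pow, Real.norm_natCast]
    exact_mod_cast DynFO.dyckOneQuery_work_le n
  · refine Asymptotics.IsBigO.trans (.of_bound 1 (.of_forall fun n => ?_))
      (DynFO.isBigO_mul_base_pow hK)
    rw [Real.norm_natCast, one_mul, Real.norm_of_nonneg (by positivity)]
    exact_mod_cast DynFO.dyckQuery_work_le n
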